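/- Let $F\subset\mathbb R$ be a real quadratic field with Galois conjugation $x\mapsto x'$ and ring of integers $\mathcal O_F$, let $\mathfrak a$ be a nonzero fractional ideal of $F$ and $\kappa$ a positive integer. Put $N:=\mathrm{Nm}(\mathfrak a)/\kappa$, let $L=\mathfrak a$ with the quadratic form $x\mapsto xx'/N$ and bilinear form $\mathrm{Tr}(xy')/N$, and let $L^\vee\subset F$ be its dual lattice. Let $\varepsilon_\kappa$ be the smallest totally positive unit $\varepsilon>1$ of $\mathcal O_F$ with $(\varepsilon-1)L^\vee\subset L$, and let $$M=M_{\mathfrak a,\kappa}:=\left\{\begin{pmatrix}\lambda_1&\lambda_2\\ \lambda_2'&\lambda_1'\end{pmatrix}:\ \lambda_1,\lambda_2\in L^\vee,\ \lambda_1-\lambda_2\in L\right\}\subset M_2(\mathbb R).$$ On $M_2(\mathbb R)$ let $Q=\det/N$, with bilinear form $(A,B)=Q(A+B)-Q(A)-Q(B)$. For $t,t_0\in\mathbb R$ put $$X(t)=\sqrt N\begin{pmatrix}e^t&0\\0&-e^{-t}\end{pmatrix},\quad Y(t_0)=\sqrt N\begin{pmatrix}0&e^{t_0}\\e^{-t_0}&0\end{pmatrix},\quad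 X^\perp(t)=\sqrt N\begin{pmatrix}e^t&0\\0&e^{-t}\end{pmatrix},\quad Y^\perp(t_0)=\sqrt N\begin{pmatrix}0&e^{t_0}\\-e^{-t_0}&0\end{pmatrix},$$ and write $\lambda_w$ and $\lambda_{w^\perp}$ for the orthogonal projections of $\lambda$ to the planes spanned by $X(t),Y(t_0)$ and by $X^\perp(t),Y^\perp(t_0)$, respectively. For $\tau=u+iv$ in the upper half-plane $\mathcal H$ let $$\Theta_M(\tau,t,t_0;\phi)=\sum_{\lambda\in M}(\lambda,X(t))\,(\lambda,Y^\perp(t_0))\,e^{2\pi i\left(Q(\lambda_{w^\perp})\tau+Q(\lambda_w)\overline\tau\right)},$$ and, with $\Gamma=\mathrm{SL}_2(\mathbb Z)$, $$\Phi(t,t_0)=\int_{\Gamma\backslash\mathcal H}v^2\,\Theta_M(\tau,t,t_0;\phi)\,\frac{du\,dv}{v^2},\qquad I(t_0;\phi,\varphi_M)=\int_0^{\log\varepsilon_\kappa}\Phi(t,t_0)\,dt,$$ the integral over $\Gamma\backslash\mathcal H$ being taken over the standard fundamental domain. Then these objects are well defined: $\varepsilon_\kappa$ exists, the series converges absolutely,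 $v^2\Theta_M$ is $\Gamma$-invariant in $\tau$ and integrable on the fundamental domain, and $\Phi(t,t_0)$ is periodic in $t$ with period $\log\varepsilon_\kappa$ and integrable on $[0,\log\varepsilon_\kappa]$. Moreover, $I(t_0;\phi,\varphi_{M_{\mathfrak a,\kappa}})$ does not depend on $t_0$, and for the fixed field $F$ it depends only on $\kappa$ and on the class of $\mathfrak a$ in the narrow class group of $F$ (fractional ideals modulo principal ideals with a totally positive generator): there is a function $C$ on $\mathrm{Cl}^+(F)\times\mathbb Z_{>0}$ such that $I(t_0;\phi,\varphi_{M_{\mathfrak a,\kappa}})=C([\mathfrak a],\kappa)$ for all $\mathfrak a$, $\kappa$ and $t_0\in\mathbb R$. -/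

import Mathlib

open scoped NumberField nonZeroDivisors MatrixGroups Modular UpperHalfPlane ComplexConjugate
open MeasureTheory

namespace HeckeCycle

noncomputable section

/-! ### The narrow class group -/

/-- Totally positive elements: positive under every real embedding. -/
def TotPos {F : Type*} [Field F] (x : F) : Prop := ∀ φ : F →+* ℝ, 0 < φ x

/-- The group of totally positive elements of `Fˣ`. -/
def totPosUnits (F : Type*) [Field F] : Subgroup Fˣ where
  carrier := {x | TotPos (x : F)}
  mul_mem' := by
    intro a b ha hb φ
    rw [Units.val_mul, map_mul]
    exact mul_pos (ha φ) (hb φ)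
  one_mem' := by
    intro φ
    simp
  inv_mem' := by
    intro a ha φ
    rw [Units.val_inv_eq_inv_val, map_inv₀]
    exact inv_pos.mpr (ha φ)

/-- The narrow class group: invertible fractional ideals modulo principal ideals that have a
totally positive generator. -/
abbrev NarrowClassGroup (F : Type*) [Field F] [NumberField F] : Type _ :=
  (FractionalIdeal (𝓞 F)⁰ F)ˣ ⧸ (totPosUnits F).map (toPrincipalIdeal (𝓞 F) F)

/-- The narrow ideal class of a fractional ideal. -/
def narrowClass {F : Type*} [Field F] [NumberField F] (𝔞 : (FractionalIdeal (𝓞 F)⁰ F)ˣ) :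
    NarrowClassGroup F :=
  QuotientGroup.mk 𝔞

/-! ### The lattices `L`, `L^∨` and `M`

Here `c` is the Galois conjugation `x ↦ x'` of the real quadratic field `F`, `𝔞` is a fractional
ideal, `κ` is a positive integer and `N = Nm(𝔞) / κ`. -/

section Lattices

variable {F : Type*} [Field F] [NumberField F]

/-- The rational number `N = Nm(𝔞) / κ`, so that `κ = Nm(𝔞) / N`. -/
def levelN (𝔞 : (FractionalIdeal (𝓞 F)⁰ F)ˣ) (κ : ℕ+) : ℚ :=
  FractionalIdeal.absNorm (𝔞 : FractionalIdeal (𝓞 F)⁰ F) / (κ : ℕ)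

/-- The bilinear form `(x, y) = Tr(x y') / N` on `F`; it is the bilinear form
`Q(x + y) - Q(x) - Q(y)` of the quadratic form `Q = Nm / N`. -/
def fieldForm (c : F ≃ₐ[ℚ] F) (N : ℚ) (x y : F) : ℚ := Algebra.trace ℚ F (x * c y) / N

/-- The underlying group of the lattice `L = (𝔞, Nm / N)`. -/
def latticeL (𝔞 : (FractionalIdeal (𝓞 F)⁰ F)ˣ) : AddSubgroup F :=
  ((𝔞 : FractionalIdeal (𝓞 F)⁰ F) : Submodule (𝓞 F) F).toAddSubgroup

/-- The dual lattice `L^∨` of `L = (𝔞, Nm / N)`. -/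
def dualL (c : F ≃ₐ[ℚ] F) (𝔞 : (FractionalIdeal (𝓞 F)⁰ F)ˣ) (κ : ℕ+) : AddSubgroup F where
  carrier := {x | ∀ y ∈ latticeL 𝔞, ∃ n : ℤ, fieldForm c (levelN 𝔞 κ) x y = n}
  add_mem' := by
    intro a b ha hb y hy
    obtain ⟨m, hm⟩ := ha y hy
    obtain ⟨n, hn⟩ := hb y hy
    refine ⟨m + n, ?_⟩
    rw [Int.cast_add, ← hm, ← hn]
    simp only [fieldForm, add_mul, map_add, add_div]
  zero_mem' := by
    intro y _
    exact ⟨0, by simp [fieldForm]⟩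
  neg_mem' := by
    intro a ha y hy
    obtain ⟨m, hm⟩ := ha y hy
    refine ⟨-m, ?_⟩
    rw [Int.cast_neg, ← hm]
    simp only [fieldForm, neg_mul, map_neg, neg_div]

/-- The matrix with rows `(l₁, l₂)` and `(l₂', l₁')`, an element of the rational quadratic space
`V` of signature `(2, 2)`. -/
def vMat (c : F ≃ₐ[ℚ] F) (l₁ l₂ : F) : Matrix (Fin 2) (Fin 2) F := !![l₁, l₂; c l₂, c l₁]

/-- The lattice `M` of all matrices with rows `(l₁, l₂)` and `(l₂', l₁')` such that
`l₁, l₂ ∈ L^∨` and `l₁ - l₂ ∈ L`. -/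
def latticeM (c : F ≃ₐ[ℚ] F) (𝔞 : (FractionalIdeal (𝓞 F)⁰ F)ˣ) (κ : ℕ+) :
    AddSubgroup (Matrix (Fin 2) (Fin 2) F) where
  carrier := {A | ∃ l₁ ∈ dualL c 𝔞 κ, ∃ l₂ ∈ dualL c 𝔞 κ, l₁ - l₂ ∈ latticeL 𝔞 ∧ A = vMat c l₁ l₂}
  add_mem' := by
    rintro _ _ ⟨a, ha, b, hb, hab, rfl⟩ ⟨a', ha', b', hb', hab', rfl⟩
    refine ⟨a + a', add_mem ha ha', b + b', add_mem hb hb', ?_, ?_⟩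
    · rw [add_sub_add_comm]
      exact add_mem hab hab'
    · ext i j
      fin_cases i <;> fin_cases j <;> simp [vMat]
  zero_mem' := by
    refine ⟨0, zero_mem _, 0, zero_mem _, by simp, ?_⟩
    ext i j
    fin_cases i <;> fin_cases j <;> simp [vMat]
  neg_mem' := by
    rintro _ ⟨a, ha, b, hb, hab, rfl⟩
    refine ⟨-a, neg_mem ha, -b, neg_mem hb, ?_, ?_⟩
    · rw [neg_sub_neg, ← neg_sub]
      exact neg_mem hab
    · ext i j
      fin_cases i <;> fin_cases j <;> simp [vMat]

/-- The real values `σ(u) > 1` of the totally positive units `u` of `F` with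
`(u - 1) L^∨ ⊆ L`. -/
def admissibleUnits (σ : F →+* ℝ) (c : F ≃ₐ[ℚ] F) (𝔞 : (FractionalIdeal (𝓞 F)⁰ F)ˣ) (κ : ℕ+) :
    Set ℝ :=
  {x | ∃ u : (𝓞 F)ˣ, TotPos ((u : 𝓞 F) : F) ∧ σ ((u : 𝓞 F) : F) = x ∧ 1 < x ∧
    ∀ y ∈ dualL c 𝔞 κ, (((u : 𝓞 F) : F) - 1) * y ∈ latticeL 𝔞}

/-- The unit `ε_κ`, as a real number: the smallest admissible unit. -/
def epsilon (σ : F →+* ℝ) (c : F ≃ₐ[ℚ] F) (𝔞 : (FractionalIdeal (𝓞 F)⁰ F)ˣ) (κ : ℕ+) : ℝ :=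
  sInf (admissibleUnits σ c 𝔞 κ)

end Lattices

/-! ### The real quadratic space `V(ℝ) = M₂(ℝ)` with `Q = det / N` -/

/-- The quadratic form `Q = det / N`. -/
def quadQ (N : ℝ) (A : Matrix (Fin 2) (Fin 2) ℝ) : ℝ := A.det / N

/-- The bilinear form `(A, B) = Q(A + B) - Q(A) - Q(B)`. -/
def bil (N : ℝ) (A B : Matrix (Fin 2) (Fin 2) ℝ) : ℝ := QuadraticMap.polar (quadQ N) A B

/-- The vector `X(t)`. -/
def vecX (N t : ℝ) : Matrix (Fin 2) (Fin 2) ℝ := √N • !![Real.exp t, 0; 0, -Real.exp (-t)]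

/-- The vector `Y(t₀)`. -/
def vecY (N t₀ : ℝ) : Matrix (Fin 2) (Fin 2) ℝ := √N • !![0, Real.exp t₀; Real.exp (-t₀), 0]

/-- The vector `X^⊥(t)`. -/
def vecXperp (N t : ℝ) : Matrix (Fin 2) (Fin 2) ℝ := √N • !![Real.exp t, 0; 0, Real.exp (-t)]

/-- The vector `Y^⊥(t₀)`. -/
def vecYperp (N t₀ : ℝ) : Matrix (Fin 2) (Fin 2) ℝ := √N • !![0, Real.exp t₀; -Real.exp (-t₀), 0]

/-- The projection of `A` to the plane spanned by the orthogonal anisotropic vectors `P`, `R`. -/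
def planeProj (N : ℝ) (P R A : Matrix (Fin 2) (Fin 2) ℝ) : Matrix (Fin 2) (Fin 2) ℝ :=
  (bil N A P / bil N P P) • P + (bil N A R / bil N R R) • R

/-- The projection of `A` to the negative plane spanned by `X(t)` and `Y(t₀)`. -/
def projNeg (N t t₀ : ℝ) (A : Matrix (Fin 2) (Fin 2) ℝ) : Matrix (Fin 2) (Fin 2) ℝ :=
  planeProj N (vecX N t) (vecY N t₀) A

/-- The projection of `A` to the positive plane spanned by `X^⊥(t)` and `Y^⊥(t₀)`. -/
def projPos (N t t₀ : ℝ) (A : Matrix (Fin 2) (Fin 2) ℝ) : Matrix (Fin 2) (Fin 2) ℝ :=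
  planeProj N (vecXperp N t) (vecYperp N t₀) A

/-- The function `(A, X(t)) (A, Y^⊥(t₀)) e(Q(A_{w^⊥}) τ + Q(A_w) τ̄)`, where `e(z) = exp(2πiz)`. -/
def thetaTerm (N : ℝ) (τ : ℍ) (t t₀ : ℝ) (A : Matrix (Fin 2) (Fin 2) ℝ) : ℂ :=
  (bil N A (vecX N t) : ℂ) * (bil N A (vecYperp N t₀) : ℂ) *
    Complex.exp (2 * Real.pi * Complex.I *
      ((quadQ N (projPos N t t₀ A) : ℂ) * (τ : ℂ) +
        (quadQ N (projNeg N t t₀ A) : ℂ) * conj (τ : ℂ)))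

/-! ### The theta function, the theta integral and the cycle integral -/

section Theta

variable {F : Type*} [Field F] [NumberField F]

/-- The term of the theta function of `M` at a lattice vector, which is viewed in `V(ℝ)` through
the real embedding `σ`. -/
def latticeTerm (σ : F →+* ℝ) (c : F ≃ₐ[ℚ] F) (𝔞 : (FractionalIdeal (𝓞 F)⁰ F)ˣ) (κ : ℕ+)
    (τ : ℍ) (t t₀ : ℝ) (A : latticeM c 𝔞 κ) : ℂ :=
  thetaTerm (levelN 𝔞 κ : ℝ) τ t t₀ ((A : Matrix (Fin 2) (Fin 2) F).map σ)

/-- The theta function `Θ_M(τ, t, t₀; φ)`. -/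
def thetaM (σ : F →+* ℝ) (c : F ≃ₐ[ℚ] F) (𝔞 : (FractionalIdeal (𝓞 F)⁰ F)ˣ) (κ : ℕ+)
    (τ : ℍ) (t t₀ : ℝ) : ℂ :=
  ∑' A : latticeM c 𝔞 κ, latticeTerm σ c 𝔞 κ τ t t₀ A

/-- The integrand `v² Θ_M(τ, t, t₀; φ)` of the theta integral, `v = Im τ`. -/
def thetaIntegrand (σ : F →+* ℝ) (c : F ≃ₐ[ℚ] F) (𝔞 : (FractionalIdeal (𝓞 F)⁰ F)ˣ) (κ : ℕ+)
    (t t₀ : ℝ) (τ : ℍ) : ℂ :=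
  (τ.im : ℂ) ^ 2 * thetaM σ c 𝔞 κ τ t t₀

/-- The theta integral over `SL₂(ℤ) \ ℍ`, computed on the standard fundamental domain `𝒟`; the
volume on `ℍ` is the invariant measure `du dv / v²`. -/
def thetaIntegral (σ : F →+* ℝ) (c : F ≃ₐ[ℚ] F) (𝔞 : (FractionalIdeal (𝓞 F)⁰ F)ˣ) (κ : ℕ+)
    (t t₀ : ℝ) : ℂ :=
  ∫ τ in 𝒟, thetaIntegrand σ c 𝔞 κ t t₀ τ

/-- The cycle integral `I(t₀; φ, φ_M)`. -/
def cycleIntegral (σ : F →+* ℝ) (c : F ≃ₐ[ℚ] F) (𝔞 : (FractionalIdeal (𝓞 F)⁰ F)ˣ) (κ : ℕ+)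
    (t₀ : ℝ) : ℂ :=
  ∫ t in (0 : ℝ)..Real.log (epsilon σ c 𝔞 κ), thetaIntegral σ c 𝔞 κ t t₀

end Theta

end

end HeckeCycle

open HeckeCycle

/-! The lattice `M` consists of the pairs `(x + y, y)` with `x ∈ L`, `y ∈ L^∨`, and such a pair has
`Q(x + y, y) = Q(x) + (x, y)`. It is therefore even, and a basis of `L` together with the diagonally
embedded dual basis has Gram matrix `[[g, 1], [1, 0]]`, so it is unimodular (`exists_frame`).
Poisson summation (`tsum_int_eq_tsum_integral_exp`, `tsum_frame_inversion`) then makes a theta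
series with one positive and one negative linear factor transform with weight `(2, 2)`, which is the
invariance of `v² Θ`. The polynomial vanishes at `λ = 0`, so the series decays exponentially at the
cusp, and every integral over the fundamental domain converges.

Independence of `t₀`: write `s` for `t₀`, and `X`, `Y` (`P`, `Q`) for the negative (positive)
coordinates in the `t`- and `s`-planes. Then `∂ₛ Θ_{XQ} + ∂ₜ Θ_{PY} = 2i (∂_u - i ∂_v)(v Θ_{XY})`
(`kernelXQDeriv_add_kernelPYDeriv`). The function `v Θ_{XY}` has weight `(0, 2)`, so `v Θ_{XY} dτ̄`
is an invariant one-form, and by Stokes the right side integrates to zero over the fundamental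
domain (`integral_halfStrip_wirtinger_eq_zero`). Integrating `∂ₜ` over a full period gives zero as
well, so the `s`-derivative of the cycle integral vanishes (`integral_stripIntegral_const`).

Periodicity: multiplying `λ₁` by an admissible unit `ε` and fixing `λ₂` preserves `M`, because `(ε -
1) L^∨ ⊆ L`. In isotropic coordinates this is a boost, which translates `t` by `log ε`
(`stripIntegral_add_log`). Admissible units come from Pell's equation. A smallest one exists because
`ε + ε⁻¹` is a trace, hence a natural number.

Dependence on the class: multiplication by a totally positive `μ` maps `M` for `𝔞` onto `M` for `μ𝔞`
and is again a boost after normalization, now in both planes. It translates `t` and `t₀` by the same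
amount (`exists_thetaIntegral_principal_mul`). The first shift is absorbed by periodicity, the
second by independence of `t₀`. -/

/-! ### Poisson summation on `ℤᵈ` -/

theorem summable_one_add_norm_pow_int {d : Type*} [Fintype d] :
    Summable fun n : d → ℤ => ((1 + ‖fun i => (n i : ℝ)‖) ^ (Fintype.card d + 1))⁻¹ := by
  classical
  let b := Pi.basisFun ℝ d
  let L := Submodule.span ℤ (Set.range b)
  have hL : Module.finrank ℤ L = Fintype.card d := by
    rw [Module.finrank_eq_card_basis (b.restrictScalars ℤ)]
  have h1 := ZLattice.summable_norm_pow_inv L (Fintype.card d + 1) (by omega)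
  let e : (d → ℤ) ≃ L := (b.restrictScalars ℤ).equivFun.symm.toEquiv
  have he : ∀ n : d → ℤ, ((e n : L) : d → ℝ) = fun i => (n i : ℝ) := by
    intro n
    change (((b.restrictScalars ℤ).equivFun.symm n : L) : d → ℝ) = _
    rw [Module.Basis.equivFun_symm_apply]
    ext i
    simp [b, Finset.sum_apply, Pi.single_apply]
  have h2 := (e.summable_iff.mpr h1)
  -- The comparison fails only at `n = 0`, where the junk value `0⁻¹ = 0` makes the majorant vanish.
  refine Summable.of_norm_bounded_eventually h2 ?_
  refine (Set.finite_singleton (0 : d → ℤ)).subset ?_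
  intro n hn
  by_contra h0
  apply hn
  have hpos : 0 < ‖fun i => (n i : ℝ)‖ := by
    rw [norm_pos_iff]
    intro h
    apply h0
    ext i
    have := congrFun h i
    simpa using this
  simp only [← he n] at hpos
  rw [Set.mem_ofPred_eq, ← he n, Real.norm_of_nonneg (by positivity), Function.comp_apply, inv_pow]
  have h3 : ‖((e n : L) : d → ℝ)‖ = ‖e n‖ := rfl
  rw [h3] at *
  gcongr
  linarith

/-- The integer translates of the half-open unit cube tile space. This unfolds an integral over `ℝᵈ`
to one over the torus. -/
theorem integral_eq_tsum_cube {d : Type*} [Fintype d] (F : (d → ℝ) → ℂ) (hF : Integrable F) :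
    ∫ x, F x = ∑' n : d → ℤ, ∫ x in {x : d → ℝ | ∀ i, x i ∈ Set.Ioc (0:ℝ) (0 + 1)},
      F (x + fun i => (n i : ℝ)) := by
  classical
  let S : (d → ℤ) → Set (d → ℝ) := fun n => {x | ∀ i, x i ∈ Set.Ioc (n i : ℝ) (n i + 1)}
  have hmeas : ∀ n, MeasurableSet (S n) := fun n =>
    MeasurableSet.univ_pi' (fun i => measurableSet_Ioc)
  have hU : (⋃ n, S n) = Set.univ := by
    rw [Set.eq_univ_iff_forall]
    intro x
    rw [Set.mem_iUnion]
    refine ⟨fun i => ⌈x i⌉ - 1, fun i => ?_⟩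
    push_cast
    exact ⟨by linarith [Int.ceil_lt_add_one (x i)], by linarith [Int.le_ceil (x i)]⟩
  have hd : Pairwise (Function.onFun Disjoint S) := by
    intro m n hmn
    rw [Function.onFun, Set.disjoint_left]
    intro x hx hy
    apply hmn
    ext i
    have h1 := hx i
    have h2 := hy i
    have h3 : (m i : ℝ) < n i + 1 := lt_of_lt_of_le h1.1 h2.2
    have h4 : (n i : ℝ) < m i + 1 := lt_of_lt_of_le h2.1 h1.2
    norm_cast at h3 h4
    omega
  rw [← setIntegral_univ, ← hU, integral_iUnion hmeas hd (by rw [hU]; exact hF.integrableOn)]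
  congr 1
  ext n
  rw [← integral_indicator (hmeas n),
    ← integral_add_right_eq_self _ (fun i => (n i : ℝ)),
    ← integral_indicator (MeasurableSet.univ_pi' (fun i => measurableSet_Ioc))]
  congr 1
  ext x
  simp only [Set.indicator]
  congr 1
  simp [S, Set.mem_Ioc, add_comm (_ : ℝ) (1 : ℝ)]

/-- The Poisson summation formula on `ℤᵈ`. -/
theorem tsum_int_eq_tsum_integral_exp {d : Type*} [Fintype d] (f : (d → ℝ) → ℂ)
    (hf : Continuous f) (C : ℝ)
    (hC : ∀ x, ‖f x‖ * (1 + ‖x‖) ^ (Fintype.card d + 1) ≤ C)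
    (hs : Summable fun n : d → ℤ =>
      ∫ x : d → ℝ, Complex.exp (-2 * Real.pi * Complex.I * ∑ i, (n i : ℂ) * x i) * f x) :
    ∑' n : d → ℤ, f (fun i => (n i : ℝ)) =
      ∑' n : d → ℤ,
        ∫ x : d → ℝ, Complex.exp (-2 * Real.pi * Complex.I * ∑ i, (n i : ℂ) * x i) * f x := by
  classical
  have hC0 : 0 ≤ C := le_trans (by positivity) (hC 0)
  have hfint : Integrable f := by
    have h := (integrable_one_add_norm (E := d → ℝ) (μ := volume)
      (r := ((Fintype.card d + 1 : ℕ) : ℝ)) (by simp)).const_mul C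
    refine h.mono' hf.aestronglyMeasurable (Filter.Eventually.of_forall fun x => ?_)
    rw [Real.rpow_neg (by positivity), Real.rpow_natCast, ← div_eq_mul_inv,
      le_div_iff₀ (by positivity)]
    exact hC x
  -- Decay survives translation by a bounded vector because `1 + ‖n‖ ≤ (1 + R)(1 + ‖x + n‖)`. The
  -- resulting summable majorant serves both the continuity of the periodization and the exchange of
  -- sum and integral.
  have hbound : ∀ R : ℝ, 0 ≤ R → ∀ (x : d → ℝ), ‖x‖ ≤ R → ∀ n : d → ℤ,
      ‖f (x + fun i => (n i : ℝ))‖ ≤ C * (1 + R) ^ (Fintype.card d + 1) *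
        ((1 + ‖fun i => (n i : ℝ)‖) ^ (Fintype.card d + 1))⁻¹ := by
    intro R hR x hx n
    set y : d → ℝ := fun i => (n i : ℝ)
    have h1 : 1 + ‖y‖ ≤ (1 + R) * (1 + ‖x + y‖) := by
      have h2 : ‖y‖ ≤ ‖x + y‖ + ‖x‖ := by
        calc ‖y‖ = ‖(x + y) - x‖ := by congr 1; abel
          _ ≤ _ := norm_sub_le _ _
      nlinarith [norm_nonneg (x + y)]
    rw [← div_eq_mul_inv, le_div_iff₀ (by positivity)]
    calc ‖f (x + y)‖ * (1 + ‖y‖) ^ (Fintype.card d + 1)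
        ≤ ‖f (x + y)‖ * ((1 + R) * (1 + ‖x + y‖)) ^ (Fintype.card d + 1) := by gcongr
      _ = (‖f (x + y)‖ * (1 + ‖x + y‖) ^ (Fintype.card d + 1)) * (1 + R) ^ (Fintype.card d + 1) := by
          rw [mul_pow]; ring
      _ ≤ _ := by gcongr; exact hC _
  have hsumm : ∀ R : ℝ, Summable fun n : d → ℤ => C * (1 + R) ^ (Fintype.card d + 1) *
        ((1 + ‖fun i => (n i : ℝ)‖) ^ (Fintype.card d + 1))⁻¹ := fun R =>
    summable_one_add_norm_pow_int.mul_left _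
  let φ : (d → ℝ) → ℂ := fun x => ∑' n : d → ℤ, f (x + fun i => (n i : ℝ))
  have hφc : Continuous φ := by
    rw [continuous_iff_continuousAt]
    intro x
    have : ContinuousOn φ (Metric.ball 0 (‖x‖ + 1)) := by
      refine continuousOn_tsum (fun n => by fun_prop) (hsumm (‖x‖ + 1)) ?_
      intro n y hy
      exact hbound _ (by positivity) y (by simpa using (Metric.mem_ball.mp hy).le) n
    exact this.continuousAt (Metric.isOpen_ball.mem_nhds (by simp))
  have hφp : ∀ x y : d → ℝ, (∀ i, (x i : UnitAddCircle) = y i) → φ x = φ y := by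
    intro x y hxy
    have : ∀ i, ∃ k : ℤ, y i = x i + k := by
      intro i
      have h := QuotientAddGroup.eq.mp (hxy i)
      obtain ⟨k, hk⟩ := AddSubgroup.mem_zmultiples_iff.mp h
      refine ⟨k, ?_⟩
      simp at hk
      linarith
    choose k hk using this
    have hy : y = x + fun i => (k i : ℝ) := by ext i; simp [hk]
    simp only [φ]
    rw [← (Equiv.addLeft k).tsum_eq]
    congr 1
    ext n
    congr 1
    rw [hy]
    ext i
    simp
    ring
  let π : (d → ℝ) → UnitAddTorus d := fun x i => (x i : UnitAddCircle)
  -- The periodization `φ` descends to a continuous function on the torus. Its Fourier coefficients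
  -- are the Fourier integrals of `f`, and the claim is its Fourier series evaluated at `0`.
  have hπ : Topology.IsQuotientMap π := by
    apply IsOpenMap.isQuotientMap
    · exact IsOpenMap.piMap (fun i => QuotientAddGroup.isOpenMap_coe) (by
        exact Filter.Eventually.of_forall fun i => QuotientAddGroup.mk_surjective)
    · exact continuous_pi fun i => (AddCircle.continuous_mk' 1).comp (continuous_apply i)
    · intro y
      choose x hx using fun i => QuotientAddGroup.mk_surjective (y i)
      exact ⟨x, funext hx⟩
  let Φ : C(UnitAddTorus d, ℂ) := Topology.IsQuotientMap.lift (f := ⟨π, hπ.continuous⟩) hπ ⟨φ, hφc⟩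
    (fun x y hxy => hφp x y (fun i => congrFun hxy i))
  have hΦ : ∀ x, Φ (π x) = φ x := fun x => by
    exact DFunLike.congr_fun (Topology.IsQuotientMap.lift_comp (f := ⟨π, hπ.continuous⟩) hπ ⟨φ, hφc⟩
    (fun x y hxy => hφp x y (fun i => congrFun hxy i))) x
  have hmF : ∀ (n : d → ℤ) (x : d → ℝ), UnitAddTorus.mFourier (-n) (fun i => (x i : UnitAddCircle)) =
      Complex.exp (-2 * Real.pi * Complex.I * ∑ i, (n i : ℂ) * x i) := by
    intro n x
    simp only [UnitAddTorus.mFourier, ContinuousMap.coe_mk, fourier_coe_apply]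
    rw [← Complex.exp_sum, Finset.mul_sum]
    congr 1
    refine Finset.sum_congr rfl fun i _ => ?_
    simp
    ring
  have hexp1 : ∀ (n : d → ℤ) (x : d → ℝ),
      ‖Complex.exp (-2 * Real.pi * Complex.I * ∑ i, (n i : ℂ) * x i)‖ = 1 := by
    intro n x
    rw [← hmF]
    simp only [UnitAddTorus.mFourier, ContinuousMap.coe_mk, norm_prod]
    exact Finset.prod_eq_one fun i _ => by rw [fourier_apply]; exact Circle.norm_coe _
  have hexpp : ∀ (n m : d → ℤ) (x : d → ℝ),
      Complex.exp (-2 * Real.pi * Complex.I * ∑ i, (n i : ℂ) * x i) =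
      Complex.exp (-2 * Real.pi * Complex.I * ∑ i, (n i : ℂ) * ((x + fun i => (m i : ℝ)) i : ℝ)) := by
    intro n m x
    rw [← hmF, ← hmF]
    congr 1
    ext i
    simp
  have hcoeff : ∀ n, UnitAddTorus.mFourierCoeff Φ n =
      ∫ x : d → ℝ, Complex.exp (-2 * Real.pi * Complex.I * ∑ i, (n i : ℂ) * x i) * f x := by
    intro n
    have hcont : Continuous fun x : d → ℝ =>
        Complex.exp (-2 * Real.pi * Complex.I * ∑ i, (n i : ℂ) * x i) := by fun_prop
    rw [integral_eq_tsum_cube]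
    swap
    · refine hfint.mono ((hcont.mul hf).aestronglyMeasurable)
        (Filter.Eventually.of_forall fun x => ?_)
      rw [norm_mul, hexp1, one_mul]
    rw [UnitAddTorus.mFourierCoeff_eq_integral _ _ 0]
    simp only [Pi.zero_apply]
    set Q : Set (d → ℝ) := {x : d → ℝ | ∀ i, x i ∈ Set.Ioc (0:ℝ) (0 + 1)} with hQ
    have hQm : MeasurableSet Q := MeasurableSet.univ_pi' (fun i => measurableSet_Ioc)
    have hQn : ∀ x ∈ Q, ‖x‖ ≤ 1 := by
      intro x hx
      rw [pi_norm_le_iff_of_nonneg zero_le_one]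
      intro i
      have := hx i
      rw [zero_add] at this
      rw [Real.norm_of_nonneg this.1.le]
      exact this.2
    have hvol : volume Q ≠ ⊤ := by
      have : volume Q ≤ volume (Metric.closedBall (0 : d → ℝ) 1) := by
        apply measure_mono
        intro x hx
        simpa using hQn x hx
      exact ne_top_of_le_ne_top (measure_closedBall_lt_top.ne) this
    have hbd : ∀ (m : d → ℤ), ∀ x ∈ Q, ‖Complex.exp (-2 * Real.pi * Complex.I * ∑ i, (n i : ℂ) * ((x + fun i => (m i : ℝ)) i : ℝ)) *
        f (x + fun i => (m i : ℝ))‖ ≤ C * (1 + 1) ^ (Fintype.card d + 1) *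
        ((1 + ‖fun i => (m i : ℝ)‖) ^ (Fintype.card d + 1))⁻¹ := by
      intro m x hx
      rw [norm_mul, hexp1, one_mul]
      exact hbound 1 zero_le_one x (hQn x hx) m
    have hint : ∀ m : d → ℤ, IntegrableOn (fun x => Complex.exp (-2 * Real.pi * Complex.I * ∑ i, (n i : ℂ) * ((x + fun i => (m i : ℝ)) i : ℝ)) *
        f (x + fun i => (m i : ℝ))) Q := by
      intro m
      refine Measure.integrableOn_of_bounded hvol ?_ (M := C * (1 + 1) ^ (Fintype.card d + 1) *
        ((1 + ‖fun i => (m i : ℝ)‖) ^ (Fintype.card d + 1))⁻¹) ?_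
      · exact (Continuous.aestronglyMeasurable (by fun_prop))
      · exact (ae_restrict_iff' hQm).mpr (Filter.Eventually.of_forall fun x hx => hbd m x hx)
    have hswap := integral_tsum_of_summable_integral_norm (μ := volume.restrict Q)
      (F := fun (m : d → ℤ) x => Complex.exp (-2 * Real.pi * Complex.I * ∑ i, (n i : ℂ) * ((x + fun i => (m i : ℝ)) i : ℝ)) *
        f (x + fun i => (m i : ℝ))) hint ?_
    · rw [hswap]
      refine setIntegral_congr_fun hQm fun x hx => ?_
      rw [smul_eq_mul, hmF]
      change _ * Φ (π x) = _
      rw [hΦ]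
      simp only [φ]
      rw [← tsum_mul_left]
      congr 1
      ext m
      rw [hexpp n m x]
    · refine Summable.of_nonneg_of_le (fun m => integral_nonneg fun x => norm_nonneg _) (fun m => ?_)
        ((hsumm 1).mul_right (volume.real Q))
      have h := norm_setIntegral_le_of_norm_le_const (μ := volume) (s := Q) hvol.lt_top
        (f := fun x => ‖Complex.exp (-2 * Real.pi * Complex.I * ∑ i, (n i : ℂ) * ((x + fun i => (m i : ℝ)) i : ℝ)) *
        f (x + fun i => (m i : ℝ))‖) (C := C * (1 + 1) ^ (Fintype.card d + 1) *
        ((1 + ‖fun i => (m i : ℝ)‖) ^ (Fintype.card d + 1))⁻¹) (fun x hx => by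
          rw [norm_norm]; exact hbd m x hx)
      exact le_trans (le_abs_self _) h
  have hsum : Summable (UnitAddTorus.mFourierCoeff Φ) := by
    rw [show UnitAddTorus.mFourierCoeff Φ = _ from funext hcoeff]
    exact hs
  have h0 := UnitAddTorus.hasSum_mFourier_series_apply_of_summable hsum (π 0)
  have h1 : ∀ n : d → ℤ, UnitAddTorus.mFourier n (π 0) = 1 := by
    intro n
    have := hmF (-n) 0
    rw [neg_neg] at this
    simpa [π] using this
  simp only [h1, smul_eq_mul, mul_one, hΦ] at h0
  have h2 := h0.tsum_eq
  simp only [φ, zero_add] at h2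
  rw [← h2]
  exact tsum_congr hcoeff

/-! ### Gaussian theta series with linear factors and their inversion -/

/-- One factor of a Gaussian theta series: `y ^ k * exp(π i z y²)`. -/
noncomputable def gaussFactor (k : ℕ) (z : ℂ) (y : ℝ) : ℂ :=
  (y : ℂ) ^ k * Complex.exp (Real.pi * Complex.I * z * (y : ℂ) ^ 2)

theorem continuous_gaussFactor (k : ℕ) (z : ℂ) : Continuous (gaussFactor k z) := by
  unfold gaussFactor
  fun_prop

theorem norm_gaussFactor (k : ℕ) (z : ℂ) (y : ℝ) :
    ‖gaussFactor k z y‖ = |y| ^ k * Real.exp (-(Real.pi * z.im * y ^ 2)) := by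
  rw [gaussFactor, norm_mul, norm_pow, Complex.norm_real, Complex.norm_exp, Real.norm_eq_abs]
  congr 2
  rw [← Complex.ofReal_pow, Complex.re_mul_ofReal]
  simp

/-- The constant combines `(1 + |y|)^(n+1) ≤ (n+1)! e^(1+|y|)` with completing the square, `|y| ≤ a
y² + 1/(4a)` for `a = π Im z`. -/
theorem norm_gaussFactor_mul_le {k : ℕ} (hk : k ≤ 1) {z : ℂ} (hz : 0 < z.im) (n : ℕ) :
    ∃ C : ℝ, 0 < C ∧ ∀ y : ℝ, ‖gaussFactor k z y‖ * (1 + |y|) ^ n ≤ C := by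
  set a := Real.pi * z.im with ha
  have ha0 : 0 < a := mul_pos Real.pi_pos hz
  refine ⟨(n + 1).factorial * Real.exp (1 + 1 / (4 * a)), by positivity, fun y => ?_⟩
  rw [norm_gaussFactor, ← ha]
  have h1 : |y| ^ k ≤ 1 + |y| := by
    interval_cases k
    · simp
    · simp
  have h2 := Real.pow_div_factorial_le_exp (1 + |y|) (by positivity) (n + 1)
  rw [div_le_iff₀ (by positivity)] at h2
  have h3 : (1 + |y|) - a * y ^ 2 ≤ 1 + 1 / (4 * a) := by
    have : |y| ≤ a * |y| ^ 2 + 1 / (4 * a) := by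
      have h4 : 0 ≤ a * (|y| - 1 / (2 * a)) ^ 2 := by positivity
      have h5 : a * (|y| - 1 / (2 * a)) ^ 2 = a * |y| ^ 2 + 1 / (4 * a) - |y| := by
        field_simp
        ring
      linarith
    rw [sq_abs] at this
    linarith
  calc |y| ^ k * Real.exp (-(a * y ^ 2)) * (1 + |y|) ^ n
      ≤ (1 + |y|) * Real.exp (-(a * y ^ 2)) * (1 + |y|) ^ n := by gcongr
    _ = (1 + |y|) ^ (n + 1) * Real.exp (-(a * y ^ 2)) := by ring
    _ ≤ (Real.exp (1 + |y|) * (n + 1).factorial) * Real.exp (-(a * y ^ 2)) := by gcongr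
    _ = (n + 1).factorial * Real.exp ((1 + |y|) - a * y ^ 2) := by
      rw [Real.exp_sub, Real.exp_neg]; ring
    _ ≤ _ := by gcongr

/-- The Fourier transform of a Gaussian factor. -/
theorem integral_exp_mul_gaussFactor {k : ℕ} (hk : k ≤ 1) {z : ℂ} (hz : 0 < z.im) (ξ : ℝ) :
    ∫ x : ℝ, Complex.exp (-2 * Real.pi * Complex.I * (ξ * x)) * gaussFactor k z x =
      (1 / (-Complex.I * z)) ^ (1 / 2 : ℂ) * (1 / z) ^ k * gaussFactor k (-1 / z) ξ := by
  have hpi : (Real.pi : ℂ) ≠ 0 := by exact_mod_cast Real.pi_ne_zero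
  have hz0 : z ≠ 0 := by rintro rfl; simp at hz
  have hb : 0 < (-(Real.pi * Complex.I * z)).re := by
    have : (-(Real.pi * Complex.I * z)).re = Real.pi * z.im := by simp
    rw [this]; exact mul_pos Real.pi_pos hz
  have h0 : ∫ x : ℝ, Complex.exp (-2 * Real.pi * Complex.I * (ξ * x)) * gaussFactor 0 z x =
      (1 / (-Complex.I * z)) ^ (1 / 2 : ℂ) * gaussFactor 0 (-1 / z) ξ := by
    have h := fourierIntegral_gaussian hb (-2 * Real.pi * ξ)
    have e1 : ∀ x : ℝ, Complex.exp (-2 * Real.pi * Complex.I * (ξ * x)) * gaussFactor 0 z x =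
        Complex.exp (Complex.I * (-2 * Real.pi * ξ) * x) *
          Complex.exp (-(-(Real.pi * Complex.I * z)) * (x : ℂ) ^ 2) := by
      intro x
      rw [gaussFactor, pow_zero, one_mul]
      congr 2 <;> ring
    simp_rw [e1]
    rw [h, gaussFactor, pow_zero, one_mul]
    congr 2
    · field_simp
    · field_simp
      rw [Complex.I_sq]
      ring
  interval_cases k
  · simpa using h0
  · have hc1 : ∀ x : ℝ, ‖Complex.exp (-2 * Real.pi * Complex.I * (ξ * x))‖ = 1 := by
      intro x
      rw [Complex.norm_exp]
      simp
    have hi0 : Integrable fun x : ℝ =>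
        Complex.exp (-2 * Real.pi * Complex.I * (ξ * x)) * gaussFactor 0 z x := by
      refine (integrable_cexp_neg_mul_sq hb).mono
        (Continuous.aestronglyMeasurable (by have := continuous_gaussFactor 0 z; fun_prop))
        (Filter.Eventually.of_forall fun x => ?_)
      rw [norm_mul, hc1, one_mul, gaussFactor]
      simp
    have hi1 : Integrable fun x : ℝ =>
        Complex.exp (-2 * Real.pi * Complex.I * (ξ * x)) * gaussFactor 1 z x := by
      refine (integrable_mul_cexp_neg_mul_sq hb).mono
        (Continuous.aestronglyMeasurable (by have := continuous_gaussFactor 1 z; fun_prop))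
        (Filter.Eventually.of_forall fun x => ?_)
      rw [norm_mul, hc1, one_mul, gaussFactor]
      simp
    -- The case `k = 1` follows from `k = 0` by integration by parts: this derivative has integral
    -- zero, which expresses the transform of `x e^{πizx²}` through that of the Gaussian.
    have hd : ∀ x : ℝ, HasDerivAt (fun x : ℝ =>
        Complex.exp (-2 * Real.pi * Complex.I * (ξ * x)) * gaussFactor 0 z x)
        (2 * Real.pi * Complex.I * z *
          (Complex.exp (-2 * Real.pi * Complex.I * (ξ * x)) * gaussFactor 1 z x) -
        2 * Real.pi * Complex.I * ξ *
          (Complex.exp (-2 * Real.pi * Complex.I * (ξ * x)) * gaussFactor 0 z x)) x := by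
      intro x
      have hx : HasDerivAt (fun x : ℝ => (x : ℂ)) 1 x := Complex.ofRealCLM.hasDerivAt
      have hA := ((hx.const_mul (ξ : ℂ)).const_mul (-2 * Real.pi * Complex.I)).cexp
      have hB := ((hx.pow 2).const_mul (Real.pi * Complex.I * z)).cexp
      have := hA.mul hB
      simp only [gaussFactor, pow_zero, one_mul]
      refine this.congr_deriv ?_
      simp
      ring
    have hz' := integral_eq_zero_of_hasDerivAt_of_integrable hd
      ((hi1.const_mul _).sub (hi0.const_mul _)) hi0
    rw [integral_sub (hi1.const_mul _) (hi0.const_mul _), integral_const_mul,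
      integral_const_mul, h0] at hz'
    have h2 : (2 * Real.pi * Complex.I : ℂ) ≠ 0 := by simp [hpi]
    have h3 : z * (∫ x : ℝ, Complex.exp (-2 * Real.pi * Complex.I * (ξ * x)) * gaussFactor 1 z x) =
        ξ * ((1 / (-Complex.I * z)) ^ (1 / 2 : ℂ) * gaussFactor 0 (-1 / z) ξ) := by
      apply mul_left_cancel₀ h2
      linear_combination hz'
    apply mul_left_cancel₀ hz0
    rw [h3]
    simp only [gaussFactor, pow_zero, pow_one, one_mul]
    generalize (1 / (-Complex.I * z)) ^ (1 / 2 : ℂ) = c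
    field_simp

theorem summable_int_of_decay {d : Type*} [Fintype d] (f : (d → ℝ) → ℂ) (C : ℝ)
    (hC : ∀ x, ‖f x‖ * (1 + ‖x‖) ^ (Fintype.card d + 1) ≤ C) :
    Summable fun n : d → ℤ => f (fun i => (n i : ℝ)) := by
  refine Summable.of_norm_bounded (summable_one_add_norm_pow_int.mul_left C) fun n => ?_
  rw [← div_eq_mul_inv, le_div_iff₀ (by positivity)]
  exact hC _

theorem prod_gaussFactor_decay {d : Type*} [Fintype d] [DecidableEq d] {k : d → ℕ}
    (hk : ∀ i, k i ≤ 1) {z : d → ℂ} (hz : ∀ i, 0 < (z i).im) {W : Matrix d d ℝ}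
    (hW : IsUnit W.det) :
    ∃ C : ℝ, ∀ x : d → ℝ, ‖∏ i, gaussFactor (k i) (z i) ((W.mulVec x) i)‖ *
      (1 + ‖x‖) ^ (Fintype.card d + 1) ≤ C := by
  choose C hC0 hC using fun i => norm_gaussFactor_mul_le (hk i) (hz i) (Fintype.card d + 1)
  let A := (Matrix.toLin' W⁻¹).toContinuousLinearMap
  refine ⟨(∏ i, C i) * (1 + ‖A‖) ^ (Fintype.card d + 1), fun x => ?_⟩
  set y := W.mulVec x with hy
  have hx : ‖x‖ ≤ ‖A‖ * ‖y‖ := by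
    have h1 : A y = x := by
      simp [A, hy, Matrix.mulVec_mulVec, Matrix.nonsing_inv_mul W hW]
    calc ‖x‖ = ‖A y‖ := by rw [h1]
      _ ≤ _ := A.le_opNorm y
  -- The sup norm is bounded by a product over coordinates, so each one-variable factor absorbs its
  -- own share of the polynomial weight.
  have h2 : 1 + ‖x‖ ≤ (1 + ‖A‖) * ∏ i, (1 + |y i|) := by
    have h3 : 1 + ‖y‖ ≤ ∏ i, (1 + |y i|) := by
      have h5 : 1 ≤ ∏ i, (1 + |y i|) := by
        simpa using Finset.prod_le_prod (f := fun _ => (1 : ℝ)) (g := fun i => 1 + |y i|)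
          (fun _ _ => zero_le_one) (fun i _ => by simp)
      have h4 : ‖y‖ ≤ (∏ i, (1 + |y i|)) - 1 := by
        rw [pi_norm_le_iff_of_nonneg (by linarith)]
        intro i
        have := Finset.mul_prod_erase Finset.univ (fun i => 1 + |y i|) (Finset.mem_univ i)
        have h6 : 1 ≤ ∏ j ∈ Finset.univ.erase i, (1 + |y j|) := by
          simpa using Finset.prod_le_prod (f := fun _ => (1 : ℝ)) (g := fun i => 1 + |y i|)
            (fun _ _ => zero_le_one) (fun i _ => by simp)
        rw [← this, Real.norm_eq_abs]
        nlinarith [abs_nonneg (y i)]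
      linarith
    have : 1 + ‖x‖ ≤ (1 + ‖A‖) * (1 + ‖y‖) := by nlinarith [norm_nonneg A, norm_nonneg y]
    refine this.trans ?_
    gcongr
  rw [norm_prod]
  calc (∏ i, ‖gaussFactor (k i) (z i) (y i)‖) * (1 + ‖x‖) ^ (Fintype.card d + 1)
      ≤ (∏ i, ‖gaussFactor (k i) (z i) (y i)‖) *
        ((1 + ‖A‖) * ∏ i, (1 + |y i|)) ^ (Fintype.card d + 1) := by gcongr
    _ = (∏ i, (‖gaussFactor (k i) (z i) (y i)‖ * (1 + |y i|) ^ (Fintype.card d + 1))) *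
        (1 + ‖A‖) ^ (Fintype.card d + 1) := by
      rw [Finset.prod_mul_distrib, mul_pow, Finset.prod_pow]; ring
    _ ≤ _ := by
      gcongr with i
      exact hC i _

theorem summable_prod_gaussFactor {d : Type*} [Fintype d] [DecidableEq d] {k : d → ℕ}
    (hk : ∀ i, k i ≤ 1) {z : d → ℂ} (hz : ∀ i, 0 < (z i).im) {W : Matrix d d ℝ}
    (hW : IsUnit W.det) :
    Summable fun m : d → ℤ =>
      ∏ i, gaussFactor (k i) (z i) ((W.mulVec fun j => (m j : ℝ)) i) := by
  obtain ⟨C, hC⟩ := prod_gaussFactor_decay hk hz hW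
  exact summable_int_of_decay (fun x => ∏ i, gaussFactor (k i) (z i) ((W.mulVec x) i)) C hC

/-- The volume preserving substitution `y = W x` turns the frequency `ξ` into `ζ` with `Wᵀ ζ = ξ`,
and the integral splits into one-variable Fourier transforms. -/
theorem integral_exp_mul_prod_gaussFactor {d : Type*} [Fintype d] [DecidableEq d] {k : d → ℕ}
    (hk : ∀ i, k i ≤ 1) {z : d → ℂ} (hz : ∀ i, 0 < (z i).im) {W : Matrix d d ℝ}
    (hW : |W.det| = 1) (ξ ζ : d → ℝ) (hξ : W.transpose.mulVec ζ = ξ) :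
    ∫ x : d → ℝ, Complex.exp (-2 * Real.pi * Complex.I * ∑ i, (ξ i : ℂ) * x i) *
        ∏ i, gaussFactor (k i) (z i) ((W.mulVec x) i) =
      ∏ i, ((1 / (-Complex.I * z i)) ^ (1 / 2 : ℂ) * (1 / z i) ^ k i *
        gaussFactor (k i) (-1 / z i) (ζ i)) := by
  have hW0 : W.det ≠ 0 := by intro h; simp [h] at hW
  have hmap := Real.map_matrix_volume_pi_eq_smul_volume_pi hW0
  rw [abs_inv, hW, inv_one, ENNReal.ofReal_one, one_smul] at hmap
  let F : (d → ℝ) → ℂ := fun y => ∏ i, (Complex.exp (-2 * Real.pi * Complex.I * (ζ i * y i)) *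
      gaussFactor (k i) (z i) (y i))
  have hF : Continuous F := by
    refine continuous_finsetProd _ fun i _ => ?_
    have := (continuous_gaussFactor (k i) (z i)).comp (continuous_apply (A := fun _ : d => ℝ) i)
    exact Continuous.mul (by fun_prop) this
  have h1 : ∀ x : d → ℝ, Complex.exp (-2 * Real.pi * Complex.I * ∑ i, (ξ i : ℂ) * x i) *
        ∏ i, gaussFactor (k i) (z i) ((W.mulVec x) i) = F (Matrix.toLin' W x) := by
    intro x
    simp only [F, Finset.prod_mul_distrib, Matrix.toLin'_apply]
    rw [← Complex.exp_sum, ← Finset.mul_sum]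
    congr 3
    have : ∑ i, ξ i * x i = ∑ i, ζ i * (W.mulVec x) i := by
      have h := Matrix.dotProduct_mulVec ζ W x
      rw [← Matrix.mulVec_transpose, hξ] at h
      exact h.symm
    exact_mod_cast this
  simp_rw [h1]
  rw [← integral_map (μ := volume) (φ := Matrix.toLin' W) (f := F)
    (LinearMap.continuous_of_finiteDimensional _).aemeasurable hF.aestronglyMeasurable, hmap]
  simp only [F]
  rw [integral_fintype_prod_volume_eq_prod
    (fun i (y : ℝ) => Complex.exp (-2 * Real.pi * Complex.I * (ζ i * y)) *
      gaussFactor (k i) (z i) y)]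
  exact Finset.prod_congr rfl fun i _ => integral_exp_mul_gaussFactor (hk i) (hz i) (ζ i)

/-- The inversion formula for Gaussian theta series of a unimodular lattice. Here `D` is a
diagonal matrix of signs and `Wᵀ D W` is the Gram matrix of the lattice. -/
theorem tsum_prod_gaussFactor {d : Type*} [Fintype d] [DecidableEq d] {k : d → ℕ}
    (hk : ∀ i, k i ≤ 1) {z : d → ℂ} (hz : ∀ i, 0 < (z i).im) {W : Matrix d d ℝ}
    (hW : |W.det| = 1) {G G' : Matrix d d ℤ} (hG : G * G' = 1) (D : d → ℝ) (hD : ∀ i, D i ≠ 0)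
    (hWG : W.transpose * Matrix.diagonal D * W = G.map (Int.cast : ℤ → ℝ)) :
    ∑' m : d → ℤ, ∏ i, gaussFactor (k i) (z i) ((W.mulVec fun j => (m j : ℝ)) i) =
      ∑' m : d → ℤ, ∏ i, ((1 / (-Complex.I * z i)) ^ (1 / 2 : ℂ) * (1 / z i) ^ k i *
        gaussFactor (k i) (-1 / z i) (D i * (W.mulVec fun j => (m j : ℝ)) i)) := by
  have hWu : IsUnit W.det := by
    rw [isUnit_iff_ne_zero]; intro h; simp [h] at hW
  have hG' : G' * G = 1 := mul_eq_one_comm.mp hG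
  -- Unimodularity identifies the lattice with its dual: since `Wᵀ D W = G`, the integral frequency
  -- `G m` is `Wᵀ ζ` with `ζ = D W m`. Reindexing the dual sum by `G` therefore makes it a sum over
  -- the original lattice.
  let e : (d → ℤ) ≃ (d → ℤ) :=
    { toFun := fun m => G.mulVec m
      invFun := fun m => G'.mulVec m
      left_inv := fun m => by simp [Matrix.mulVec_mulVec, hG']
      right_inv := fun m => by simp [Matrix.mulVec_mulVec, hG] }
  let ζ : (d → ℤ) → d → ℝ := fun m i => D i * (W.mulVec fun j => (m j : ℝ)) i
  have hζ : ∀ m, W.transpose.mulVec (ζ m) = fun i => ((e m) i : ℝ) := by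
    intro m
    have h1 : ζ m = (Matrix.diagonal D).mulVec (W.mulVec fun j => (m j : ℝ)) := by
      ext i; simp [ζ, Matrix.mulVec_diagonal]
    rw [h1, Matrix.mulVec_mulVec, Matrix.mulVec_mulVec, hWG]
    ext i
    simp [e, Matrix.mulVec, dotProduct]
  have hI : ∀ m : d → ℤ, ∫ x : d → ℝ,
      Complex.exp (-2 * Real.pi * Complex.I * ∑ i, ((e m) i : ℂ) * x i) *
        ∏ i, gaussFactor (k i) (z i) ((W.mulVec x) i) =
      ∏ i, ((1 / (-Complex.I * z i)) ^ (1 / 2 : ℂ) * (1 / z i) ^ k i *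
        gaussFactor (k i) (-1 / z i) (ζ m i)) := by
    intro m
    have := integral_exp_mul_prod_gaussFactor hk hz hW _ (ζ m) (hζ m)
    simpa using this
  obtain ⟨C, hC⟩ := prod_gaussFactor_decay hk hz hWu
  have hz' : ∀ i, 0 < (-1 / z i).im := by
    intro i
    rw [neg_div, one_div, Complex.neg_im, Complex.inv_im, neg_div, neg_neg]
    have : z i ≠ 0 := by intro h; have := hz i; simp [h] at this
    exact div_pos (hz i) (Complex.normSq_pos.mpr this)
  have hsum : Summable fun m : d → ℤ =>
      ∏ i, ((1 / (-Complex.I * z i)) ^ (1 / 2 : ℂ) * (1 / z i) ^ k i *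
        gaussFactor (k i) (-1 / z i) (ζ m i)) := by
    simp_rw [Finset.prod_mul_distrib]
    refine Summable.mul_left _ ?_
    have hDW : IsUnit (Matrix.diagonal D * W).det := by
      rw [Matrix.det_mul, Matrix.det_diagonal]
      exact IsUnit.mul (isUnit_iff_ne_zero.mpr (Finset.prod_ne_zero_iff.mpr fun i _ => hD i)) hWu
    refine (summable_prod_gaussFactor hk hz' hDW).congr fun m => ?_
    refine Finset.prod_congr rfl fun i _ => ?_
    rw [← Matrix.mulVec_mulVec, Matrix.mulVec_diagonal]
  have hf : Continuous fun x : d → ℝ => ∏ i, gaussFactor (k i) (z i) ((W.mulVec x) i) := by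
    refine continuous_finsetProd _ fun i _ => (continuous_gaussFactor (k i) (z i)).comp ?_
    fun_prop
  rw [tsum_int_eq_tsum_integral_exp (fun x => ∏ i, gaussFactor (k i) (z i) ((W.mulVec x) i))
    hf C hC ?_, ← e.tsum_eq]
  · exact tsum_congr hI
  · rw [← e.summable_iff]
    exact hsum.congr fun m => (hI m).symm

noncomputable section

/-! ### Coordinates of a vector of signature `(2, 2)` with respect to a point of the product of
two hyperbolic lines, and the Gaussian kernel -/

/-- Coordinate along the first negative direction. -/
def negX (l : Fin 4 → ℝ) (t : ℝ) : ℝ := l 1 * Real.exp t - l 0 * Real.exp (-t)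

/-- Coordinate along the first positive direction. -/
def posX (l : Fin 4 → ℝ) (t : ℝ) : ℝ := l 1 * Real.exp t + l 0 * Real.exp (-t)

/-- Coordinate along the second negative direction. -/
def negY (l : Fin 4 → ℝ) (s : ℝ) : ℝ := -(l 2 * Real.exp (-s)) - l 3 * Real.exp s

/-- Coordinate along the second positive direction. -/
def posY (l : Fin 4 → ℝ) (s : ℝ) : ℝ := l 2 * Real.exp (-s) - l 3 * Real.exp s

/-- The (scaled) majorant of the quadratic form. -/
def majorant (l : Fin 4 → ℝ) (t s : ℝ) : ℝ :=
  negX l t ^ 2 + negY l s ^ 2 + posX l t ^ 2 + posY l s ^ 2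

/-- The quadratic form of signature `(2, 2)`. -/
def hypForm (l : Fin 4 → ℝ) : ℝ := l 0 * l 1 - l 2 * l 3

/-- The Siegel Gaussian `e(Q(λ_+) τ + Q(λ_-) τ̄)`, `τ = u + i v`. -/
def siegelGauss (l : Fin 4 → ℝ) (u v t s : ℝ) : ℂ :=
  Complex.exp (((2 * Real.pi * hypForm l * u : ℝ) : ℂ) * Complex.I -
    ((Real.pi / 2 * v * majorant l t s : ℝ) : ℂ))

theorem four_mul_hypForm (l : Fin 4 → ℝ) (t s : ℝ) :
    4 * hypForm l = posX l t ^ 2 + posY l s ^ 2 - negX l t ^ 2 - negY l s ^ 2 := by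
  have h1 : Real.exp t * Real.exp (-t) = 1 := by rw [← Real.exp_add]; simp
  have h2 : Real.exp s * Real.exp (-s) = 1 := by rw [← Real.exp_add]; simp
  simp only [hypForm, posX, posY, negX, negY]
  linear_combination (-4 * l 0 * l 1) * h1 + (4 * l 2 * l 3) * h2

theorem norm_siegelGauss (l : Fin 4 → ℝ) (u v t s : ℝ) :
    ‖siegelGauss l u v t s‖ = Real.exp (-(Real.pi / 2 * v * majorant l t s)) := by
  rw [siegelGauss, Complex.norm_exp]
  simp

theorem majorant_nonneg (l : Fin 4 → ℝ) (t s : ℝ) : 0 ≤ majorant l t s := by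
  unfold majorant; positivity

@[fun_prop]
theorem continuous_negX (l : Fin 4 → ℝ) : Continuous (negX l) := by unfold negX; fun_prop

@[fun_prop]
theorem continuous_posX (l : Fin 4 → ℝ) : Continuous (posX l) := by unfold posX; fun_prop

@[fun_prop]
theorem continuous_negY (l : Fin 4 → ℝ) : Continuous (negY l) := by unfold negY; fun_prop

@[fun_prop]
theorem continuous_posY (l : Fin 4 → ℝ) : Continuous (posY l) := by unfold posY; fun_prop

/-- The coordinates behave like `sinh` and `cosh`: differentiation exchanges the positive and the
negative coordinate of a hyperbolic plane. All derivatives of the kernels below come from this. -/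
theorem hasDerivAt_negX (l : Fin 4 → ℝ) (t : ℝ) : HasDerivAt (negX l) (posX l t) t := by
  have h1 := (Real.hasDerivAt_exp t).const_mul (l 1)
  have h2 := ((hasDerivAt_neg t).exp).const_mul (l 0)
  refine (h1.sub h2).congr_deriv ?_
  simp [posX]

theorem hasDerivAt_posX (l : Fin 4 → ℝ) (t : ℝ) : HasDerivAt (posX l) (negX l t) t := by
  have h1 := (Real.hasDerivAt_exp t).const_mul (l 1)
  have h2 := ((hasDerivAt_neg t).exp).const_mul (l 0)
  refine (h1.add h2).congr_deriv ?_
  simp [negX]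
  ring

theorem hasDerivAt_negY (l : Fin 4 → ℝ) (s : ℝ) : HasDerivAt (negY l) (posY l s) s := by
  have h1 := (Real.hasDerivAt_exp s).const_mul (l 3)
  have h2 := ((hasDerivAt_neg s).exp).const_mul (l 2)
  refine (h2.neg.sub h1).congr_deriv ?_
  simp [posY]

theorem hasDerivAt_posY (l : Fin 4 → ℝ) (s : ℝ) : HasDerivAt (posY l) (negY l s) s := by
  have h1 := (Real.hasDerivAt_exp s).const_mul (l 3)
  have h2 := ((hasDerivAt_neg s).exp).const_mul (l 2)
  refine (h2.sub h1).congr_deriv ?_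
  simp [negY]

theorem hasDerivAt_majorant_fst (l : Fin 4 → ℝ) (t s : ℝ) :
    HasDerivAt (fun t => majorant l t s) (4 * negX l t * posX l t) t := by
  have h := ((((hasDerivAt_negX l t).pow 2).add_const (negY l s ^ 2)).add
    ((hasDerivAt_posX l t).pow 2)).add_const (posY l s ^ 2)
  refine h.congr_deriv ?_
  simp
  ring

theorem hasDerivAt_majorant_snd (l : Fin 4 → ℝ) (t s : ℝ) :
    HasDerivAt (fun s => majorant l t s) (4 * negY l s * posY l s) s := by
  have h := ((((hasDerivAt_negY l s).pow 2).const_add (negX l t ^ 2)).add_const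
    (posX l t ^ 2)).add ((hasDerivAt_posY l s).pow 2)
  refine h.congr_deriv ?_
  simp
  ring

theorem hasDerivAt_siegelGauss_t (l : Fin 4 → ℝ) (u v t s : ℝ) :
    HasDerivAt (fun t => siegelGauss l u v t s)
      (((-(2 * Real.pi * v * negX l t * posX l t) : ℝ) : ℂ) * siegelGauss l u v t s) t := by
  have h := (((hasDerivAt_majorant_fst l t s).const_mul (Real.pi / 2 * v)).ofReal_comp.const_sub
    (((2 * Real.pi * hypForm l * u : ℝ) : ℂ) * Complex.I)).cexp
  refine h.congr_deriv ?_
  rw [mul_comm, siegelGauss]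
  congr 1
  push_cast
  ring

theorem hasDerivAt_siegelGauss_s (l : Fin 4 → ℝ) (u v t s : ℝ) :
    HasDerivAt (fun s => siegelGauss l u v t s)
      (((-(2 * Real.pi * v * negY l s * posY l s) : ℝ) : ℂ) * siegelGauss l u v t s) s := by
  have h := (((hasDerivAt_majorant_snd l t s).const_mul (Real.pi / 2 * v)).ofReal_comp.const_sub
    (((2 * Real.pi * hypForm l * u : ℝ) : ℂ) * Complex.I)).cexp
  refine h.congr_deriv ?_
  rw [mul_comm, siegelGauss]
  congr 1
  push_cast
  ring

theorem hasFDerivAt_siegelGauss (l : Fin 4 → ℝ) (t s : ℝ) (z : ℝ × ℝ) :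
    HasFDerivAt (fun z : ℝ × ℝ => siegelGauss l z.1 z.2 t s)
      ((ContinuousLinearMap.fst ℝ ℝ ℝ).smulRight
        (((2 * Real.pi * hypForm l : ℝ) : ℂ) * Complex.I * siegelGauss l z.1 z.2 t s) +
      (ContinuousLinearMap.snd ℝ ℝ ℝ).smulRight
        (((-(Real.pi / 2 * majorant l t s) : ℝ) : ℂ) * siegelGauss l z.1 z.2 t s)) z := by
  have h1 : HasFDerivAt (fun z : ℝ × ℝ => (z.1 : ℂ))
    (Complex.ofRealCLM.comp (ContinuousLinearMap.fst ℝ ℝ ℝ)) z :=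
    (Complex.ofRealCLM.comp (ContinuousLinearMap.fst ℝ ℝ ℝ)).hasFDerivAt
  have h2 : HasFDerivAt (fun z : ℝ × ℝ => (z.2 : ℂ))
    (Complex.ofRealCLM.comp (ContinuousLinearMap.snd ℝ ℝ ℝ)) z :=
    (Complex.ofRealCLM.comp (ContinuousLinearMap.snd ℝ ℝ ℝ)).hasFDerivAt
  have h := ((h1.const_mul (((2 * Real.pi * hypForm l : ℝ) : ℂ) * Complex.I)).sub
    (h2.const_mul ((Real.pi / 2 * majorant l t s : ℝ) : ℂ))).cexp
  have e : (fun z : ℝ × ℝ => siegelGauss l z.1 z.2 t s) = fun z : ℝ × ℝ =>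
      Complex.exp (((2 * Real.pi * hypForm l : ℝ) : ℂ) * Complex.I * z.1 -
        ((Real.pi / 2 * majorant l t s : ℝ) : ℂ) * z.2) := by
    ext z
    rw [siegelGauss]
    congr 1
    push_cast
    ring
  rw [e]
  refine h.congr_fderiv ?_
  have e' := congrFun e z
  rw [Pi.sub_apply, ← e']
  ext x <;> simp <;> ring

/-! ### Theta kernels -/

/-- A family of functions of `(u, v, t, s)` indexed by `λ ∈ ℝ⁴` which is continuous, vanishes at
`λ = 0` and is dominated by a Gaussian in `λ`. -/
structure IsThetaKernel (F : (Fin 4 → ℝ) → ℝ → ℝ → ℝ → ℝ → ℂ) : Prop where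
  cont : ∀ l, Continuous fun z : ℝ × ℝ × ℝ × ℝ => F l z.1 z.2.1 z.2.2.1 z.2.2.2
  zero : ∀ u v t s, F 0 u v t s = 0
  bound : ∃ K : ℝ, 0 ≤ K ∧ ∀ l u v t s, 0 < v →
    ‖F l u v t s‖ ≤ K * (1 + 1 / v) * Real.exp (-(Real.pi / 4 * v * majorant l t s))

/-- Half of the exponent `π v H / 2`, with `H` the majorant, is spent on the polynomial, which
leaves `π / 4` in the bound. Powers of `v H` are bounded against that half; a factor `H` not matched
by its own `v` costs `1 / v`, whence the term `1 + 1 / v`. -/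
theorem IsThetaKernel.of_poly (P : (Fin 4 → ℝ) → ℝ → ℝ → ℝ → ℂ)
    (hc : ∀ l, Continuous fun z : ℝ × ℝ × ℝ => P l z.1 z.2.1 z.2.2)
    (h0 : ∀ v t s, P 0 v t s = 0) (K : ℝ) (hK : 0 ≤ K)
    (hb : ∀ l v t s, 0 < v → ‖P l v t s‖ ≤
      K * (majorant l t s + v * majorant l t s + v * majorant l t s ^ 2)) :
    IsThetaKernel fun l u v t s => P l v t s * siegelGauss l u v t s := by
  refine ⟨fun l => ?_, fun u v t s => by simp [h0], 6 * K, by positivity, ?_⟩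
  · refine Continuous.mul ?_ ?_
    · exact (hc l).comp continuous_snd
    · simp only [siegelGauss, majorant]
      fun_prop
  · intro l u v t s hv
    rw [norm_mul, norm_siegelGauss]
    set H := majorant l t s
    have hH : 0 ≤ H := majorant_nonneg l t s
    set X := Real.pi / 4 * v * H with hX
    have hX0 : 0 ≤ X := by positivity
    have hexp : Real.exp (-(Real.pi / 2 * v * H)) = Real.exp (-X) * Real.exp (-X) := by
      rw [← Real.exp_add]; congr 1; rw [hX]; ring
    have h1 : X * Real.exp (-X) ≤ 1 := by
      rw [Real.exp_neg, ← div_eq_mul_inv, div_le_one (Real.exp_pos _)]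
      linarith [Real.add_one_le_exp X]
    have h2 : X ^ 2 * Real.exp (-X) ≤ 2 := by
      rw [Real.exp_neg, ← div_eq_mul_inv, div_le_iff₀ (Real.exp_pos _)]
      have := Real.quadratic_le_exp_of_nonneg hX0
      linarith
    have hpi : 3 < Real.pi := Real.pi_gt_three
    have h3 : v * H ≤ 4 / 3 * X := by
      rw [hX]; nlinarith [mul_nonneg hv.le hH]
    have h4 : v * H * Real.exp (-X) ≤ 2 := by
      have := Real.exp_pos (-X)
      nlinarith
    have h5 : (v * H) ^ 2 * Real.exp (-X) ≤ 4 := by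
      have h6 : (v * H) ^ 2 ≤ 16 / 9 * X ^ 2 := by
        have := mul_self_le_mul_self (by positivity : 0 ≤ v * H) h3
        nlinarith
      have := Real.exp_pos (-X)
      nlinarith
    have h7 : (H + v * H + v * H ^ 2) * Real.exp (-X) ≤ 6 * (1 + 1 / v) := by
      have : (H + v * H + v * H ^ 2) * Real.exp (-X) =
        (v * H * Real.exp (-X) + (v * H) ^ 2 * Real.exp (-X)) * (1 / v) +
          v * H * Real.exp (-X) := by field_simp; ring
      rw [this]
      have : 0 < 1 / v := by positivity
      nlinarith
    calc ‖P l v t s‖ * Real.exp (-(Real.pi / 2 * v * H))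
        ≤ (K * (H + v * H + v * H ^ 2)) * (Real.exp (-X) * Real.exp (-X)) := by
          rw [hexp]; gcongr; exact hb l v t s hv
      _ = K * ((H + v * H + v * H ^ 2) * Real.exp (-X)) * Real.exp (-X) := by ring
      _ ≤ K * (6 * (1 + 1 / v)) * Real.exp (-X) := by gcongr
      _ = _ := by ring

/-- The theta series of a kernel for the lattice `R ℤ⁴`. -/
def thetaSum (R : Matrix (Fin 4) (Fin 4) ℝ) (F : (Fin 4 → ℝ) → ℝ → ℝ → ℝ → ℝ → ℂ)
    (u v t s : ℝ) : ℂ :=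
  ∑' m : Fin 4 → ℤ, F (R.mulVec fun i => (m i : ℝ)) u v t s

/-- The majorant is twice the sum of the squares of the coordinates scaled by `e^{±t}`, `e^{±s}`. It
is thus positive definite, uniformly for bounded `t` and `s`; the norm of `R⁻¹` transports the bound
to the coefficients. -/
theorem majorant_lower_bound {R : Matrix (Fin 4) (Fin 4) ℝ} (hR : IsUnit R.det) (T : ℝ) :
    ∃ δ : ℝ, 0 < δ ∧ ∀ (x : Fin 4 → ℝ) (t s : ℝ), |t| ≤ T → |s| ≤ T →
      δ * ‖x‖ ^ 2 ≤ majorant (R.mulVec x) t s := by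
  let A := (Matrix.toLin' R⁻¹).toContinuousLinearMap
  refine ⟨2 * Real.exp (-T) ^ 2 / (1 + ‖A‖) ^ 2, by positivity, fun x t s ht hs => ?_⟩
  set l := R.mulVec x with hl
  have hx : ‖x‖ ≤ (1 + ‖A‖) * ‖l‖ := by
    have h1 : A l = x := by
      simp [A, hl, Matrix.mulVec_mulVec, Matrix.nonsing_inv_mul R hR]
    calc ‖x‖ = ‖A l‖ := by rw [h1]
      _ ≤ ‖A‖ * ‖l‖ := A.le_opNorm l
      _ ≤ _ := by gcongr; linarith
  have hmaj : majorant l t s = 2 * ((l 0 * Real.exp (-t)) ^ 2 + (l 1 * Real.exp t) ^ 2 +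
      (l 2 * Real.exp (-s)) ^ 2 + (l 3 * Real.exp s) ^ 2) := by
    simp only [majorant, negX, negY, posX, posY]; ring
  have key : ∀ (y r : ℝ), -T ≤ r → (|y| * Real.exp (-T)) ^ 2 ≤ (y * Real.exp r) ^ 2 := by
    intro y r hr
    rw [mul_pow, mul_pow, sq_abs]
    have : Real.exp (-T) ≤ Real.exp r := Real.exp_le_exp.mpr hr
    gcongr
  have hli : ∀ i, (|l i| * Real.exp (-T)) ^ 2 ≤ majorant l t s / 2 := by
    rw [abs_le] at ht hs
    have k0 := key (l 0) (-t) (by linarith)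
    have k1 := key (l 1) t (by linarith)
    have k2 := key (l 2) (-s) (by linarith)
    have k3 := key (l 3) s (by linarith)
    intro i
    rw [hmaj]
    fin_cases i <;> simp only [Fin.zero_eta, Fin.mk_one, Fin.reduceFinMk] <;>
      nlinarith [sq_nonneg (l 0 * Real.exp (-t)), sq_nonneg (l 1 * Real.exp t),
        sq_nonneg (l 2 * Real.exp (-s)), sq_nonneg (l 3 * Real.exp s)]
  have hl2 : (‖l‖ * Real.exp (-T)) ^ 2 ≤ majorant l t s / 2 := by
    obtain ⟨i, hi⟩ : ∃ i, ‖l i‖ = ‖l‖ := by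
      obtain ⟨i, -, hi⟩ := Finset.exists_mem_eq_sup' Finset.univ_nonempty (fun i => ‖l i‖₊)
      refine ⟨i, ?_⟩
      rw [Pi.norm_def, ← Finset.sup'_eq_sup Finset.univ_nonempty, hi]
      simp
    rw [← hi]
    exact hli i
  rw [div_mul_eq_mul_div, div_le_iff₀ (by positivity)]
  calc 2 * Real.exp (-T) ^ 2 * ‖x‖ ^ 2 ≤ 2 * Real.exp (-T) ^ 2 * ((1 + ‖A‖) * ‖l‖) ^ 2 := by
        gcongr
    _ = 2 * (‖l‖ * Real.exp (-T)) ^ 2 * (1 + ‖A‖) ^ 2 := by ring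
    _ ≤ _ := by gcongr; linarith

theorem summable_exp_neg_norm_sq {a : ℝ} (ha : 0 < a) :
    Summable fun m : Fin 4 → ℤ => Real.exp (-(a * ‖fun i => (m i : ℝ)‖ ^ 2)) := by
  obtain ⟨C, -, hC⟩ := norm_gaussFactor_mul_le (k := 0) zero_le_one
    (z := ((a / Real.pi : ℝ) : ℂ) * Complex.I) (by simp; positivity) 5
  refine Summable.of_norm_bounded (summable_one_add_norm_pow_int.mul_left C) fun m => ?_
  have h := hC ‖fun i => (m i : ℝ)‖
  rw [norm_gaussFactor, pow_zero, one_mul, abs_of_nonneg (norm_nonneg _)] at h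
  have e : Real.pi * (((a / Real.pi : ℝ) : ℂ) * Complex.I).im = a := by
    simp; field_simp
  rw [e] at h
  rw [Real.norm_of_nonneg (Real.exp_nonneg _), ← div_eq_mul_inv, le_div_iff₀ (by positivity)]
  simpa using h

theorem one_le_norm_intCast {m : Fin 4 → ℤ} (hm : m ≠ 0) : 1 ≤ ‖fun i => (m i : ℝ)‖ := by
  obtain ⟨i, hi⟩ := Function.ne_iff.mp hm
  have h1 : (1 : ℝ) ≤ |(m i : ℝ)| := by
    have := Int.one_le_abs hi
    exact_mod_cast this
  exact h1.trans (norm_le_pi_norm (fun i => (m i : ℝ)) i)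

/-- The terms of a theta series are uniformly dominated for `v ≥ v₀` and bounded `t, s`, with
exponential decay in `v`. -/
theorem IsThetaKernel.uniform_bound {F : (Fin 4 → ℝ) → ℝ → ℝ → ℝ → ℝ → ℂ} (hF : IsThetaKernel F)
    {R : Matrix (Fin 4) (Fin 4) ℝ} (hR : IsUnit R.det) {v₀ : ℝ} (hv₀ : 0 < v₀) (T : ℝ) :
    ∃ (c : ℝ) (b : (Fin 4 → ℤ) → ℝ), 0 < c ∧ Summable b ∧ (∀ m, 0 ≤ b m) ∧
      ∀ m u v t s, v₀ ≤ v → |t| ≤ T → |s| ≤ T →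
        ‖F (R.mulVec fun i => (m i : ℝ)) u v t s‖ ≤ b m * Real.exp (-(c * v)) := by
  obtain ⟨δ, hδ, hδm⟩ := majorant_lower_bound hR T
  obtain ⟨K, hK, hb⟩ := hF.bound
  set c := Real.pi / 4 * δ with hc
  have hc0 : 0 < c := by positivity
  refine ⟨c, fun m => K * (1 + 1 / v₀) * Real.exp (c * v₀) *
    Real.exp (-(c * v₀ * ‖fun i => (m i : ℝ)‖ ^ 2)), hc0,
    (summable_exp_neg_norm_sq (by positivity)).mul_left _, fun m => by positivity, ?_⟩
  intro m u v t s hv ht hs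
  have hvpos : 0 < v := hv₀.trans_le hv
  -- The Gaussian does not decay in `v` at the zero vector, so decay at the cusp rests on the
  -- vanishing of the kernel there.
  by_cases hm : m = 0
  · subst hm
    have : (R.mulVec fun i => (((0 : Fin 4 → ℤ) i : ℤ) : ℝ)) = 0 := by
      rw [← Matrix.mulVec_zero R]
      congr 1
      ext i
      simp
    rw [this, hF.zero, norm_zero]
    positivity
  have h1 := one_le_norm_intCast hm
  set n := ‖fun i => (m i : ℝ)‖
  have h2 : 1 ≤ n ^ 2 := one_le_pow₀ h1
  calc ‖F (R.mulVec fun i => (m i : ℝ)) u v t s‖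
      ≤ K * (1 + 1 / v) * Real.exp (-(Real.pi / 4 * v *
          majorant (R.mulVec fun i => (m i : ℝ)) t s)) := hb _ _ _ _ _ hvpos
    _ ≤ K * (1 + 1 / v₀) * Real.exp (c * v₀ + -(c * v₀ * n ^ 2) + -(c * v)) := by
        gcongr
        have h3 := hδm (fun i => (m i : ℝ)) t s ht hs
        have h4 : Real.pi / 4 * v * (δ * n ^ 2) ≤ Real.pi / 4 * v *
          majorant (R.mulVec fun i => (m i : ℝ)) t s := by gcongr
        -- A nonzero integral vector has norm at least `1`, so `v n² ≥ v₀ n² + v - v₀`. This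
        -- separates summability in `m` from decay in `v`.
        have h5 : 0 ≤ c * (v - v₀) * (n ^ 2 - 1) := by
          have := sub_nonneg.mpr hv
          have := sub_nonneg.mpr h2
          positivity
        have h6 : Real.pi / 4 * v * (δ * n ^ 2) = c * v * n ^ 2 := by rw [hc]; ring
        nlinarith
    _ = _ := by rw [Real.exp_add, Real.exp_add]; ring

theorem IsThetaKernel.summable {F : (Fin 4 → ℝ) → ℝ → ℝ → ℝ → ℝ → ℂ} (hF : IsThetaKernel F)
    {R : Matrix (Fin 4) (Fin 4) ℝ} (hR : IsUnit R.det) {u v t s : ℝ} (hv : 0 < v) :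
    Summable fun m : Fin 4 → ℤ => F (R.mulVec fun i => (m i : ℝ)) u v t s := by
  obtain ⟨c, b, hc, hb, hb0, h⟩ := hF.uniform_bound hR hv (max |t| |s|)
  exact Summable.of_norm_bounded (hb.mul_right _)
    fun m => h m u v t s le_rfl (le_max_left _ _) (le_max_right _ _)

theorem IsThetaKernel.exp_bound {F : (Fin 4 → ℝ) → ℝ → ℝ → ℝ → ℝ → ℂ} (hF : IsThetaKernel F)
    {R : Matrix (Fin 4) (Fin 4) ℝ} (hR : IsUnit R.det) {v₀ : ℝ} (hv₀ : 0 < v₀) (T : ℝ) :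
    ∃ c C : ℝ, 0 < c ∧ 0 ≤ C ∧ ∀ u v t s, v₀ ≤ v → |t| ≤ T → |s| ≤ T →
      ‖thetaSum R F u v t s‖ ≤ C * Real.exp (-(c * v)) := by
  obtain ⟨c, b, hc, hb, hb0, h⟩ := hF.uniform_bound hR hv₀ T
  refine ⟨c, ∑' m, b m, hc, tsum_nonneg hb0, fun u v t s hv ht hs => ?_⟩
  rw [← tsum_mul_right]
  exact tsum_of_norm_bounded (hb.mul_right _).hasSum fun m => h m u v t s hv ht hs

theorem IsThetaKernel.local_bound {F : (Fin 4 → ℝ) → ℝ → ℝ → ℝ → ℝ → ℂ} (hF : IsThetaKernel F)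
    {R : Matrix (Fin 4) (Fin 4) ℝ} (hR : IsUnit R.det) {v₀ : ℝ} (hv₀ : 0 < v₀) (T : ℝ) :
    ∃ b : (Fin 4 → ℤ) → ℝ, Summable b ∧
      ∀ m u v t s, v₀ ≤ v → |t| ≤ T → |s| ≤ T →
        ‖F (R.mulVec fun i => (m i : ℝ)) u v t s‖ ≤ b m := by
  obtain ⟨c, b, hc, hb, hb0, h⟩ := hF.uniform_bound hR hv₀ T
  refine ⟨b, hb, fun m u v t s hv ht hs => (h m u v t s hv ht hs).trans ?_⟩
  have : Real.exp (-(c * v)) ≤ 1 := by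
    rw [Real.exp_le_one_iff]
    have : 0 ≤ c * v := mul_nonneg hc.le (hv₀.le.trans hv)
    linarith
  nlinarith [hb0 m]

theorem IsThetaKernel.continuousOn {F : (Fin 4 → ℝ) → ℝ → ℝ → ℝ → ℝ → ℂ} (hF : IsThetaKernel F)
    {R : Matrix (Fin 4) (Fin 4) ℝ} (hR : IsUnit R.det) :
    ContinuousOn (fun z : ℝ × ℝ × ℝ × ℝ => thetaSum R F z.1 z.2.1 z.2.2.1 z.2.2.2)
      {z | 0 < z.2.1} := by
  intro z hz
  have hz' : 0 < z.2.1 := hz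
  obtain ⟨b, hb, h⟩ := hF.local_bound hR (half_pos hz') (max |z.2.2.1| |z.2.2.2| + 1)
  let U : Set (ℝ × ℝ × ℝ × ℝ) := {y | z.2.1 / 2 < y.2.1 ∧
    |y.2.2.1| < max |z.2.2.1| |z.2.2.2| + 1 ∧ |y.2.2.2| < max |z.2.2.1| |z.2.2.2| + 1}
  have hU : IsOpen U := by
    have o1 : IsOpen {y : ℝ × ℝ × ℝ × ℝ | z.2.1 / 2 < y.2.1} :=
      isOpen_lt (by fun_prop) (by fun_prop)
    have o2 : IsOpen {y : ℝ × ℝ × ℝ × ℝ | |y.2.2.1| < max |z.2.2.1| |z.2.2.2| + 1} :=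
      isOpen_lt (by fun_prop) (by fun_prop)
    have o3 : IsOpen {y : ℝ × ℝ × ℝ × ℝ | |y.2.2.2| < max |z.2.2.1| |z.2.2.2| + 1} :=
      isOpen_lt (by fun_prop) (by fun_prop)
    exact o1.inter (o2.inter o3)
  have hzU : z ∈ U := ⟨by linarith, by linarith [le_max_left |z.2.2.1| |z.2.2.2|],
    by linarith [le_max_right |z.2.2.1| |z.2.2.2|]⟩
  have : ContinuousOn (fun z : ℝ × ℝ × ℝ × ℝ => thetaSum R F z.1 z.2.1 z.2.2.1 z.2.2.2) U := by
    refine continuousOn_tsum (fun m => (hF.cont _).continuousOn) hb ?_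
    intro m y hy
    exact h m _ _ _ _ hy.1.le hy.2.1.le hy.2.2.le
  exact (this.continuousAt (hU.mem_nhds hzU)).continuousWithinAt

theorem hasDerivAt_thetaSum_t {F F' : (Fin 4 → ℝ) → ℝ → ℝ → ℝ → ℝ → ℂ}
    (hF : IsThetaKernel F) (hF' : IsThetaKernel F')
    (hd : ∀ l u v t s, HasDerivAt (fun t => F l u v t s) (F' l u v t s) t)
    {R : Matrix (Fin 4) (Fin 4) ℝ} (hR : IsUnit R.det) {u v : ℝ} (hv : 0 < v) (t s : ℝ) :
    HasDerivAt (fun t => thetaSum R F u v t s) (thetaSum R F' u v t s) t := by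
  obtain ⟨b, hb, h⟩ := hF'.local_bound hR hv (max (|t| + 1) |s|)
  refine hasDerivAt_tsum_of_isPreconnected hb (Metric.isOpen_ball (x := t) (ε := 1))
    (convex_ball t 1).isPreconnected (fun m y _ => hd _ u v y s) ?_
    (Metric.mem_ball_self one_pos) (hF.summable hR hv) (Metric.mem_ball_self one_pos)
  intro m y hy
  refine h m u v y s le_rfl (le_trans ?_ (le_max_left _ _)) (le_max_right _ _)
  rw [Metric.mem_ball, Real.dist_eq] at hy
  have := abs_sub_abs_le_abs_sub y t
  linarith

theorem hasDerivAt_thetaSum_s {F F' : (Fin 4 → ℝ) → ℝ → ℝ → ℝ → ℝ → ℂ}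
    (hF : IsThetaKernel F) (hF' : IsThetaKernel F')
    (hd : ∀ l u v t s, HasDerivAt (fun s => F l u v t s) (F' l u v t s) s)
    {R : Matrix (Fin 4) (Fin 4) ℝ} (hR : IsUnit R.det) {u v : ℝ} (hv : 0 < v) (t s : ℝ) :
    HasDerivAt (fun s => thetaSum R F u v t s) (thetaSum R F' u v t s) s := by
  obtain ⟨b, hb, h⟩ := hF'.local_bound hR hv (max |t| (|s| + 1))
  refine hasDerivAt_tsum_of_isPreconnected hb (Metric.isOpen_ball (x := s) (ε := 1))
    (convex_ball s 1).isPreconnected (fun m y _ => hd _ u v t y) ?_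
    (Metric.mem_ball_self one_pos) (hF.summable hR hv) (Metric.mem_ball_self one_pos)
  intro m y hy
  refine h m u v t y le_rfl (le_max_left _ _) (le_trans ?_ (le_max_right _ _))
  rw [Metric.mem_ball, Real.dist_eq] at hy
  have := abs_sub_abs_le_abs_sub y s
  linarith

/-- A joint derivative in `(u, v)` is used, rather than two partial ones, because Stokes' theorem
differentiates along translates of the curved lower boundary. -/
theorem hasFDerivAt_thetaSum {F Fu Fv : (Fin 4 → ℝ) → ℝ → ℝ → ℝ → ℝ → ℂ}
    (hF : IsThetaKernel F) (hFu : IsThetaKernel Fu) (hFv : IsThetaKernel Fv)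
    (hd : ∀ l t s (z : ℝ × ℝ), HasFDerivAt (fun z : ℝ × ℝ => F l z.1 z.2 t s)
      ((ContinuousLinearMap.fst ℝ ℝ ℝ).smulRight (Fu l z.1 z.2 t s) +
        (ContinuousLinearMap.snd ℝ ℝ ℝ).smulRight (Fv l z.1 z.2 t s)) z)
    {R : Matrix (Fin 4) (Fin 4) ℝ} (hR : IsUnit R.det) {z : ℝ × ℝ} (hz : 0 < z.2) (t s : ℝ) :
    HasFDerivAt (fun z : ℝ × ℝ => thetaSum R F z.1 z.2 t s)
      ((ContinuousLinearMap.fst ℝ ℝ ℝ).smulRight (thetaSum R Fu z.1 z.2 t s) +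
        (ContinuousLinearMap.snd ℝ ℝ ℝ).smulRight (thetaSum R Fv z.1 z.2 t s)) z := by
  obtain ⟨b, hb, h⟩ := hFu.local_bound hR (half_pos hz) (max |t| |s|)
  obtain ⟨b', hb', h'⟩ := hFv.local_bound hR (half_pos hz) (max |t| |s|)
  let U : Set (ℝ × ℝ) := {y | z.2 / 2 < y.2}
  have hU : IsOpen U := isOpen_lt (by fun_prop) (by fun_prop)
  have hUc : Convex ℝ U := by
    have : U = (LinearMap.snd ℝ ℝ ℝ) ⁻¹' Set.Ioi (z.2 / 2) := rfl
    rw [this]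
    exact (convex_Ioi _).linear_preimage _
  have hzU : z ∈ U := by change z.2 / 2 < z.2; linarith
  have key := hasFDerivAt_tsum_of_isPreconnected (hb.add hb') hU hUc.isPreconnected
    (f := fun (m : Fin 4 → ℤ) (z : ℝ × ℝ) => F (R.mulVec fun i => (m i : ℝ)) z.1 z.2 t s)
    (fun m y _ => hd (R.mulVec fun i => (m i : ℝ)) t s y) ?_ hzU (hF.summable hR hz) hzU
  · refine key.congr_fderiv ?_
    have s1 := (hFu.summable hR (u := z.1) (t := t) (s := s) hz)
    have s2 := (hFv.summable hR (u := z.1) (t := t) (s := s) hz)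
    have e1 : HasSum (fun m : Fin 4 → ℤ => (ContinuousLinearMap.fst ℝ ℝ ℝ).smulRight
        (Fu (R.mulVec fun i => (m i : ℝ)) z.1 z.2 t s))
        ((ContinuousLinearMap.fst ℝ ℝ ℝ).smulRight (thetaSum R Fu z.1 z.2 t s)) :=
      (ContinuousLinearMap.smulRightL ℝ (ℝ × ℝ) ℂ (ContinuousLinearMap.fst ℝ ℝ ℝ)).hasSum s1.hasSum
    have e2 : HasSum (fun m : Fin 4 → ℤ => (ContinuousLinearMap.snd ℝ ℝ ℝ).smulRight
        (Fv (R.mulVec fun i => (m i : ℝ)) z.1 z.2 t s))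
        ((ContinuousLinearMap.snd ℝ ℝ ℝ).smulRight (thetaSum R Fv z.1 z.2 t s)) :=
      (ContinuousLinearMap.smulRightL ℝ (ℝ × ℝ) ℂ (ContinuousLinearMap.snd ℝ ℝ ℝ)).hasSum s2.hasSum
    exact (e1.add e2).tsum_eq
  · intro m y hy
    have hy' : z.2 / 2 < y.2 := hy
    refine (norm_add_le _ _).trans (add_le_add ?_ ?_)
    · rw [ContinuousLinearMap.norm_smulRight_apply]
      have h1 := h m y.1 y.2 t s hy'.le (le_max_left _ _) (le_max_right _ _)
      have h2 := ContinuousLinearMap.norm_fst_le ℝ ℝ ℝ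
      nlinarith [norm_nonneg (Fu (R.mulVec fun i => (m i : ℝ)) y.1 y.2 t s)]
    · rw [ContinuousLinearMap.norm_smulRight_apply]
      have h1 := h' m y.1 y.2 t s hy'.le (le_max_left _ _) (le_max_right _ _)
      have h2 := ContinuousLinearMap.norm_snd_le ℝ ℝ ℝ
      nlinarith [norm_nonneg (Fv (R.mulVec fun i => (m i : ℝ)) y.1 y.2 t s)]

end

noncomputable section

/-! ### The kernels of the theta series and of their derivatives -/

/-- The kernel of the theta series itself. -/
def kernelXQ (l : Fin 4 → ℝ) (u v t s : ℝ) : ℂ :=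
  ((negX l t * posY l s : ℝ) : ℂ) * siegelGauss l u v t s

/-- The kernel of the `dt₀`-component of the closed differential form. -/
def kernelPY (l : Fin 4 → ℝ) (u v t s : ℝ) : ℂ :=
  ((posX l t * negY l s : ℝ) : ℂ) * siegelGauss l u v t s

/-- The kernel of the primitive of weight `(0, 2)`. -/
def kernelXY (l : Fin 4 → ℝ) (u v t s : ℝ) : ℂ :=
  ((v * (negX l t * negY l s) : ℝ) : ℂ) * siegelGauss l u v t s

/-- The derivative of `kernelXQ` in `s`. -/
def kernelXQDeriv (l : Fin 4 → ℝ) (u v t s : ℝ) : ℂ :=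
  ((negX l t * negY l s * (1 - 2 * Real.pi * v * posY l s ^ 2) : ℝ) : ℂ) * siegelGauss l u v t s

/-- The derivative of `kernelPY` in `t`. -/
def kernelPYDeriv (l : Fin 4 → ℝ) (u v t s : ℝ) : ℂ :=
  ((negX l t * negY l s * (1 - 2 * Real.pi * v * posX l t ^ 2) : ℝ) : ℂ) * siegelGauss l u v t s

/-- The derivative of `kernelXY` in `u`. -/
def kernelXYDerivU (l : Fin 4 → ℝ) (u v t s : ℝ) : ℂ :=
  ((v * (negX l t * negY l s) * (2 * Real.pi * hypForm l) : ℝ) : ℂ) * Complex.I *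
    siegelGauss l u v t s

/-- The derivative of `kernelXY` in `v`. -/
def kernelXYDerivV (l : Fin 4 → ℝ) (u v t s : ℝ) : ℂ :=
  ((negX l t * negY l s * (1 - Real.pi / 2 * v * majorant l t s) : ℝ) : ℂ) * siegelGauss l u v t s

theorem abs_coord_mul_le {a b H : ℝ} (h : a ^ 2 + b ^ 2 ≤ H) : |a * b| ≤ H := by
  rw [abs_le]
  constructor <;> nlinarith [sq_nonneg (a + b), sq_nonneg (a - b), sq_nonneg a, sq_nonneg b]

/-- Common shape of the differentiated kernels: a product of two coordinates times one minus a
multiple of `v` times a quadratic expression. The number `7` is a convenient upper bound for `2π`.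
-/
theorem abs_mul_one_sub_le {r v H x : ℝ} (hr : |r| ≤ H) (hv : 0 < v) (hx0 : 0 ≤ x)
    (hx : x ≤ 7 * (v * H)) : |r * (1 - x)| ≤ 7 * (H + v * H + v * H ^ 2) := by
  have hH : 0 ≤ H := (abs_nonneg r).trans hr
  have h1 : |1 - x| ≤ 1 + 7 * (v * H) := by
    rw [abs_le]; constructor <;> nlinarith [mul_nonneg hv.le hH]
  rw [abs_mul]
  have := mul_le_mul hr h1 (abs_nonneg _) hH
  nlinarith [mul_nonneg hv.le hH]

theorem isThetaKernel_kernelXQ : IsThetaKernel kernelXQ := by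
  refine IsThetaKernel.of_poly (fun l _ t s => ((negX l t * posY l s : ℝ) : ℂ))
    (fun l => by fun_prop) (fun v t s => by simp [negX]) 7 (by norm_num) fun l v t s hv => ?_
  have hH := majorant_nonneg l t s
  have h : |negX l t * posY l s| ≤ majorant l t s :=
    abs_coord_mul_le (by simp only [majorant]; nlinarith [sq_nonneg (negY l s), sq_nonneg (posX l t)])
  rw [Complex.norm_real, Real.norm_eq_abs]
  nlinarith [mul_nonneg hv.le hH, mul_nonneg hv.le (sq_nonneg (majorant l t s))]

theorem isThetaKernel_kernelPY : IsThetaKernel kernelPY := by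
  refine IsThetaKernel.of_poly (fun l _ t s => ((posX l t * negY l s : ℝ) : ℂ))
    (fun l => by fun_prop) (fun v t s => by simp [posX]) 7 (by norm_num) fun l v t s hv => ?_
  have hH := majorant_nonneg l t s
  have h : |posX l t * negY l s| ≤ majorant l t s :=
    abs_coord_mul_le (by simp only [majorant]; nlinarith [sq_nonneg (negX l t), sq_nonneg (posY l s)])
  rw [Complex.norm_real, Real.norm_eq_abs]
  nlinarith [mul_nonneg hv.le hH, mul_nonneg hv.le (sq_nonneg (majorant l t s))]

theorem abs_negX_mul_negY_le (l : Fin 4 → ℝ) (t s : ℝ) :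
    |negX l t * negY l s| ≤ majorant l t s :=
  abs_coord_mul_le (by simp only [majorant]; nlinarith [sq_nonneg (posX l t), sq_nonneg (posY l s)])

theorem isThetaKernel_kernelXY : IsThetaKernel kernelXY := by
  refine IsThetaKernel.of_poly (fun l v t s => ((v * (negX l t * negY l s) : ℝ) : ℂ))
    (fun l => by fun_prop) (fun v t s => by simp [negX]) 7 (by norm_num) fun l v t s hv => ?_
  have hH := majorant_nonneg l t s
  have h := abs_negX_mul_negY_le l t s
  rw [Complex.norm_real, Real.norm_eq_abs, abs_mul, abs_of_pos hv]
  have := mul_le_mul_of_nonneg_left h hv.le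
  nlinarith [mul_nonneg hv.le hH, mul_nonneg hv.le (sq_nonneg (majorant l t s))]

theorem isThetaKernel_kernelXQDeriv : IsThetaKernel kernelXQDeriv := by
  refine IsThetaKernel.of_poly (fun l v t s => ((negX l t * negY l s *
    (1 - 2 * Real.pi * v * posY l s ^ 2) : ℝ) : ℂ))
    (fun l => by fun_prop) (fun v t s => by simp [negX]) 7 (by norm_num) fun l v t s hv => ?_
  have hpi := Real.pi_pos
  rw [Complex.norm_real, Real.norm_eq_abs]
  refine abs_mul_one_sub_le (abs_negX_mul_negY_le l t s) hv (by positivity) ?_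
  have h1 : posY l s ^ 2 ≤ majorant l t s := by
    simp only [majorant]
    nlinarith [sq_nonneg (negX l t), sq_nonneg (negY l s), sq_nonneg (posX l t)]
  have h2 : 2 * Real.pi ≤ 7 := by linarith [Real.pi_lt_d2]
  calc 2 * Real.pi * v * posY l s ^ 2 = (2 * Real.pi) * (v * posY l s ^ 2) := by ring
    _ ≤ 7 * (v * majorant l t s) := by gcongr

theorem isThetaKernel_kernelPYDeriv : IsThetaKernel kernelPYDeriv := by
  refine IsThetaKernel.of_poly (fun l v t s => ((negX l t * negY l s *
    (1 - 2 * Real.pi * v * posX l t ^ 2) : ℝ) : ℂ))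
    (fun l => by fun_prop) (fun v t s => by simp [negX]) 7 (by norm_num) fun l v t s hv => ?_
  have hpi := Real.pi_pos
  rw [Complex.norm_real, Real.norm_eq_abs]
  refine abs_mul_one_sub_le (abs_negX_mul_negY_le l t s) hv (by positivity) ?_
  have h1 : posX l t ^ 2 ≤ majorant l t s := by
    simp only [majorant]
    nlinarith [sq_nonneg (negX l t), sq_nonneg (negY l s), sq_nonneg (posY l s)]
  have h2 : 2 * Real.pi ≤ 7 := by linarith [Real.pi_lt_d2]
  calc 2 * Real.pi * v * posX l t ^ 2 = (2 * Real.pi) * (v * posX l t ^ 2) := by ring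
    _ ≤ 7 * (v * majorant l t s) := by gcongr

theorem isThetaKernel_kernelXYDerivV : IsThetaKernel kernelXYDerivV := by
  refine IsThetaKernel.of_poly (fun l v t s => ((negX l t * negY l s *
    (1 - Real.pi / 2 * v * majorant l t s) : ℝ) : ℂ))
    (fun l => by simp only [majorant]; fun_prop) (fun v t s => by simp [negX]) 7 (by norm_num)
    fun l v t s hv => ?_
  have hpi := Real.pi_pos
  have hH := majorant_nonneg l t s
  rw [Complex.norm_real, Real.norm_eq_abs]
  refine abs_mul_one_sub_le (abs_negX_mul_negY_le l t s) hv (by positivity) ?_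
  have h2 : Real.pi / 2 ≤ 7 := by linarith [Real.pi_lt_d2]
  calc Real.pi / 2 * v * majorant l t s = (Real.pi / 2) * (v * majorant l t s) := by ring
    _ ≤ 7 * (v * majorant l t s) := by gcongr

theorem isThetaKernel_kernelXYDerivU : IsThetaKernel kernelXYDerivU := by
  refine IsThetaKernel.of_poly (fun l v t s => ((v * (negX l t * negY l s) *
    (2 * Real.pi * hypForm l) : ℝ) : ℂ) * Complex.I)
    (fun l => by fun_prop) (fun v t s => by simp [negX]) 7 (by norm_num) fun l v t s hv => ?_
  have hH := majorant_nonneg l t s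
  have hpi := Real.pi_pos
  have h := abs_negX_mul_negY_le l t s
  have h1 : |2 * Real.pi * hypForm l| ≤ 7 * majorant l t s := by
    have h3 : |hypForm l| ≤ majorant l t s := by
      have := four_mul_hypForm l t s
      have hm : majorant l t s =
        negX l t ^ 2 + negY l s ^ 2 + posX l t ^ 2 + posY l s ^ 2 := rfl
      rw [abs_le]
      constructor <;> nlinarith [sq_nonneg (negX l t), sq_nonneg (negY l s),
        sq_nonneg (posX l t), sq_nonneg (posY l s)]
    rw [abs_mul, abs_of_pos (by positivity : 0 < 2 * Real.pi)]
    have h2 : 2 * Real.pi ≤ 7 := by linarith [Real.pi_lt_d2]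
    gcongr
  rw [norm_mul, Complex.norm_I, mul_one, Complex.norm_real, Real.norm_eq_abs, abs_mul, abs_mul,
    abs_of_pos hv]
  calc v * |negX l t * negY l s| * |2 * Real.pi * hypForm l|
      ≤ v * majorant l t s * (7 * majorant l t s) := by gcongr
    _ ≤ _ := by nlinarith [mul_nonneg hv.le hH]

theorem hasDerivAt_kernelXQ (l : Fin 4 → ℝ) (u v t s : ℝ) :
    HasDerivAt (fun s => kernelXQ l u v t s) (kernelXQDeriv l u v t s) s := by
  have h := (((hasDerivAt_posY l s).const_mul (negX l t)).ofReal_comp).mul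
    (hasDerivAt_siegelGauss_s l u v t s)
  refine h.congr_deriv ?_
  simp only [kernelXQDeriv]
  push_cast
  ring

theorem hasDerivAt_kernelPY (l : Fin 4 → ℝ) (u v t s : ℝ) :
    HasDerivAt (fun t => kernelPY l u v t s) (kernelPYDeriv l u v t s) t := by
  have h := (((hasDerivAt_posX l t).mul_const (negY l s)).ofReal_comp).mul
    (hasDerivAt_siegelGauss_t l u v t s)
  refine h.congr_deriv ?_
  simp only [kernelPYDeriv]
  push_cast
  ring

theorem hasFDerivAt_kernelXY (l : Fin 4 → ℝ) (t s : ℝ) (z : ℝ × ℝ) :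
    HasFDerivAt (fun z : ℝ × ℝ => kernelXY l z.1 z.2 t s)
      ((ContinuousLinearMap.fst ℝ ℝ ℝ).smulRight (kernelXYDerivU l z.1 z.2 t s) +
        (ContinuousLinearMap.snd ℝ ℝ ℝ).smulRight (kernelXYDerivV l z.1 z.2 t s)) z := by
  have h2 : HasFDerivAt (fun z : ℝ × ℝ => (z.2 : ℂ))
    (Complex.ofRealCLM.comp (ContinuousLinearMap.snd ℝ ℝ ℝ)) z :=
    (Complex.ofRealCLM.comp (ContinuousLinearMap.snd ℝ ℝ ℝ)).hasFDerivAt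
  have h := (h2.mul_const (((negX l t * negY l s : ℝ) : ℂ))).mul (hasFDerivAt_siegelGauss l t s z)
  have e : (fun z : ℝ × ℝ => kernelXY l z.1 z.2 t s) = (fun z : ℝ × ℝ => (z.2 : ℂ) *
      ((negX l t * negY l s : ℝ) : ℂ)) * fun z : ℝ × ℝ => siegelGauss l z.1 z.2 t s := by
    ext z
    simp [kernelXY]
  rw [e]
  refine h.congr_fderiv ?_
  ext x <;> simp [kernelXYDerivU, kernelXYDerivV] <;> ring

/-- The differential form is closed up to a total derivative in the upper half plane. -/
theorem kernelXQDeriv_add_kernelPYDeriv (l : Fin 4 → ℝ) (u v t s : ℝ) :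
    kernelXQDeriv l u v t s + kernelPYDeriv l u v t s =
      2 * Complex.I * (kernelXYDerivU l u v t s - Complex.I * kernelXYDerivV l u v t s) := by
  -- With `Q` the form and `H` the majorant, both sides carry the factor `negX * negY`, and the
  -- identity reduces to `4 Q + H = 2 (posX² + posY²)`.
  have h := four_mul_hypForm l t s
  have h' : (4 * hypForm l : ℂ) =
      posX l t ^ 2 + posY l s ^ 2 - negX l t ^ 2 - negY l s ^ 2 := by exact_mod_cast h
  simp only [kernelXQDeriv, kernelPYDeriv, kernelXYDerivU, kernelXYDerivV, majorant]
  push_cast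
  linear_combination ((v : ℂ) * negX l t * negY l s * Real.pi * siegelGauss l u v t s) * h' +
    ((2 * negX l t * negY l s * siegelGauss l u v t s - 4 * Real.pi * hypForm l * v * negX l t * negY l s * siegelGauss l u v t s -
      Real.pi * v * negX l t * negY l s * siegelGauss l u v t s * (negX l t ^ 2 + negY l s ^ 2 + posX l t ^ 2 + posY l s ^ 2)) : ℂ) * Complex.I_sq

/-! ### Even unimodular lattices -/

/-- The Gram matrix of the polarization of `hypForm`. -/
def hypGram : Matrix (Fin 4) (Fin 4) ℝ := !![0, 1, 0, 0; 1, 0, 0, 0; 0, 0, 0, -1; 0, 0, -1, 0]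

/-- The columns of `R` span an even unimodular lattice for `hypForm`. -/
structure IsEvenUnimodular (R : Matrix (Fin 4) (Fin 4) ℝ) : Prop where
  gram : ∃ G G' : Matrix (Fin 4) (Fin 4) ℤ, G * G' = 1 ∧
    R.transpose * hypGram * R = G.map (Int.cast : ℤ → ℝ)
  even : ∀ m : Fin 4 → ℤ, ∃ k : ℤ, hypForm (R.mulVec fun i => (m i : ℝ)) = k

/-- The matrix of the four coordinate functions, scaled by `1 / √2`. -/
def frameMatrix (t s : ℝ) : Matrix (Fin 4) (Fin 4) ℝ :=
  (√2)⁻¹ • !![-Real.exp (-t), Real.exp t, 0, 0; 0, 0, -Real.exp (-s), -Real.exp s;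
    Real.exp (-t), Real.exp t, 0, 0; 0, 0, Real.exp (-s), -Real.exp s]

/-- The signature of the frame. -/
def frameSign : Fin 4 → ℝ := ![-1, -1, 1, 1]

theorem frameMatrix_mulVec (t s : ℝ) (l : Fin 4 → ℝ) :
    (frameMatrix t s).mulVec l =
      (√2)⁻¹ • ![negX l t, negY l s, posX l t, posY l s] := by
  rw [frameMatrix, Matrix.smul_mulVec]
  congr 1
  ext i
  fin_cases i <;>
    simp [Matrix.mulVec, dotProduct, Fin.sum_univ_four, negX, negY, posX, posY] <;> ring

/-- The four rescaled coordinates diagonalize the form with signs `-, -, +, +`, so the frame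
composed with a lattice basis meets the hypothesis of `tsum_prod_gaussFactor`. -/
theorem frameMatrix_gram (t s : ℝ) :
    (frameMatrix t s).transpose * Matrix.diagonal frameSign * frameMatrix t s = hypGram := by
  have h1 : Real.exp t * Real.exp (-t) = 1 := by rw [← Real.exp_add]; simp
  have h2 : Real.exp s * Real.exp (-s) = 1 := by rw [← Real.exp_add]; simp
  have h3 : (√2)⁻¹ * (√2)⁻¹ = (1 / 2 : ℝ) := by
    rw [← mul_inv, Real.mul_self_sqrt (by norm_num)]; norm_num
  rw [frameMatrix, Matrix.transpose_smul, Matrix.smul_mul, Matrix.smul_mul, Matrix.mul_smul,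
    smul_smul, h3]
  ext i j
  fin_cases i <;> fin_cases j <;>
    simp [Matrix.mul_apply, Fin.sum_univ_four, hypGram, frameSign, Matrix.diagonal] <;>
    linarith

theorem det_hypGram : hypGram.det = 1 := by
  simp [hypGram, Matrix.det_succ_row_zero, Fin.sum_univ_succ, Fin.succAbove]

/-- The square of `det R` is the determinant of an invertible integral Gram matrix, hence `±1`, and
over `ℝ` the sign is positive. -/
theorem IsEvenUnimodular.abs_det {R : Matrix (Fin 4) (Fin 4) ℝ} (hR : IsEvenUnimodular R) :
    |R.det| = 1 := by
  obtain ⟨G, G', hG, hRG⟩ := hR.gram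
  have h1 := congrArg Matrix.det hRG
  rw [Matrix.det_mul, Matrix.det_mul, Matrix.det_transpose, det_hypGram, mul_one] at h1
  have h2 : (G.map (Int.cast : ℤ → ℝ)).det = (G.det : ℝ) := by
    simpa using (Int.castRingHom ℝ).map_det G |>.symm
  have h3 : IsUnit G.det := by
    have := congrArg Matrix.det hG
    rw [Matrix.det_mul, Matrix.det_one] at this
    exact IsUnit.of_mul_eq_one _ this
  rw [h2] at h1
  rcases Int.isUnit_iff.mp h3 with h | h
  · rw [h] at h1
    push_cast at h1
    rw [abs_eq zero_le_one]
    exact mul_self_eq_one_iff.mp h1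
  · rw [h] at h1
    push_cast at h1
    nlinarith [mul_self_nonneg R.det]

theorem IsEvenUnimodular.isUnit_det {R : Matrix (Fin 4) (Fin 4) ℝ} (hR : IsEvenUnimodular R) :
    IsUnit R.det := by
  rw [isUnit_iff_ne_zero]
  intro h
  have := hR.abs_det
  simp [h] at this

theorem abs_det_frameMatrix (t s : ℝ) : |(frameMatrix t s).det| = 1 := by
  have h1 := congrArg Matrix.det (frameMatrix_gram t s)
  rw [Matrix.det_mul, Matrix.det_mul, Matrix.det_transpose, det_hypGram, Matrix.det_diagonal] at h1
  have : ∏ i, frameSign i = 1 := by simp [frameSign, Fin.prod_univ_four]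
  rw [this, mul_one] at h1
  rw [abs_eq zero_le_one]
  exact mul_self_eq_one_iff.mp h1

/-- The parameters of the four Gaussian factors. -/
def frameTau (τ : ℂ) : Fin 4 → ℂ := ![-(starRingEnd ℂ τ), -(starRingEnd ℂ τ), τ, τ]

/-- In orthogonal coordinates the Siegel Gaussian is a product of one-variable Gaussians, with
parameter `τ` in the positive directions and `-τ̄`, again in the upper half-plane, in the negative
ones. -/
theorem prod_gaussFactor_frame (k : Fin 4 → ℕ) (l : Fin 4 → ℝ) (u v t s : ℝ) :
    ∏ i, gaussFactor (k i) (frameTau ⟨u, v⟩ i) ((frameMatrix t s).mulVec l i) =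
      (((√2)⁻¹ ^ (∑ i, k i) : ℝ) : ℂ) *
      (((negX l t ^ k 0 * negY l s ^ k 1 * posX l t ^ k 2 * posY l s ^ k 3 : ℝ) : ℂ) *
        siegelGauss l u v t s) := by
  have h3 : (((√2)⁻¹ : ℝ) : ℂ) ^ 2 = 1 / 2 := by
    have : ((√2)⁻¹ : ℝ) ^ 2 = (1 / 2 : ℝ) := by
      rw [inv_pow, Real.sq_sqrt (by norm_num)]; norm_num
    rw [← Complex.ofReal_pow, this]
    norm_num
  have h4 := four_mul_hypForm l t s
  have h4' : (4 * hypForm l : ℂ) =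
      posX l t ^ 2 + posY l s ^ 2 - negX l t ^ 2 - negY l s ^ 2 := by exact_mod_cast h4
  have hexp : siegelGauss l u v t s =
      Complex.exp (Real.pi * Complex.I * (-(starRingEnd ℂ ⟨u, v⟩)) *
          (((√2)⁻¹ * negX l t : ℝ) : ℂ) ^ 2) *
        Complex.exp (Real.pi * Complex.I * (-(starRingEnd ℂ ⟨u, v⟩)) *
          (((√2)⁻¹ * negY l s : ℝ) : ℂ) ^ 2) *
        Complex.exp (Real.pi * Complex.I * (⟨u, v⟩ : ℂ) * (((√2)⁻¹ * posX l t : ℝ) : ℂ) ^ 2) *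
        Complex.exp (Real.pi * Complex.I * (⟨u, v⟩ : ℂ) * (((√2)⁻¹ * posY l s : ℝ) : ℂ) ^ 2) := by
    rw [← Complex.exp_add, ← Complex.exp_add, ← Complex.exp_add, siegelGauss]
    congr 1
    have e1 : (⟨u, v⟩ : ℂ) = u + v * Complex.I := Complex.mk_eq_add_mul_I u v
    have e2 : (starRingEnd ℂ ⟨u, v⟩) = u - v * Complex.I := by
      rw [e1]; simp [sub_eq_add_neg]
    have e3 : ∀ y : ℝ, (((√2)⁻¹ * y : ℝ) : ℂ) ^ 2 = 1 / 2 * (y : ℂ) ^ 2 := fun y => by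
      rw [Complex.ofReal_mul, mul_pow, h3]
    rw [e2, e1, majorant, e3, e3, e3, e3]
    push_cast
    linear_combination (Real.pi * u * Complex.I / 2) * h4' -
      (Real.pi * v / 2 * (negX l t ^ 2 + negY l s ^ 2 + posX l t ^ 2 + posY l s ^ 2)) *
        Complex.I_sq
  rw [Fin.prod_univ_four, Fin.sum_univ_four, hexp, frameMatrix_mulVec]
  simp only [gaussFactor, frameTau, Pi.smul_apply, Matrix.cons_val_zero, Matrix.cons_val_one,
    Matrix.cons_val, smul_eq_mul]
  push_cast
  ring

/-- The inversion formula for the theta series of an even unimodular lattice. -/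
theorem tsum_frame_inversion {R : Matrix (Fin 4) (Fin 4) ℝ} (hR : IsEvenUnimodular R)
    {k : Fin 4 → ℕ} (hk : ∀ i, k i ≤ 1) {u v : ℝ} (hv : 0 < v) (t s : ℝ) :
    thetaSum R (fun l u v t s => ((negX l t ^ k 0 * negY l s ^ k 1 * posX l t ^ k 2 *
        posY l s ^ k 3 : ℝ) : ℂ) * siegelGauss l u v t s) u v t s =
      (1 / ((u ^ 2 + v ^ 2 : ℝ) : ℂ)) * (1 / (⟨u, -v⟩ : ℂ)) ^ (k 0 + k 1) *
        (1 / (⟨u, v⟩ : ℂ)) ^ (k 2 + k 3) *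
      thetaSum R (fun l u v t s => ((negX l t ^ k 0 * negY l s ^ k 1 * posX l t ^ k 2 *
        posY l s ^ k 3 : ℝ) : ℂ) * siegelGauss l u v t s)
        (-u / (u ^ 2 + v ^ 2)) (v / (u ^ 2 + v ^ 2)) t s := by
  obtain ⟨G, G', hG, hRG⟩ := hR.gram
  set W := frameMatrix t s * R with hW
  set n : ℝ := u ^ 2 + v ^ 2 with hn
  have hn0 : 0 < n := by positivity
  have hWdet : |W.det| = 1 := by
    rw [hW, Matrix.det_mul, abs_mul, abs_det_frameMatrix, hR.abs_det, one_mul]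
  have hWG : W.transpose * Matrix.diagonal frameSign * W = G.map (Int.cast : ℤ → ℝ) := by
    rw [← hRG, ← frameMatrix_gram t s, hW, Matrix.transpose_mul]
    simp only [Matrix.mul_assoc]
  have hz : ∀ i, 0 < (frameTau ⟨u, v⟩ i).im := by
    intro i
    fin_cases i <;> simp [frameTau, hv]
  have hD : ∀ i, frameSign i ≠ 0 := by
    intro i
    fin_cases i <;> simp [frameSign]
  have key := tsum_prod_gaussFactor hk hz hWdet hG frameSign hD hWG
  have hτ0 : (⟨u, v⟩ : ℂ) ≠ 0 := by
    intro h
    have := congrArg Complex.im h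
    simp at this
    linarith
  have hτ0' : (⟨u, -v⟩ : ℂ) ≠ 0 := by
    intro h
    have := congrArg Complex.im h
    simp at this
    linarith
  have hττ : (⟨u, v⟩ : ℂ) * ⟨u, -v⟩ = ((n : ℝ) : ℂ) := by
    apply Complex.ext
    · rw [Complex.ofReal_re, hn]; simp; ring
    · rw [Complex.ofReal_im]; simp; ring
  have hconj : starRingEnd ℂ (⟨u, v⟩ : ℂ) = ⟨u, -v⟩ := by
    apply Complex.ext <;> simp
  -- The inversions of the single factors fit together: `-1 / (-τ̄)` is minus the conjugate of `-1 /
  -- τ`, so all four arise from the one point `-1 / τ`.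
  have hinv : ∀ i, -1 / frameTau ⟨u, v⟩ i = frameTau ⟨-u / n, v / n⟩ i := by
    have hnC : ((n : ℝ) : ℂ) ≠ 0 := by exact_mod_cast hn0.ne'
    have e1 : (-1 : ℂ) / ⟨u, v⟩ = ⟨-u / n, v / n⟩ := by
      rw [div_eq_iff hτ0]
      apply Complex.ext <;> simp <;> field_simp <;> simp [hn] <;> ring
    have e2 : (-1 : ℂ) / (-(⟨u, -v⟩ : ℂ)) = -(starRingEnd ℂ ⟨-u / n, v / n⟩) := by
      rw [← e1, map_div₀, map_neg, map_one, hconj]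
      field_simp
    intro i
    fin_cases i
    · simpa [frameTau, hconj] using e2
    · simpa [frameTau, hconj] using e2
    · simpa [frameTau] using e1
    · simpa [frameTau] using e1
  have hsign : ∀ (i : Fin 4) (z : ℂ) (y : ℝ), gaussFactor (k i) z (frameSign i * y) =
      (frameSign i : ℂ) ^ k i * gaussFactor (k i) z y := by
    intro i z y
    have : (frameSign i) ^ 2 = 1 := by fin_cases i <;> simp [frameSign]
    have h2 : ((frameSign i : ℝ) : ℂ) ^ 2 = 1 := by exact_mod_cast this
    simp only [gaussFactor, Complex.ofReal_mul, mul_pow, h2, one_mul]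
    ring
  -- Each square root occurs twice, as there are two positive and two negative directions, so no
  -- branch choice remains. Together they give `1 / |τ|²`.
  have hroot : ∀ w : ℂ, w ^ (1 / 2 : ℂ) * w ^ (1 / 2 : ℂ) = w := by
    intro w
    have := Complex.cpow_nat_inv_pow w (n := 2) (by norm_num)
    rw [← pow_two]
    simpa using this
  have hconst : ∏ i, ((1 / (-Complex.I * frameTau ⟨u, v⟩ i)) ^ (1 / 2 : ℂ) *
      (1 / frameTau ⟨u, v⟩ i) ^ k i * (frameSign i : ℂ) ^ k i) =
      (1 / (n : ℂ)) * (1 / (⟨u, -v⟩ : ℂ)) ^ (k 0 + k 1) * (1 / (⟨u, v⟩ : ℂ)) ^ (k 2 + k 3) := by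
    rw [Fin.prod_univ_four]
    simp only [frameTau, frameSign, Matrix.cons_val_zero, Matrix.cons_val_one, Matrix.cons_val,
      hconj, Complex.ofReal_neg, Complex.ofReal_one, one_pow, mul_one]
    -- In the negative directions the sign from the frame cancels the sign in `-τ̄`.
    have e3 : ∀ j : ℕ, (1 / (-(⟨u, -v⟩ : ℂ))) ^ j * (-1) ^ j = (1 / (⟨u, -v⟩ : ℂ)) ^ j := by
      intro j
      rw [← mul_pow]
      congr 1
      field_simp
    have e4 := hroot (1 / (-Complex.I * (-(⟨u, -v⟩ : ℂ))))
    have e5 := hroot (1 / (-Complex.I * (⟨u, v⟩ : ℂ)))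
    have e6 : (1 / (-Complex.I * (-(⟨u, -v⟩ : ℂ)))) * (1 / (-Complex.I * (⟨u, v⟩ : ℂ))) =
        1 / (n : ℂ) := by
      rw [← hττ, one_div_mul_one_div]
      congr 1
      linear_combination (-(⟨u, -v⟩ : ℂ) * ⟨u, v⟩) * Complex.I_mul_I
    rw [← e6, pow_add, pow_add, ← e3 (k 0), ← e3 (k 1)]
    generalize (1 / (-Complex.I * (-(⟨u, -v⟩ : ℂ)))) ^ (1 / 2 : ℂ) = r₁ at e4 ⊢
    generalize (1 / (-Complex.I * (⟨u, v⟩ : ℂ))) ^ (1 / 2 : ℂ) = r₂ at e5 ⊢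
    rw [← e4, ← e5]
    ring
  have hterm : ∀ (u' v' : ℝ) (m : Fin 4 → ℤ), ∏ i, gaussFactor (k i) (frameTau ⟨u', v'⟩ i)
      ((W.mulVec fun j => (m j : ℝ)) i) = (((√2)⁻¹ ^ (∑ i, k i) : ℝ) : ℂ) *
      (fun l u v t s => ((negX l t ^ k 0 * negY l s ^ k 1 * posX l t ^ k 2 *
        posY l s ^ k 3 : ℝ) : ℂ) * siegelGauss l u v t s) (R.mulVec fun i => (m i : ℝ)) u' v' t s := by
    intro u' v' m
    rw [hW, ← Matrix.mulVec_mulVec]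
    exact prod_gaussFactor_frame k _ u' v' t s
  have hc : (((√2)⁻¹ ^ (∑ i, k i) : ℝ) : ℂ) ≠ 0 := by
    have : ((√2)⁻¹ ^ (∑ i, k i) : ℝ) ≠ 0 := by positivity
    exact_mod_cast this
  simp_rw [hsign, hinv] at key
  have hsplit : ∀ m : Fin 4 → ℤ, ∏ i, ((1 / (-Complex.I * frameTau ⟨u, v⟩ i)) ^ (1 / 2 : ℂ) *
      (1 / frameTau ⟨u, v⟩ i) ^ k i * ((frameSign i : ℂ) ^ k i *
        gaussFactor (k i) (frameTau ⟨-u / n, v / n⟩ i) ((W.mulVec fun j => (m j : ℝ)) i))) =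
      ((1 / (n : ℂ)) * (1 / (⟨u, -v⟩ : ℂ)) ^ (k 0 + k 1) * (1 / (⟨u, v⟩ : ℂ)) ^ (k 2 + k 3)) *
      ∏ i, gaussFactor (k i) (frameTau ⟨-u / n, v / n⟩ i) ((W.mulVec fun j => (m j : ℝ)) i) := by
    intro m
    rw [← hconst, ← Finset.prod_mul_distrib]
    exact Finset.prod_congr rfl fun i _ => by ring
  simp_rw [hsplit, hterm, tsum_mul_left] at key
  apply mul_left_cancel₀ hc
  rw [thetaSum, thetaSum, key]
  ring

end

/-! ### Modular transformation of the theta series -/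

noncomputable section

/-- Evenness of the lattice: `u` enters only through `e(Q(λ) u)`, and `Q(λ)` is an integer. -/
theorem thetaSum_add_one {R : Matrix (Fin 4) (Fin 4) ℝ} (hR : IsEvenUnimodular R)
    (P : (Fin 4 → ℝ) → ℝ → ℝ → ℝ → ℂ) (u v t s : ℝ) :
    thetaSum R (fun l u v t s => P l v t s * siegelGauss l u v t s) (u + 1) v t s =
      thetaSum R (fun l u v t s => P l v t s * siegelGauss l u v t s) u v t s := by
  refine tsum_congr fun m => ?_
  obtain ⟨k, hk⟩ := hR.even m
  simp only [siegelGauss]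
  congr 1
  rw [hk]
  have : (((2 * Real.pi * k * (u + 1) : ℝ) : ℂ) * Complex.I -
      ((Real.pi / 2 * v * majorant (R.mulVec fun i => (m i : ℝ)) t s : ℝ) : ℂ)) =
      (((2 * Real.pi * k * u : ℝ) : ℂ) * Complex.I -
      ((Real.pi / 2 * v * majorant (R.mulVec fun i => (m i : ℝ)) t s : ℝ) : ℂ)) +
        k * (2 * Real.pi * Complex.I) := by push_cast; ring
  rw [this, Complex.exp_periodic.int_mul k]

theorem thetaSum_kernelXQ_add_one {R : Matrix (Fin 4) (Fin 4) ℝ} (hR : IsEvenUnimodular R)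
    (u v t s : ℝ) : thetaSum R kernelXQ (u + 1) v t s = thetaSum R kernelXQ u v t s :=
  thetaSum_add_one hR (fun l _ t s => ((negX l t * posY l s : ℝ) : ℂ)) u v t s

theorem thetaSum_kernelXY_add_one {R : Matrix (Fin 4) (Fin 4) ℝ} (hR : IsEvenUnimodular R)
    (u v t s : ℝ) : thetaSum R kernelXY (u + 1) v t s = thetaSum R kernelXY u v t s :=
  thetaSum_add_one hR (fun l v t s => ((v * (negX l t * negY l s) : ℝ) : ℂ)) u v t s

theorem mk_mul_mk_neg (u v : ℝ) : (⟨u, v⟩ : ℂ) * ⟨u, -v⟩ = ((u ^ 2 + v ^ 2 : ℝ) : ℂ) := by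
  apply Complex.ext
  · rw [Complex.ofReal_re]; simp; ring
  · rw [Complex.ofReal_im]; simp; ring

/-- One negative and one positive linear factor contribute `1 / τ̄` and `1 / τ`, which joins the
Gaussian factor `1 / |τ|²` to `|τ|⁻⁴`. This is exactly what `v²` compensates. -/
theorem thetaSum_kernelXQ_inversion {R : Matrix (Fin 4) (Fin 4) ℝ} (hR : IsEvenUnimodular R)
    {u v : ℝ} (hv : 0 < v) (t s : ℝ) :
    thetaSum R kernelXQ u v t s = (1 / ((u ^ 2 + v ^ 2 : ℝ) : ℂ)) ^ 2 *
      thetaSum R kernelXQ (-u / (u ^ 2 + v ^ 2)) (v / (u ^ 2 + v ^ 2)) t s := by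
  have h := tsum_frame_inversion hR (k := ![1, 0, 0, 1])
    (by intro i; fin_cases i <;> simp) (u := u) hv t s
  have e : (fun (l : Fin 4 → ℝ) (u v t s : ℝ) => ((negX l t ^ (![1, 0, 0, 1] : Fin 4 → ℕ) 0 *
      negY l s ^ (![1, 0, 0, 1] : Fin 4 → ℕ) 1 * posX l t ^ (![1, 0, 0, 1] : Fin 4 → ℕ) 2 *
        posY l s ^ (![1, 0, 0, 1] : Fin 4 → ℕ) 3 : ℝ) : ℂ) * siegelGauss l u v t s) =
        kernelXQ := by
    funext l u v t s
    simp [kernelXQ]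
  rw [e] at h
  rw [h, pow_two (1 / ((u ^ 2 + v ^ 2 : ℝ) : ℂ))]
  nth_rewrite 3 [← mk_mul_mk_neg]
  simp only [Matrix.cons_val_zero, Matrix.cons_val_one, Matrix.cons_val, add_zero, zero_add,
    pow_one]
  rw [one_div_mul_eq_div, ← one_div_mul_one_div]
  ring

/-- Two negative linear factors give weight `(1, 3)`, and the factor `v` lowers it to `(0, 2)`. Only
the unit circle is needed, where `-1 / τ = -τ̄` reflects `u` and fixes `v`. -/
theorem thetaSum_kernelXY_inversion {R : Matrix (Fin 4) (Fin 4) ℝ} (hR : IsEvenUnimodular R)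
    {u v : ℝ} (hv : 0 < v) (huv : u ^ 2 + v ^ 2 = 1) (t s : ℝ) :
    thetaSum R kernelXY (-u) v t s = (⟨u, -v⟩ : ℂ) ^ 2 * thetaSum R kernelXY u v t s := by
  have h := tsum_frame_inversion hR (k := ![1, 1, 0, 0])
    (by intro i; fin_cases i <;> simp) (u := u) hv t s
  have e : ∀ u, thetaSum R kernelXY u v t s = (v : ℂ) *
      thetaSum R (fun (l : Fin 4 → ℝ) (u v t s : ℝ) =>
      ((negX l t ^ (![1, 1, 0, 0] : Fin 4 → ℕ) 0 *
      negY l s ^ (![1, 1, 0, 0] : Fin 4 → ℕ) 1 * posX l t ^ (![1, 1, 0, 0] : Fin 4 → ℕ) 2 *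
        posY l s ^ (![1, 1, 0, 0] : Fin 4 → ℕ) 3 : ℝ) : ℂ) * siegelGauss l u v t s) u v t s := by
    intro u
    rw [thetaSum, thetaSum, ← tsum_mul_left]
    refine tsum_congr fun m => ?_
    simp [kernelXY]
    ring
  have h0 : (⟨u, -v⟩ : ℂ) ≠ 0 := by
    intro h
    have := congrArg Complex.im h
    simp at this
    linarith
  rw [e, e, h, huv]
  simp only [div_one, Matrix.cons_val_zero, Matrix.cons_val_one, Matrix.cons_val]
  push_cast
  field_simp

/-! ### Stokes' theorem on the standard fundamental domain -/

/-- The lower boundary of the standard fundamental domain. -/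
def arc (u : ℝ) : ℝ := √(1 - u ^ 2)

/-- The half strip which parametrizes the standard fundamental domain through
`(u, r) ↦ u + i (arc u + r)`. -/
def halfStrip : Set (ℝ × ℝ) := Set.Icc (-(1 / 2)) (1 / 2) ×ˢ Set.Ici 0

@[fun_prop]
theorem continuous_arc : Continuous arc := by unfold arc; fun_prop

theorem half_le_arc {u : ℝ} (hu : u ∈ Set.Icc (-(1 / 2) : ℝ) (1 / 2)) : 1 / 2 ≤ arc u := by
  apply Real.le_sqrt_of_sq_le
  nlinarith [hu.1, hu.2]

theorem sq_add_arc_sq {u : ℝ} (hu : u ∈ Set.Icc (-(1 / 2) : ℝ) (1 / 2)) :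
    u ^ 2 + arc u ^ 2 = 1 := by
  rw [arc, Real.sq_sqrt (by nlinarith [hu.1, hu.2])]
  ring

theorem arc_neg (u : ℝ) : arc (-u) = arc u := by simp [arc]

theorem hasDerivAt_arc {u : ℝ} (hu : u ∈ Set.Icc (-(1 / 2) : ℝ) (1 / 2)) :
    HasDerivAt arc (-u / arc u) u := by
  have h1 : 0 < 1 - u ^ 2 := by nlinarith [hu.1, hu.2]
  have h := (((hasDerivAt_id u).pow 2).const_sub 1).sqrt (by simpa using h1.ne')
  refine h.congr_deriv ?_
  have : √(1 - u ^ 2) ≠ 0 := (Real.sqrt_pos.mpr h1).ne'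
  simp [arc]
  field_simp

theorem measurableSet_halfStrip : MeasurableSet halfStrip :=
  measurableSet_Icc.prod measurableSet_Ici

theorem volume_restrict_halfStrip : (volume : Measure (ℝ × ℝ)).restrict halfStrip =
    (volume.restrict (Set.Icc (-(1 / 2) : ℝ) (1 / 2))).prod (volume.restrict (Set.Ici (0 : ℝ))) := by
  rw [Measure.prod_restrict, Measure.volume_eq_prod]
  rfl

theorem integrableOn_exp_halfStrip {c : ℝ} (hc : 0 < c) (C : ℝ) :
    IntegrableOn (fun z : ℝ × ℝ => C * Real.exp (-(c * z.2))) halfStrip := by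
  rw [IntegrableOn, volume_restrict_halfStrip]
  have h1 : Integrable (fun _ : ℝ => C) (volume.restrict (Set.Icc (-(1 / 2) : ℝ) (1 / 2))) :=
    integrable_const _
  have h2 : Integrable (fun r : ℝ => Real.exp (-(c * r))) (volume.restrict (Set.Ici (0 : ℝ))) := by
    have := exp_neg_integrableOn_Ioi 0 hc
    rw [← IntegrableOn, integrableOn_Ici_iff_integrableOn_Ioi]
    simpa using this
  exact h1.mul_prod h2

theorem integrableOn_halfStrip_of_exp_bound {h : ℝ × ℝ → ℂ} (hc : ContinuousOn h halfStrip)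
    {c C : ℝ} (hc0 : 0 < c) (hb : ∀ z ∈ halfStrip, ‖h z‖ ≤ C * Real.exp (-(c * z.2))) :
    IntegrableOn h halfStrip := by
  refine (integrableOn_exp_halfStrip hc0 C).mono'
    (hc.aestronglyMeasurable measurableSet_halfStrip) ?_
  exact (ae_restrict_iff' measurableSet_halfStrip).mpr (Filter.Eventually.of_forall hb)

/-- Stokes' theorem for the one-form `g dτ̄`, invariant under `T` and `S`: the vertical sides cancel
by `hT`, the two halves of the arc cancel by `hS`, and the cusp contributes nothing by exponential
decay. -/
theorem integral_halfStrip_wirtinger_eq_zero {g gu gv : ℝ → ℝ → ℂ}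
    (hd : ∀ z : ℝ × ℝ, 0 < z.2 → HasFDerivAt (fun z : ℝ × ℝ => g z.1 z.2)
      ((ContinuousLinearMap.fst ℝ ℝ ℝ).smulRight (gu z.1 z.2) +
        (ContinuousLinearMap.snd ℝ ℝ ℝ).smulRight (gv z.1 z.2)) z)
    (hgu : ContinuousOn (fun z : ℝ × ℝ => gu z.1 z.2) {z | 0 < z.2})
    (hgv : ContinuousOn (fun z : ℝ × ℝ => gv z.1 z.2) {z | 0 < z.2})
    {c C : ℝ} (hc : 0 < c) (hC : 0 ≤ C)
    (hbg : ∀ u v, 1 / 2 ≤ v → ‖g u v‖ ≤ C * Real.exp (-(c * v)))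
    (hbu : ∀ u v, 1 / 2 ≤ v → ‖gu u v‖ ≤ C * Real.exp (-(c * v)))
    (hbv : ∀ u v, 1 / 2 ≤ v → ‖gv u v‖ ≤ C * Real.exp (-(c * v)))
    (hT : ∀ v, 0 < v → g (1 / 2) v = g (-(1 / 2)) v)
    (hS : ∀ u ∈ Set.Icc (-(1 / 2) : ℝ) (1 / 2),
      g (-u) (arc u) = (⟨u, -arc u⟩ : ℂ) ^ 2 * g u (arc u)) :
    ∫ z in halfStrip, (gu z.1 (arc z.1 + z.2) - Complex.I * gv z.1 (arc z.1 + z.2)) = 0 := by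
  set J : Set ℝ := Set.Icc (-(1 / 2) : ℝ) (1 / 2) with hJ
  have hpos : ∀ z ∈ halfStrip, 1 / 2 ≤ arc z.1 + z.2 := fun z hz => by
    have h1 := half_le_arc hz.1
    have h2 : 0 ≤ z.2 := hz.2
    linarith
  have hmaps : Set.MapsTo (fun z : ℝ × ℝ => (z.1, arc z.1 + z.2)) halfStrip {z | 0 < z.2} :=
    fun z hz => lt_of_lt_of_le one_half_pos (hpos z hz)
  have hcu : ContinuousOn (fun z : ℝ × ℝ => gu z.1 (arc z.1 + z.2)) halfStrip :=
    hgu.comp (Continuous.continuousOn (by fun_prop)) hmaps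
  have hcv : ContinuousOn (fun z : ℝ × ℝ => gv z.1 (arc z.1 + z.2)) halfStrip :=
    hgv.comp (Continuous.continuousOn (by fun_prop)) hmaps
  have hexp : ∀ z ∈ halfStrip, C * Real.exp (-(c * (arc z.1 + z.2))) ≤ C * Real.exp (-(c * z.2)) := by
    intro z hz
    have h1 := half_le_arc hz.1
    gcongr
    linarith
  have hbu' : ∀ z ∈ halfStrip, ‖gu z.1 (arc z.1 + z.2)‖ ≤ C * Real.exp (-(c * z.2)) :=
    fun z hz => (hbu _ _ (hpos z hz)).trans (hexp z hz)
  have hbv' : ∀ z ∈ halfStrip, ‖gv z.1 (arc z.1 + z.2)‖ ≤ C * Real.exp (-(c * z.2)) :=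
    fun z hz => (hbv _ _ (hpos z hz)).trans (hexp z hz)
  -- slope of the arc
  let w' : ℝ → ℝ := fun u => -u / arc u
  have hw'c : ContinuousOn w' J := by
    refine ContinuousOn.div (by fun_prop) (by fun_prop) fun u hu => ?_
    have := half_le_arc hu
    linarith
  have hw'b : ∀ u ∈ J, |w' u| ≤ 1 := by
    intro u hu
    have h1 := half_le_arc hu
    rw [abs_div, abs_neg, abs_of_pos (by linarith : 0 < arc u), div_le_one (by linarith)]
    have : |u| ≤ 1 / 2 := abs_le.mpr hu
    linarith
  have hw'c2 : ContinuousOn (fun z : ℝ × ℝ => ((w' z.1 : ℝ) : ℂ)) halfStrip :=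
    Complex.continuous_ofReal.comp_continuousOn
      (hw'c.comp continuousOn_fst fun z hz => hz.1)
  -- In the coordinates `(u, r)` with `v = arc u + r`, `A` is the total `u`-derivative of `g` along
  -- a translate of the arc. The remainder `B` is a function of `u` times the `r`-derivative. Each
  -- can be integrated in one variable.
  let A : ℝ × ℝ → ℂ := fun z => gu z.1 (arc z.1 + z.2) + w' z.1 * gv z.1 (arc z.1 + z.2)
  let B : ℝ × ℝ → ℂ := fun z => (w' z.1 + Complex.I) * gv z.1 (arc z.1 + z.2)
  have hAint : IntegrableOn A halfStrip := by
    refine integrableOn_halfStrip_of_exp_bound (hcu.add (hw'c2.mul hcv)) hc (C := C + C)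
      fun z hz => ?_
    rw [add_mul]
    refine (norm_add_le _ _).trans (add_le_add (hbu' z hz) ?_)
    rw [norm_mul, Complex.norm_real, Real.norm_eq_abs]
    have := hw'b z.1 hz.1
    have := hbv' z hz
    nlinarith [norm_nonneg (gv z.1 (arc z.1 + z.2))]
  have hBint : IntegrableOn B halfStrip := by
    refine integrableOn_halfStrip_of_exp_bound ((hw'c2.add continuousOn_const).mul hcv) hc
      (C := 2 * C) fun z hz => ?_
    simp only [B]
    rw [norm_mul, mul_assoc]
    have h1 : ‖((w' z.1 : ℝ) : ℂ) + Complex.I‖ ≤ 2 := by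
      refine (norm_add_le _ _).trans ?_
      rw [Complex.norm_real, Real.norm_eq_abs, Complex.norm_I]
      linarith [hw'b z.1 hz.1]
    exact mul_le_mul h1 (hbv' z hz) (norm_nonneg _) (by norm_num)
  have hsplit : ∀ z : ℝ × ℝ, gu z.1 (arc z.1 + z.2) - Complex.I * gv z.1 (arc z.1 + z.2) =
      A z - B z := by
    intro z; simp only [A, B]; ring
  simp_rw [hsplit]
  rw [integral_sub hAint hBint]
  -- the horizontal contribution
  have hA0 : ∫ z in halfStrip, A z = 0 := by
    rw [IntegrableOn, volume_restrict_halfStrip] at hAint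
    rw [volume_restrict_halfStrip, integral_prod_symm A hAint]
    rw [setIntegral_congr_fun (g := fun _ => (0 : ℂ)) measurableSet_Ici, integral_zero]
    intro r hr
    have hr : 0 ≤ r := hr
    simp only
    rw [integral_Icc_eq_integral_Ioc, ← intervalIntegral.integral_of_le (by norm_num)]
    have hderiv : ∀ u ∈ Set.uIcc (-(1 / 2) : ℝ) (1 / 2),
        HasDerivAt (fun u => g u (arc u + r)) (A (u, r)) u := by
      intro u hu
      rw [Set.uIcc_of_le (by norm_num)] at hu
      have h1 : HasDerivAt (fun u : ℝ => (u, arc u + r)) (1, w' u) u :=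
        (hasDerivAt_id u).prodMk ((hasDerivAt_arc hu).add_const r)
      have h2 := hd (u, arc u + r) (hmaps (x := (u, r)) ⟨hu, hr⟩)
      have h3 := h2.comp_hasDerivAt u h1
      refine h3.congr_deriv ?_
      simp [A]
    rw [intervalIntegral.integral_eq_sub_of_hasDerivAt hderiv]
    · have h1 : (0 : ℝ) < arc (1 / 2) + r := by
        have := half_le_arc (u := 1 / 2) ⟨by norm_num, le_rfl⟩
        linarith
      rw [arc_neg, hT _ h1, sub_self]
    · refine ContinuousOn.intervalIntegrable ?_
      rw [Set.uIcc_of_le (by norm_num)]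
      have hcA : ContinuousOn A halfStrip := hcu.add (hw'c2.mul hcv)
      exact hcA.comp (Continuous.continuousOn (by fun_prop)) fun u hu => ⟨hu, hr⟩
  -- the vertical contribution
  have hB0 : ∫ z in halfStrip, B z = 0 := by
    have hBint' := hBint
    rw [IntegrableOn, volume_restrict_halfStrip] at hBint'
    rw [volume_restrict_halfStrip, integral_prod B hBint']
    have hinner : ∀ u ∈ J, ∫ r in Set.Ici (0 : ℝ), B (u, r) =
        -((w' u + Complex.I) * g u (arc u)) := by
      intro u hu
      have hu2 := half_le_arc hu
      simp only [B]
      rw [integral_const_mul, integral_Ici_eq_integral_Ioi,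
        integral_Ioi_of_hasDerivAt_of_tendsto (f := fun r => g u (arc u + r)) (m := 0)]
      · simp
      · have h2 := (hd (u, arc u + 0) (by simp; linarith)).continuousAt
        have h3 : ContinuousAt (fun r : ℝ => ((u, arc u + r) : ℝ × ℝ)) 0 := by fun_prop
        exact (ContinuousAt.comp (f := fun r : ℝ => ((u, arc u + r) : ℝ × ℝ)) h2 h3).continuousWithinAt
      · intro r hr
        have hr : 0 < r := hr
        have h1 : HasDerivAt (fun r : ℝ => (u, arc u + r)) (0, 1) r :=
          (hasDerivAt_const r u).prodMk ((hasDerivAt_id r).const_add (arc u))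
        have h2 := hd (u, arc u + r) (by simp; linarith)
        have h3 := h2.comp_hasDerivAt r h1
        refine h3.congr_deriv ?_
        simp
      · refine IntegrableOn.mono_set (t := Set.Ici 0) ?_ Set.Ioi_subset_Ici_self
        have h2 : IntegrableOn (fun r : ℝ => C * Real.exp (-(c * r))) (Set.Ici (0 : ℝ)) := by
          have := (exp_neg_integrableOn_Ioi 0 hc).const_mul C
          rw [integrableOn_Ici_iff_integrableOn_Ioi]
          simpa [IntegrableOn] using this
        refine h2.mono' ?_ ?_
        · refine ContinuousOn.aestronglyMeasurable ?_ measurableSet_Ici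
          exact hcv.comp (f := fun r : ℝ => ((u, r) : ℝ × ℝ))
            (Continuous.continuousOn (by fun_prop)) fun r hr => ⟨hu, hr⟩
        · exact (ae_restrict_iff' measurableSet_Ici).mpr
            (Filter.Eventually.of_forall fun r hr => hbv' (u, r) ⟨hu, hr⟩)
      · have h1 : Filter.Tendsto (fun r : ℝ => C * Real.exp (-(c * r))) Filter.atTop (nhds 0) := by
          have h2 : Filter.Tendsto (fun r : ℝ => c * r) Filter.atTop Filter.atTop :=
            Filter.tendsto_id.const_mul_atTop hc
          simpa using (Real.tendsto_exp_neg_atTop_nhds_zero.comp h2).const_mul C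
        refine squeeze_zero_norm' ?_ h1
        filter_upwards [Filter.eventually_ge_atTop 0] with r hr
        exact (hbg u (arc u + r) (by linarith)).trans (hexp (u, r) ⟨hu, hr⟩)
    rw [setIntegral_congr_fun measurableSet_Icc hinner, integral_neg,
      integral_Icc_eq_integral_Ioc, ← intervalIntegral.integral_of_le (by norm_num)]
    set f : ℝ → ℂ := fun u => (w' u + Complex.I) * g u (arc u) with hf
    -- Up to the factor `i`, `f du` is the pullback of `g dτ̄` to the arc. The inversion preserves
    -- this form and acts on the arc by `u ↦ -u`, so its coefficient is odd.
    have hodd : ∀ u ∈ Set.uIcc (-(1 / 2) : ℝ) (1 / 2), f (-u) = -f u := by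
      intro u hu
      rw [Set.uIcc_of_le (by norm_num)] at hu
      have h1 := half_le_arc hu
      have h2 := sq_add_arc_sq hu
      have h2' : (u : ℂ) ^ 2 + (arc u : ℂ) ^ 2 = 1 := by exact_mod_cast h2
      have h3 : (arc u : ℂ) ≠ 0 := by
        have : arc u ≠ 0 := by linarith
        exact_mod_cast this
      simp only [hf, w', arc_neg]
      rw [hS u hu, Complex.mk_eq_add_mul_I]
      push_cast
      field_simp
      linear_combination (g u (arc u) * (u - arc u * Complex.I)) * h2' -
        (g u (arc u) * (u - arc u * Complex.I) * (arc u) ^ 2) * Complex.I_sq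
    have h1 : ∫ u in (-(1 / 2) : ℝ)..(1 / 2), f (-u) = -∫ u in (-(1 / 2) : ℝ)..(1 / 2), f u := by
      rw [intervalIntegral.integral_congr hodd, intervalIntegral.integral_neg]
    rw [intervalIntegral.integral_comp_neg, neg_neg] at h1
    have h2 : (2 : ℂ) * ∫ u in (-(1 / 2) : ℝ)..(1 / 2), f u = 0 := by linear_combination h1
    have h3 : ∫ u in (-(1 / 2) : ℝ)..(1 / 2), f u = 0 := by simpa using h2
    rw [h3, neg_zero]
  rw [hA0, hB0, sub_zero]

end

/-! ### Integrals over the fundamental domain and independence of the second parameter -/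

noncomputable section

/-- The integral of a theta series over the standard fundamental domain, in half strip
coordinates. -/
def stripIntegral (R : Matrix (Fin 4) (Fin 4) ℝ) (F : (Fin 4 → ℝ) → ℝ → ℝ → ℝ → ℝ → ℂ)
    (t s : ℝ) : ℂ :=
  ∫ z in halfStrip, thetaSum R F z.1 (arc z.1 + z.2) t s

variable {F F' : (Fin 4 → ℝ) → ℝ → ℝ → ℝ → ℝ → ℂ} {R : Matrix (Fin 4) (Fin 4) ℝ}

theorem half_le_arc_add {z : ℝ × ℝ} (hz : z ∈ halfStrip) : 1 / 2 ≤ arc z.1 + z.2 := by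
  have h1 := half_le_arc hz.1
  have h2 : 0 ≤ z.2 := hz.2
  linarith

theorem IsThetaKernel.continuousOn_halfStrip (hF : IsThetaKernel F) (hR : IsUnit R.det) (t s : ℝ) :
    ContinuousOn (fun z : ℝ × ℝ => thetaSum R F z.1 (arc z.1 + z.2) t s) halfStrip := by
  refine (hF.continuousOn hR).comp
    (f := fun z : ℝ × ℝ => ((z.1, arc z.1 + z.2, t, s) : ℝ × ℝ × ℝ × ℝ))
    (Continuous.continuousOn (by fun_prop)) fun z hz => ?_
  exact lt_of_lt_of_le one_half_pos (half_le_arc_add hz)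

theorem IsThetaKernel.strip_bound (hF : IsThetaKernel F) (hR : IsUnit R.det) (T : ℝ) :
    ∃ c C : ℝ, 0 < c ∧ 0 ≤ C ∧ ∀ z ∈ halfStrip, ∀ t s : ℝ, |t| ≤ T → |s| ≤ T →
      ‖thetaSum R F z.1 (arc z.1 + z.2) t s‖ ≤ C * Real.exp (-(c * z.2)) := by
  obtain ⟨c, C, hc, hC, h⟩ := hF.exp_bound hR one_half_pos T
  refine ⟨c, C, hc, hC, fun z hz t s ht hs => (h _ _ t s (half_le_arc_add hz) ht hs).trans ?_⟩
  have h1 := half_le_arc hz.1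
  gcongr
  linarith

theorem IsThetaKernel.integrableOn_halfStrip (hF : IsThetaKernel F) (hR : IsUnit R.det)
    (t s : ℝ) : IntegrableOn (fun z : ℝ × ℝ => thetaSum R F z.1 (arc z.1 + z.2) t s) halfStrip := by
  obtain ⟨c, C, hc, hC, h⟩ := hF.strip_bound hR (max |t| |s|)
  exact integrableOn_halfStrip_of_exp_bound (hF.continuousOn_halfStrip hR t s) hc
    fun z hz => h z hz t s (le_max_left _ _) (le_max_right _ _)

theorem abs_le_abs_add_one {y x : ℝ} (h : y ∈ Metric.ball x 1) : |y| ≤ |x| + 1 := by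
  rw [Metric.mem_ball, Real.dist_eq] at h
  have := abs_sub_abs_le_abs_sub y x
  linarith

theorem IsThetaKernel.continuous_stripIntegral (hF : IsThetaKernel F) (hR : IsUnit R.det) :
    Continuous fun p : ℝ × ℝ => stripIntegral R F p.1 p.2 := by
  rw [continuous_iff_continuousAt]
  rintro ⟨t, s⟩
  obtain ⟨c, C, hc, hC, h⟩ := hF.strip_bound hR (max (|t| + 1) (|s| + 1))
  refine continuousAt_of_dominated (bound := fun z => C * Real.exp (-(c * z.2))) ?_ ?_
    (integrableOn_exp_halfStrip hc C) ?_
  · exact Filter.Eventually.of_forall fun p =>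
      (hF.continuousOn_halfStrip hR p.1 p.2).aestronglyMeasurable measurableSet_halfStrip
  · filter_upwards [Metric.ball_mem_nhds (t, s) one_pos] with p hp
    rw [← ball_prod_same] at hp
    refine (ae_restrict_iff' measurableSet_halfStrip).mpr (Filter.Eventually.of_forall fun z hz => ?_)
    exact h z hz p.1 p.2 ((abs_le_abs_add_one hp.1).trans (le_max_left _ _))
      ((abs_le_abs_add_one hp.2).trans (le_max_right _ _))
  · refine (ae_restrict_iff' measurableSet_halfStrip).mpr (Filter.Eventually.of_forall fun z hz => ?_)
    have hpos : 0 < arc z.1 + z.2 := lt_of_lt_of_le one_half_pos (half_le_arc_add hz)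
    have h1 : ContinuousAt (fun z : ℝ × ℝ × ℝ × ℝ => thetaSum R F z.1 z.2.1 z.2.2.1 z.2.2.2)
        (z.1, arc z.1 + z.2, t, s) :=
      (hF.continuousOn hR).continuousAt ((isOpen_lt (by fun_prop) (by fun_prop)).mem_nhds hpos)
    have h2 : ContinuousAt (fun p : ℝ × ℝ => ((z.1, arc z.1 + z.2, p.1, p.2) : ℝ × ℝ × ℝ × ℝ))
        (t, s) := by fun_prop
    exact ContinuousAt.comp (f := fun p : ℝ × ℝ =>
      ((z.1, arc z.1 + z.2, p.1, p.2) : ℝ × ℝ × ℝ × ℝ)) h1 h2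

theorem hasDerivAt_stripIntegral_t (hF : IsThetaKernel F) (hF' : IsThetaKernel F')
    (hd : ∀ l u v t s, HasDerivAt (fun t => F l u v t s) (F' l u v t s) t)
    (hR : IsUnit R.det) (t s : ℝ) :
    HasDerivAt (fun t => stripIntegral R F t s) (stripIntegral R F' t s) t := by
  obtain ⟨c, C, hc, hC, h⟩ := hF'.strip_bound hR (max (|t| + 1) |s|)
  refine (hasDerivAt_integral_of_dominated_loc_of_deriv_le
    (μ := volume.restrict halfStrip)
    (F := fun t (z : ℝ × ℝ) => thetaSum R F z.1 (arc z.1 + z.2) t s)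
    (F' := fun t (z : ℝ × ℝ) => thetaSum R F' z.1 (arc z.1 + z.2) t s)
    (bound := fun z : ℝ × ℝ => C * Real.exp (-(c * z.2))) (Metric.ball_mem_nhds t one_pos) ?_
    (hF.integrableOn_halfStrip hR t s)
    ((hF'.continuousOn_halfStrip hR t s).aestronglyMeasurable measurableSet_halfStrip) ?_
    (integrableOn_exp_halfStrip hc C) ?_).2
  · exact Filter.Eventually.of_forall fun y =>
      (hF.continuousOn_halfStrip hR y s).aestronglyMeasurable measurableSet_halfStrip
  · refine (ae_restrict_iff' measurableSet_halfStrip).mpr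
      (Filter.Eventually.of_forall fun z hz y hy => ?_)
    exact h z hz y s ((abs_le_abs_add_one hy).trans (le_max_left _ _)) (le_max_right _ _)
  · refine (ae_restrict_iff' measurableSet_halfStrip).mpr
      (Filter.Eventually.of_forall fun z hz y hy => ?_)
    exact hasDerivAt_thetaSum_t hF hF' hd hR
      (lt_of_lt_of_le one_half_pos (half_le_arc_add hz)) y s

theorem hasDerivAt_stripIntegral_s (hF : IsThetaKernel F) (hF' : IsThetaKernel F')
    (hd : ∀ l u v t s, HasDerivAt (fun s => F l u v t s) (F' l u v t s) s)
    (hR : IsUnit R.det) (t s : ℝ) :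
    HasDerivAt (fun s => stripIntegral R F t s) (stripIntegral R F' t s) s := by
  obtain ⟨c, C, hc, hC, h⟩ := hF'.strip_bound hR (max |t| (|s| + 1))
  refine (hasDerivAt_integral_of_dominated_loc_of_deriv_le
    (μ := volume.restrict halfStrip)
    (F := fun s (z : ℝ × ℝ) => thetaSum R F z.1 (arc z.1 + z.2) t s)
    (F' := fun s (z : ℝ × ℝ) => thetaSum R F' z.1 (arc z.1 + z.2) t s)
    (bound := fun z : ℝ × ℝ => C * Real.exp (-(c * z.2))) (Metric.ball_mem_nhds s one_pos) ?_
    (hF.integrableOn_halfStrip hR t s)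
    ((hF'.continuousOn_halfStrip hR t s).aestronglyMeasurable measurableSet_halfStrip) ?_
    (integrableOn_exp_halfStrip hc C) ?_).2
  · exact Filter.Eventually.of_forall fun y =>
      (hF.continuousOn_halfStrip hR t y).aestronglyMeasurable measurableSet_halfStrip
  · refine (ae_restrict_iff' measurableSet_halfStrip).mpr
      (Filter.Eventually.of_forall fun z hz y hy => ?_)
    exact h z hz t y (le_max_left _ _) ((abs_le_abs_add_one hy).trans (le_max_right _ _))
  · refine (ae_restrict_iff' measurableSet_halfStrip).mpr
      (Filter.Eventually.of_forall fun z hz y hy => ?_)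
    exact hasDerivAt_thetaSum_s hF hF' hd hR
      (lt_of_lt_of_le one_half_pos (half_le_arc_add hz)) t y

theorem thetaSum_deriv_add_deriv (hR : IsUnit R.det) {u v : ℝ} (hv : 0 < v) (t s : ℝ) :
    thetaSum R kernelXQDeriv u v t s + thetaSum R kernelPYDeriv u v t s =
      2 * Complex.I * (thetaSum R kernelXYDerivU u v t s -
        Complex.I * thetaSum R kernelXYDerivV u v t s) := by
  have s1 := isThetaKernel_kernelXQDeriv.summable hR (u := u) (t := t) (s := s) hv
  have s2 := isThetaKernel_kernelPYDeriv.summable hR (u := u) (t := t) (s := s) hv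
  have s3 := isThetaKernel_kernelXYDerivU.summable hR (u := u) (t := t) (s := s) hv
  have s4 := isThetaKernel_kernelXYDerivV.summable hR (u := u) (t := t) (s := s) hv
  simp only [thetaSum]
  rw [← tsum_mul_left (a := Complex.I), ← s1.tsum_add s2, ← s3.tsum_sub (s4.mul_left _),
    ← tsum_mul_left]
  exact tsum_congr fun m => kernelXQDeriv_add_kernelPYDeriv _ u v t s

/-- Stokes' theorem applies to `v Θ_{XY}`: evenness of the lattice identifies the vertical sides and
the weight `(0, 2)` inversion pairs the halves of the arc. -/
theorem integral_halfStrip_kernelXY_wirtinger (hR : IsEvenUnimodular R) (t s : ℝ) :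
    ∫ z in halfStrip, (thetaSum R kernelXYDerivU z.1 (arc z.1 + z.2) t s -
      Complex.I * thetaSum R kernelXYDerivV z.1 (arc z.1 + z.2) t s) = 0 := by
  have hu := hR.isUnit_det
  obtain ⟨c1, C1, hc1, hC1, h1⟩ := isThetaKernel_kernelXY.exp_bound hu one_half_pos (max |t| |s|)
  obtain ⟨c2, C2, hc2, hC2, h2⟩ :=
    isThetaKernel_kernelXYDerivU.exp_bound hu one_half_pos (max |t| |s|)
  obtain ⟨c3, C3, hc3, hC3, h3⟩ :=
    isThetaKernel_kernelXYDerivV.exp_bound hu one_half_pos (max |t| |s|)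
  -- The smallest rate and the sum of the constants serve the series and both of its derivatives at
  -- once.
  have hmono : ∀ {c' C' v : ℝ}, 0 ≤ C' → min c1 (min c2 c3) ≤ c' → C' ≤ C1 + C2 + C3 → 1 / 2 ≤ v →
      C' * Real.exp (-(c' * v)) ≤ (C1 + C2 + C3) * Real.exp (-(min c1 (min c2 c3) * v)) := by
    intro c' C' v h0 hc hC hv
    gcongr
  have hcont : ∀ {F : (Fin 4 → ℝ) → ℝ → ℝ → ℝ → ℝ → ℂ}, IsThetaKernel F →
      ContinuousOn (fun z : ℝ × ℝ => thetaSum R F z.1 z.2 t s) {z | 0 < z.2} := fun hF =>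
    (hF.continuousOn hu).comp
      (f := fun z : ℝ × ℝ => ((z.1, z.2, t, s) : ℝ × ℝ × ℝ × ℝ))
      (Continuous.continuousOn (by fun_prop)) fun z hz => hz
  have hd := fun (z : ℝ × ℝ) (hz : 0 < z.2) => hasFDerivAt_thetaSum isThetaKernel_kernelXY
    isThetaKernel_kernelXYDerivU isThetaKernel_kernelXYDerivV hasFDerivAt_kernelXY hu hz t s
  have hT : ∀ v, 0 < v → thetaSum R kernelXY (1 / 2) v t s =
      thetaSum R kernelXY (-(1 / 2)) v t s := by
    intro v hv
    rw [← thetaSum_kernelXY_add_one hR (-(1 / 2))]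
    norm_num
  have hS : ∀ u ∈ Set.Icc (-(1 / 2) : ℝ) (1 / 2), thetaSum R kernelXY (-u) (arc u) t s =
      (⟨u, -arc u⟩ : ℂ) ^ 2 * thetaSum R kernelXY u (arc u) t s := fun u hu' =>
    thetaSum_kernelXY_inversion hR
      (lt_of_lt_of_le one_half_pos (half_le_arc hu')) (sq_add_arc_sq hu') t s
  exact integral_halfStrip_wirtinger_eq_zero
    (g := fun u v => thetaSum R kernelXY u v t s)
    (gu := fun u v => thetaSum R kernelXYDerivU u v t s)
    (gv := fun u v => thetaSum R kernelXYDerivV u v t s)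
    (c := min c1 (min c2 c3)) (C := C1 + C2 + C3) hd (hcont isThetaKernel_kernelXYDerivU)
    (hcont isThetaKernel_kernelXYDerivV) (lt_min hc1 (lt_min hc2 hc3))
    (add_nonneg (add_nonneg hC1 hC2) hC3)
    (fun u v hv => (h1 u v t s hv (le_max_left _ _) (le_max_right _ _)).trans
      (hmono hC1 (min_le_left _ _) (by linarith) hv))
    (fun u v hv => (h2 u v t s hv (le_max_left _ _) (le_max_right _ _)).trans
      (hmono hC2 ((min_le_right _ _).trans (min_le_left _ _)) (by linarith) hv))
    (fun u v hv => (h3 u v t s hv (le_max_left _ _) (le_max_right _ _)).trans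
      (hmono hC3 ((min_le_right _ _).trans (min_le_right _ _)) (by linarith) hv)) hT hS

/-- After integration over the fundamental domain the total derivative drops out, and the one-form
with components `Θ_{XQ} dt` and `-Θ_{PY} ds` becomes closed in `(t, s)`. -/
theorem stripIntegral_deriv_add_deriv (hR : IsEvenUnimodular R) (t s : ℝ) :
    stripIntegral R kernelXQDeriv t s + stripIntegral R kernelPYDeriv t s = 0 := by
  have hu := hR.isUnit_det
  have h1 : ∀ z ∈ halfStrip, thetaSum R kernelXQDeriv z.1 (arc z.1 + z.2) t s +
      thetaSum R kernelPYDeriv z.1 (arc z.1 + z.2) t s = 2 * Complex.I *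
      (thetaSum R kernelXYDerivU z.1 (arc z.1 + z.2) t s -
        Complex.I * thetaSum R kernelXYDerivV z.1 (arc z.1 + z.2) t s) := fun z hz =>
    thetaSum_deriv_add_deriv hu (lt_of_lt_of_le one_half_pos (half_le_arc_add hz)) t s
  rw [stripIntegral, stripIntegral, ← integral_add
    (isThetaKernel_kernelXQDeriv.integrableOn_halfStrip hu t s)
    (isThetaKernel_kernelPYDeriv.integrableOn_halfStrip hu t s),
    setIntegral_congr_fun measurableSet_halfStrip h1, integral_const_mul,
    integral_halfStrip_kernelXY_wirtinger hR, mul_zero]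

/-- If the integrals of the closed form have period `ℓ` in `t`, then the integral over a period
does not depend on the second variable. -/
theorem integral_stripIntegral_const (hR : IsEvenUnimodular R) {ℓ : ℝ}
    (hper : ∀ s, stripIntegral R kernelPY ℓ s = stripIntegral R kernelPY 0 s) (s₁ s₂ : ℝ) :
    ∫ t in (0 : ℝ)..ℓ, stripIntegral R kernelXQ t s₁ =
      ∫ t in (0 : ℝ)..ℓ, stripIntegral R kernelXQ t s₂ := by
  have hu := hR.isUnit_det
  have hc1 := isThetaKernel_kernelXQ.continuous_stripIntegral hu
  have hc2 := isThetaKernel_kernelXQDeriv.continuous_stripIntegral hu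
  have hc3 := isThetaKernel_kernelPYDeriv.continuous_stripIntegral hu
  -- Closedness trades the `s`-derivative for a `t`-derivative, which integrates to a difference of
  -- values one period apart.
  have hzero : ∀ s, ∫ t in (0 : ℝ)..ℓ, stripIntegral R kernelXQDeriv t s = 0 := by
    intro s
    have h1 : ∀ t, stripIntegral R kernelXQDeriv t s = -stripIntegral R kernelPYDeriv t s :=
      fun t => eq_neg_of_add_eq_zero_left (stripIntegral_deriv_add_deriv hR t s)
    simp_rw [h1]
    rw [intervalIntegral.integral_neg, intervalIntegral.integral_eq_sub_of_hasDerivAt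
      (fun t _ => hasDerivAt_stripIntegral_t isThetaKernel_kernelPY isThetaKernel_kernelPYDeriv
        hasDerivAt_kernelPY hu t s), hper, sub_self, neg_zero]
    exact (hc3.comp (f := fun t : ℝ => ((t, s) : ℝ × ℝ)) (by fun_prop)).intervalIntegrable _ _
  have hderiv : ∀ s, HasDerivAt (fun s => ∫ t in (0 : ℝ)..ℓ, stripIntegral R kernelXQ t s) 0 s := by
    intro s
    obtain ⟨B, hB⟩ := ((isCompact_uIcc (a := (0 : ℝ)) (b := ℓ)).prod
      (isCompact_closedBall s 1)).exists_bound_of_continuousOn hc2.continuousOn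
    have h := (intervalIntegral.hasDerivAt_integral_of_dominated_loc_of_deriv_le
      (μ := volume) (a := 0) (b := ℓ) (F := fun s t => stripIntegral R kernelXQ t s)
      (F' := fun s t => stripIntegral R kernelXQDeriv t s) (x₀ := s) (bound := fun _ => B)
      (Metric.ball_mem_nhds s one_pos) ?_ ?_ ?_ ?_ ?_ ?_).2
    · rwa [hzero] at h
    · exact Filter.Eventually.of_forall fun y =>
        (hc1.comp (f := fun t : ℝ => ((t, y) : ℝ × ℝ)) (by fun_prop)).aestronglyMeasurable
    · exact (hc1.comp (f := fun t : ℝ => ((t, s) : ℝ × ℝ)) (by fun_prop)).intervalIntegrable _ _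
    · exact (hc2.comp (f := fun t : ℝ => ((t, s) : ℝ × ℝ)) (by fun_prop)).aestronglyMeasurable
    · refine Filter.Eventually.of_forall fun t ht y hy => ?_
      exact hB (t, y) ⟨Set.uIoc_subset_uIcc ht, Metric.ball_subset_closedBall hy⟩
    · exact intervalIntegrable_const
    · exact Filter.Eventually.of_forall fun t _ y _ => hasDerivAt_stripIntegral_s
        isThetaKernel_kernelXQ isThetaKernel_kernelXQDeriv hasDerivAt_kernelXQ hu t y
  exact is_const_of_deriv_eq_zero (fun s => (hderiv s).differentiableAt)
    (fun s => (hderiv s).deriv) s₁ s₂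

end

noncomputable section

/-! ### The standard fundamental domain in half strip coordinates -/

/-- Half strip coordinates on the upper half plane. -/
def stripCoord (τ : ℍ) : ℝ × ℝ := (τ.re, τ.im - arc τ.re)

/-- The measurable equivalence `x + i y ↦ (x, y - arc x)`. -/
def shearEquiv : ℂ ≃ᵐ ℝ × ℝ :=
  Complex.measurableEquivRealProd.trans
    { toFun := fun p => (p.1, p.2 - arc p.1)
      invFun := fun p => (p.1, p.2 + arc p.1)
      left_inv := fun p => by simp
      right_inv := fun p => by simp
      measurable_toFun := (show Continuous fun p : ℝ × ℝ => (p.1, p.2 - arc p.1) by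
        fun_prop).measurable
      measurable_invFun := (show Continuous fun p : ℝ × ℝ => (p.1, p.2 + arc p.1) by
        fun_prop).measurable }

/-- On each vertical line the shear is a translation. -/
theorem measurePreserving_shearEquiv : MeasurePreserving shearEquiv := by
  have h : MeasurePreserving (fun p : ℝ × ℝ => (p.1, p.2 - arc p.1)) := by
    refine (MeasurePreserving.id (volume : Measure ℝ)).skew_product
      (g := fun u v => v - arc u) (μc := volume) (μd := volume)
      (Continuous.measurable (by fun_prop)) ?_
    exact Filter.Eventually.of_forall fun u => (measurePreserving_sub_right volume (arc u)).map_eq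
  exact h.comp Complex.volume_preserving_equiv_real_prod

theorem measurableEmbedding_stripCoord : MeasurableEmbedding stripCoord :=
  shearEquiv.measurableEmbedding.comp UpperHalfPlane.measurableEmbedding_coe

theorem measurePreserving_stripCoord :
    MeasurePreserving stripCoord (volume.comap UpperHalfPlane.coe)
      (volume.restrict (Set.range stripCoord)) := by
  have h1 : MeasurePreserving UpperHalfPlane.coe (volume.comap UpperHalfPlane.coe)
      (volume.restrict (.range UpperHalfPlane.coe)) :=
    ⟨UpperHalfPlane.measurable_coe, by rw [UpperHalfPlane.measurableEmbedding_coe.map_comap]⟩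
  have h2 := measurePreserving_shearEquiv.restrict_image_emb shearEquiv.measurableEmbedding
    (Set.range UpperHalfPlane.coe)
  rw [← Set.range_comp] at h2
  exact h2.comp h1

theorem stripCoord_preimage_halfStrip : stripCoord ⁻¹' halfStrip = 𝒟 := by
  ext τ
  have h1 : Complex.normSq (τ : ℂ) = τ.re ^ 2 + τ.im ^ 2 := by
    rw [Complex.normSq_apply]; simp [pow_two]
  simp only [stripCoord, halfStrip, Set.mem_preimage, Set.mem_prod, Set.mem_Ici, sub_nonneg,
    ModularGroup.fd, Set.mem_ofPred_eq, h1, ← abs_le, Set.mem_Icc]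
  rw [and_comm]
  refine and_congr_left fun h => ?_
  rw [arc, Real.sqrt_le_left τ.im_pos.le]
  constructor <;> intro h <;> linarith

theorem halfStrip_subset_range : halfStrip ⊆ Set.range stripCoord := by
  intro z hz
  have h := half_le_arc_add hz
  refine ⟨⟨⟨z.1, arc z.1 + z.2⟩, by simp; linarith⟩, ?_⟩
  ext <;> simp [stripCoord, UpperHalfPlane.re, UpperHalfPlane.im]

theorem volume_smul_im_sq (τ : ℍ) (w : ℂ) :
    ((1 / NNReal.mk τ.im τ.im_pos.le) ^ 2 : NNReal) • ((τ.im : ℂ) ^ 2 * w) = w := by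
  have h0 : (τ.im : ℂ) ≠ 0 := by exact_mod_cast τ.im_pos.ne'
  rw [NNReal.smul_def, Complex.real_smul]
  push_cast
  field_simp

theorem measurable_density :
    Measurable fun τ : ℍ => ((1 / NNReal.mk τ.im τ.im_pos.le) ^ 2 : NNReal) := by
  refine Continuous.measurable (.pow (.div₀ continuous_const ?_ ?_) _)
  · exact UpperHalfPlane.continuous_im.subtype_mk _
  · exact fun x ↦ NNReal.ne_iff.mp x.im_ne_zero

/-- The factor `v²` cancels the density of `du dv / v²`, so what remains is Lebesgue measure, which
the shear preserves. -/
theorem setIntegral_fd (h : ℝ → ℝ → ℂ) :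
    ∫ τ in 𝒟, (τ.im : ℂ) ^ 2 * h τ.re τ.im = ∫ z in halfStrip, h z.1 (arc z.1 + z.2) := by
  have hm : MeasurableSet 𝒟 := by
    rw [← stripCoord_preimage_halfStrip]
    exact measurableEmbedding_stripCoord.measurable measurableSet_halfStrip
  rw [UpperHalfPlane.volume_def, setIntegral_withDensity_eq_setIntegral_smul measurable_density _ hm]
  simp_rw [volume_smul_im_sq]
  have := measurePreserving_stripCoord.setIntegral_preimage_emb measurableEmbedding_stripCoord
    (fun z => h z.1 (arc z.1 + z.2)) halfStrip
  rw [Measure.restrict_restrict measurableSet_halfStrip,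
    Set.inter_eq_left.mpr halfStrip_subset_range, stripCoord_preimage_halfStrip] at this
  rw [← this]
  simp [stripCoord]

theorem integrableOn_fd {h : ℝ → ℝ → ℂ}
    (hi : IntegrableOn (fun z : ℝ × ℝ => h z.1 (arc z.1 + z.2)) halfStrip) :
    IntegrableOn (fun τ : ℍ => (τ.im : ℂ) ^ 2 * h τ.re τ.im) 𝒟 := by
  have hm : MeasurableSet 𝒟 := by
    rw [← stripCoord_preimage_halfStrip]
    exact measurableEmbedding_stripCoord.measurable measurableSet_halfStrip
  rw [IntegrableOn, UpperHalfPlane.volume_def, restrict_withDensity hm,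
    integrable_withDensity_iff_integrable_smul measurable_density]
  simp_rw [volume_smul_im_sq]
  have := measurePreserving_stripCoord.integrableOn_comp_preimage measurableEmbedding_stripCoord
    (f := fun z => h z.1 (arc z.1 + z.2)) (s := halfStrip)
  rw [IntegrableOn, IntegrableOn, Measure.restrict_restrict measurableSet_halfStrip,
    Set.inter_eq_left.mpr halfStrip_subset_range, stripCoord_preimage_halfStrip] at this
  have h2 := this.mpr hi
  refine h2.congr (Filter.Eventually.of_forall fun τ => ?_)
  simp [stripCoord]

/-- `v² Θ` is invariant under the modular group. -/
theorem im_sq_mul_thetaSum_smul {R : Matrix (Fin 4) (Fin 4) ℝ} (hR : IsEvenUnimodular R)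
    (t s : ℝ) (γ : SL(2, ℤ)) : ∀ τ : ℍ,
    ((γ • τ).im : ℂ) ^ 2 * thetaSum R kernelXQ (γ • τ).re (γ • τ).im t s =
      (τ.im : ℂ) ^ 2 * thetaSum R kernelXQ τ.re τ.im t s := by
  -- It suffices to check the generators: `S` is the inversion formula and `T` the periodicity in
  -- `u`.
  have : γ ∈ Subgroup.closure {ModularGroup.S, ModularGroup.T} := by
    rw [SpecialLinearGroup.SL2Z_generators]; trivial
  induction this using Subgroup.closure_induction with
  | one => simp
  | mem g hg =>
    intro τ
    rcases hg with rfl | hg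
    · have hτ : (ModularGroup.S • τ : ℍ) = UpperHalfPlane.mk (-τ : ℂ)⁻¹ τ.im_inv_neg_coe_pos :=
        UpperHalfPlane.modular_S_smul τ
      have hn : Complex.normSq (-τ : ℂ) = τ.re ^ 2 + τ.im ^ 2 := by
        rw [Complex.normSq_neg, Complex.normSq_apply]; simp [pow_two]
      have hre : (ModularGroup.S • τ : ℍ).re = -τ.re / (τ.re ^ 2 + τ.im ^ 2) := by
        rw [hτ]
        change ((-τ : ℂ)⁻¹).re = _
        rw [Complex.inv_re, hn]
        simp
      have him : (ModularGroup.S • τ : ℍ).im = τ.im / (τ.re ^ 2 + τ.im ^ 2) := by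
        rw [hτ]
        change ((-τ : ℂ)⁻¹).im = _
        rw [Complex.inv_im, hn]
        simp
      rw [thetaSum_kernelXQ_inversion hR τ.im_pos, hre, him]
      push_cast
      ring
    · rw [Set.mem_singleton_iff] at hg
      subst hg
      have hre : (ModularGroup.T • τ : ℍ).re = τ.re + 1 := by
        rw [UpperHalfPlane.modular_T_smul, UpperHalfPlane.vadd_re, add_comm]
      have him : (ModularGroup.T • τ : ℍ).im = τ.im := by
        rw [UpperHalfPlane.modular_T_smul, UpperHalfPlane.vadd_im]
      rw [hre, him, thetaSum_kernelXQ_add_one hR]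
  | mul g h _ _ ig ih =>
    intro τ
    rw [mul_smul, ig, ih]
  | inv g _ ig =>
    intro τ
    have := ig (g⁻¹ • τ)
    rw [smul_inv_smul] at this
    exact this.symm

end

/-! ### The lattices `L` and `L^∨` in a real quadratic field -/

section QuadraticField

variable {F : Type*} [Field F] [NumberField F]

theorem card_aut_eq_two (hF : Module.finrank ℚ F = 2) {c : F ≃ₐ[ℚ] F} (hc : c ≠ 1) :
    Fintype.card (F ≃ₐ[ℚ] F) = 2 := by
  have h1 := AlgEquiv.card_le (F := ℚ) (K := F)
  rw [hF] at h1
  have h2 : 1 < Fintype.card (F ≃ₐ[ℚ] F) := Fintype.one_lt_card_iff.mpr ⟨c, 1, hc⟩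
  omega

theorem isGalois_of_finrank_two (hF : Module.finrank ℚ F = 2) {c : F ≃ₐ[ℚ] F} (hc : c ≠ 1) :
    IsGalois ℚ F := by
  apply IsGalois.of_card_aut_eq_finrank
  rw [hF, Nat.card_eq_fintype_card, card_aut_eq_two hF hc]

theorem univ_aut_eq_pair [DecidableEq (F ≃ₐ[ℚ] F)] (hF : Module.finrank ℚ F = 2)
    {c : F ≃ₐ[ℚ] F} (hc : c ≠ 1) : (Finset.univ : Finset (F ≃ₐ[ℚ] F)) = {1, c} := by
  symm
  rw [← Finset.card_eq_iff_eq_univ, card_aut_eq_two hF hc, Finset.card_pair hc.symm]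

theorem conj_conj (hF : Module.finrank ℚ F = 2) {c : F ≃ₐ[ℚ] F} (hc : c ≠ 1) (x : F) :
    c (c x) = x := by
  have h := pow_card_eq_one (x := c)
  rw [card_aut_eq_two hF hc, pow_two] at h
  exact DFunLike.congr_fun h x

theorem trace_eq_add_conj (hF : Module.finrank ℚ F = 2) {c : F ≃ₐ[ℚ] F} (hc : c ≠ 1) (x : F) :
    ((Algebra.trace ℚ F x : ℚ) : F) = x + c x := by
  classical
  have := isGalois_of_finrank_two hF hc
  rw [← eq_ratCast (algebraMap ℚ F), trace_eq_sum_automorphisms, univ_aut_eq_pair hF hc,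
    Finset.sum_pair hc.symm]
  rfl

theorem norm_eq_mul_conj (hF : Module.finrank ℚ F = 2) {c : F ≃ₐ[ℚ] F} (hc : c ≠ 1) (x : F) :
    ((Algebra.norm ℚ x : ℚ) : F) = x * c x := by
  classical
  have := isGalois_of_finrank_two hF hc
  rw [← eq_ratCast (algebraMap ℚ F), Algebra.norm_eq_prod_automorphisms, univ_aut_eq_pair hF hc,
    Finset.prod_pair hc.symm]
  rfl

theorem ratCast_fieldForm (hF : Module.finrank ℚ F = 2) {c : F ≃ₐ[ℚ] F} (hc : c ≠ 1) (N : ℚ)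
    (σ : F →+* ℝ) (x y : F) :
    ((fieldForm c N x y : ℚ) : ℝ) = (σ x * σ (c y) + σ (c x) * σ y) / N := by
  have h0 : c (x * c y) = c x * y := by rw [map_mul, conj_conj hF hc]
  have h := congrArg σ (trace_eq_add_conj hF hc (x * c y))
  rw [map_ratCast, h0, map_add, map_mul σ, map_mul σ] at h
  rw [fieldForm, Rat.cast_div, h]

theorem levelN_pos (𝔞 : (FractionalIdeal (𝓞 F)⁰ F)ˣ) (κ : ℕ+) : 0 < levelN 𝔞 κ := by
  rw [levelN]
  have h1 : 0 < FractionalIdeal.absNorm (𝔞 : FractionalIdeal (𝓞 F)⁰ F) := by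
    refine lt_of_le_of_ne (FractionalIdeal.absNorm_nonneg _) (Ne.symm ?_)
    rw [Ne, FractionalIdeal.absNorm_eq_zero_iff]
    exact 𝔞.ne_zero
  have h2 : (0 : ℚ) < ((κ : ℕ) : ℚ) := by exact_mod_cast κ.pos
  exact div_pos h1 h2

theorem levelN_pos_real (𝔞 : (FractionalIdeal (𝓞 F)⁰ F)ˣ) (κ : ℕ+) :
    (0 : ℝ) < (levelN 𝔞 κ : ℝ) := by exact_mod_cast levelN_pos 𝔞 κ

theorem mem_latticeL {𝔞 : (FractionalIdeal (𝓞 F)⁰ F)ˣ} {x : F} :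
    x ∈ latticeL 𝔞 ↔ x ∈ (𝔞 : FractionalIdeal (𝓞 F)⁰ F) := Iff.rfl

theorem mul_mem_latticeL {𝔞 : (FractionalIdeal (𝓞 F)⁰ F)ˣ} (r : 𝓞 F) {x : F}
    (hx : x ∈ latticeL 𝔞) : (r : F) * x ∈ latticeL 𝔞 := by
  have := ((𝔞 : FractionalIdeal (𝓞 F)⁰ F) : Submodule (𝓞 F) F).smul_mem r hx
  rwa [Algebra.smul_def] at this

/-- The norm form is integral on the lattice `L`. -/
theorem exists_norm_eq_mul_levelN (𝔞 : (FractionalIdeal (𝓞 F)⁰ F)ˣ) (κ : ℕ+) {x : F}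
    (hx : x ∈ latticeL 𝔞) : ∃ k : ℤ, Algebra.norm ℚ x = k * levelN 𝔞 κ := by
  -- The ideal `x 𝔞⁻¹` is an integral ideal `I`, so `|Nm x| = Nm(I) Nm(𝔞) = Nm(I) κ N`.
  have h1 : FractionalIdeal.spanSingleton (𝓞 F)⁰ x * (𝔞⁻¹ : (FractionalIdeal (𝓞 F)⁰ F)ˣ) ≤ 1 := by
    rw [← Units.mul_inv 𝔞]
    gcongr
    rw [FractionalIdeal.spanSingleton_le_iff_mem]
    exact hx
  obtain ⟨I, hI⟩ := FractionalIdeal.le_one_iff_exists_coeIdeal.mp h1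
  have h2 : FractionalIdeal.spanSingleton (𝓞 F)⁰ x = (I : FractionalIdeal (𝓞 F)⁰ F) * 𝔞 := by
    rw [hI, mul_assoc, Units.inv_mul, mul_one]
  have h3 := congrArg FractionalIdeal.absNorm h2
  rw [map_mul, FractionalIdeal.absNorm_span_singleton, FractionalIdeal.coeIdeal_absNorm] at h3
  have h4 : FractionalIdeal.absNorm (𝔞 : FractionalIdeal (𝓞 F)⁰ F) = levelN 𝔞 κ * (κ : ℕ) := by
    rw [levelN]
    have : ((κ : ℕ) : ℚ) ≠ 0 := by exact_mod_cast κ.ne_zero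
    field_simp
  rw [h4] at h3
  rcases abs_choice (Algebra.norm ℚ x) with h | h
  · refine ⟨(Ideal.absNorm I : ℤ) * (κ : ℕ), ?_⟩
    rw [← h, h3]; push_cast; ring
  · refine ⟨-((Ideal.absNorm I : ℤ) * (κ : ℕ)), ?_⟩
    rw [← neg_neg (Algebra.norm ℚ x), ← h, h3]; push_cast; ring

theorem exists_conj_mul_eq (hF : Module.finrank ℚ F = 2) {c : F ≃ₐ[ℚ] F} (hc : c ≠ 1)
    (σ : F →+* ℝ) (𝔞 : (FractionalIdeal (𝓞 F)⁰ F)ˣ) (κ : ℕ+) {x : F} (hx : x ∈ latticeL 𝔞) :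
    ∃ k : ℤ, σ x * σ (c x) / (levelN 𝔞 κ : ℝ) = k := by
  obtain ⟨k, hk⟩ := exists_norm_eq_mul_levelN 𝔞 κ hx
  refine ⟨k, ?_⟩
  have h := congrArg σ (norm_eq_mul_conj hF hc x)
  rw [map_ratCast, map_mul] at h
  rw [← h, hk, div_eq_iff (levelN_pos_real 𝔞 κ).ne']
  push_cast
  rfl

/-- `L ⊆ L^∨`. -/
theorem latticeL_le_dualL (hF : Module.finrank ℚ F = 2) {c : F ≃ₐ[ℚ] F} (hc : c ≠ 1)
    (σ : F →+* ℝ) (𝔞 : (FractionalIdeal (𝓞 F)⁰ F)ˣ) (κ : ℕ+) : latticeL 𝔞 ≤ dualL c 𝔞 κ := by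
  intro x hx y hy
  -- Polarization: the bilinear form is `Q(x + y) - Q(x) - Q(y)`, and `Q` is integral on `L`.
  obtain ⟨k1, h1⟩ := exists_conj_mul_eq hF hc σ 𝔞 κ (add_mem hx hy)
  obtain ⟨k2, h2⟩ := exists_conj_mul_eq hF hc σ 𝔞 κ hx
  obtain ⟨k3, h3⟩ := exists_conj_mul_eq hF hc σ 𝔞 κ hy
  refine ⟨k1 - k2 - k3, ?_⟩
  have : ((fieldForm c (levelN 𝔞 κ) x y : ℚ) : ℝ) = ((k1 - k2 - k3 : ℤ) : ℝ) := by
    rw [ratCast_fieldForm hF hc _ σ]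
    push_cast
    rw [← h1, ← h2, ← h3]
    simp only [map_add]
    ring
  exact_mod_cast this

/-- A `ℤ`-basis of the lattice `L`. -/
theorem exists_basis_latticeL (hF : Module.finrank ℚ F = 2) (𝔞 : (FractionalIdeal (𝓞 F)⁰ F)ˣ) :
    ∃ e : Module.Basis (Fin 2) ℚ F, ∀ x : F, x ∈ latticeL 𝔞 ↔
      ∃ m : Fin 2 → ℤ, x = m 0 * e 0 + m 1 * e 1 := by
  have hcard : Fintype.card (Module.Free.ChooseBasisIndex ℤ 𝔞) = 2 := by
    rw [← Module.finrank_eq_card_basis (NumberField.basisOfFractionalIdeal F 𝔞), hF]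
  let e := (NumberField.basisOfFractionalIdeal F 𝔞).reindex (Fintype.equivFinOfCardEq hcard)
  refine ⟨e, fun x => ?_⟩
  have hr : Set.range e = Set.range (NumberField.basisOfFractionalIdeal F 𝔞) :=
    Module.Basis.range_reindex _ _
  have h1 : x ∈ latticeL 𝔞 ↔ x ∈ Submodule.span ℤ (Set.range e) := by
    rw [hr, NumberField.mem_span_basisOfFractionalIdeal]
    rfl
  rw [h1, Submodule.mem_span_range_iff_exists_fun]
  constructor
  · rintro ⟨m, hm⟩
    refine ⟨m, ?_⟩
    rw [← hm, Fin.sum_univ_two]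
    simp
  · rintro ⟨m, hm⟩
    refine ⟨m, ?_⟩
    rw [hm, Fin.sum_univ_two]
    simp

theorem fieldForm_add_right (c : F ≃ₐ[ℚ] F) (N : ℚ) (x y z : F) :
    fieldForm c N x (y + z) = fieldForm c N x y + fieldForm c N x z := by
  simp only [fieldForm, map_add, mul_add, add_div]

theorem fieldForm_add_left (c : F ≃ₐ[ℚ] F) (N : ℚ) (x y z : F) :
    fieldForm c N (x + y) z = fieldForm c N x z + fieldForm c N y z := by
  simp only [fieldForm, map_add, add_mul, add_div]

theorem fieldForm_ratCast_mul_left (c : F ≃ₐ[ℚ] F) (N : ℚ) (q : ℚ) (x y : F) :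
    fieldForm c N (q * x) y = q * fieldForm c N x y := by
  rw [fieldForm, fieldForm, mul_assoc, ← eq_ratCast (algebraMap ℚ F), ← Algebra.smul_def, map_smul,
    smul_eq_mul, mul_div_assoc]

theorem fieldForm_intCast_mul_left (c : F ≃ₐ[ℚ] F) (N : ℚ) (n : ℤ) (x y : F) :
    fieldForm c N (n * x) y = n * fieldForm c N x y := by
  have := fieldForm_ratCast_mul_left c N n x y
  simpa using this

theorem fieldForm_intCast_mul_right (c : F ≃ₐ[ℚ] F) (N : ℚ) (n : ℤ) (x y : F) :
    fieldForm c N x (n * y) = n * fieldForm c N x y := by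
  have h := fieldForm_intCast_mul_left c N n x y
  rw [← h]
  simp only [fieldForm, map_mul, map_intCast]
  congr 2
  ring

/-- The dual basis spans the dual lattice. -/
theorem exists_basis_dualL {c : F ≃ₐ[ℚ] F} (𝔞 : (FractionalIdeal (𝓞 F)⁰ F)ˣ) (κ : ℕ+)
    {e : Module.Basis (Fin 2) ℚ F} (he : ∀ x : F, x ∈ latticeL 𝔞 ↔
      ∃ m : Fin 2 → ℤ, x = m 0 * e 0 + m 1 * e 1) :
    ∃ f : Fin 2 → F, (∀ i j, fieldForm c (levelN 𝔞 κ) (f i) (e j) = if i = j then 1 else 0) ∧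
      ∀ x : F, x ∈ dualL c 𝔞 κ ↔ ∃ m : Fin 2 → ℤ, x = m 0 * f 0 + m 1 * f 1 := by
  have hN := (levelN_pos 𝔞 κ).ne'
  let b : Module.Basis (Fin 2) ℚ F := e.traceDual
  -- The form is `Tr(x c(y)) / N`, so conjugating the trace-dual basis and scaling by `N` gives its
  -- dual basis.
  let f : Fin 2 → F := fun i => ((levelN 𝔞 κ : ℚ) : F) * c (b i)
  have hfe : ∀ i j, fieldForm c (levelN 𝔞 κ) (f i) (e j) = if i = j then 1 else 0 := by
    intro i j
    rw [fieldForm_ratCast_mul_left, fieldForm, ← map_mul, Algebra.trace_eq_of_algEquiv,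
      Module.Basis.trace_traceDual_mul]
    simp only [eq_comm (a := j)]
    field_simp
  have hrep : ∀ x, x = (fieldForm c (levelN 𝔞 κ) x (e 0) : F) * f 0 +
      (fieldForm c (levelN 𝔞 κ) x (e 1) : F) * f 1 := by
    intro x
    have h1 := b.sum_repr (c.symm x)
    have h2 := congrArg c h1
    rw [AlgEquiv.apply_symm_apply, Fin.sum_univ_two, Algebra.smul_def, Algebra.smul_def, map_add,
      map_mul, map_mul, AlgEquiv.commutes, AlgEquiv.commutes] at h2
    have h3 : ∀ i, b.repr (c.symm x) i = levelN 𝔞 κ * fieldForm c (levelN 𝔞 κ) x (e i) := by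
      intro i
      rw [Module.Basis.traceDual_repr_apply, Algebra.traceForm_apply,
        ← Algebra.trace_eq_of_algEquiv c, map_mul, AlgEquiv.apply_symm_apply, fieldForm]
      field_simp
    rw [h3, h3] at h2
    nth_rewrite 1 [← h2]
    simp only [f, eq_ratCast]
    push_cast
    ring
  refine ⟨f, hfe, fun x => ⟨fun hx => ?_, ?_⟩⟩
  · obtain ⟨m0, h0⟩ := hx (e 0) ((he _).mpr ⟨![1, 0], by simp⟩)
    obtain ⟨m1, h1⟩ := hx (e 1) ((he _).mpr ⟨![0, 1], by simp⟩)
    refine ⟨![m0, m1], ?_⟩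
    nth_rewrite 1 [hrep x]
    rw [h0, h1]
    simp
  · rintro ⟨m, rfl⟩ y hy
    obtain ⟨n, rfl⟩ := (he y).mp hy
    refine ⟨m 0 * n 0 + m 1 * n 1, ?_⟩
    simp only [fieldForm_add_left, fieldForm_add_right, fieldForm_intCast_mul_left,
      fieldForm_intCast_mul_right, hfe]
    push_cast
    simp
    ring

theorem exists_pos_mul_mem_latticeL {𝔞 : (FractionalIdeal (𝓞 F)⁰ F)ˣ}
    {e : Module.Basis (Fin 2) ℚ F} (he : ∀ x : F, x ∈ latticeL 𝔞 ↔
      ∃ m : Fin 2 → ℤ, x = m 0 * e 0 + m 1 * e 1) (x : F) :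
    ∃ k : ℕ, 0 < k ∧ (k : F) * x ∈ latticeL 𝔞 := by
  set q := e.repr x
  refine ⟨(q 0).den * (q 1).den, by positivity, ?_⟩
  rw [he]
  refine ⟨![(q 0).num * (q 1).den, (q 0).den * (q 1).num], ?_⟩
  have h := e.sum_repr x
  rw [Fin.sum_univ_two, Algebra.smul_def, Algebra.smul_def, eq_ratCast, eq_ratCast] at h
  have h0 : ((q 0 : ℚ) : F) * ((q 0).den : F) = (q 0).num := by exact_mod_cast Rat.mul_den_eq_num (q 0)
  have h1 : ((q 1 : ℚ) : F) * ((q 1).den : F) = (q 1).num := by exact_mod_cast Rat.mul_den_eq_num (q 1)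
  nth_rewrite 1 [← h]
  simp only [Matrix.cons_val_zero, Matrix.cons_val_one]
  push_cast
  rw [← h0, ← h1]
  ring

/-- A positive integer which maps the dual lattice into the lattice. -/
theorem exists_pos_mul_dualL (hF : Module.finrank ℚ F = 2) {c : F ≃ₐ[ℚ] F}
    (𝔞 : (FractionalIdeal (𝓞 F)⁰ F)ˣ) (κ : ℕ+) :
    ∃ k : ℕ, 0 < k ∧ ∀ x ∈ dualL c 𝔞 κ, (k : F) * x ∈ latticeL 𝔞 := by
  obtain ⟨e, he⟩ := exists_basis_latticeL hF 𝔞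
  obtain ⟨f, -, hf⟩ := exists_basis_dualL (c := c) 𝔞 κ he
  obtain ⟨k0, hk0, h0⟩ := exists_pos_mul_mem_latticeL he (f 0)
  obtain ⟨k1, hk1, h1⟩ := exists_pos_mul_mem_latticeL he (f 1)
  refine ⟨k0 * k1, by positivity, fun x hx => ?_⟩
  obtain ⟨m, rfl⟩ := (hf x).mp hx
  have e0 := mul_mem_latticeL ((k1 : 𝓞 F) * (m 0 : 𝓞 F)) h0
  have e1 := mul_mem_latticeL ((k0 : 𝓞 F) * (m 1 : 𝓞 F)) h1
  have := add_mem e0 e1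
  convert this using 1
  push_cast
  simp
  ring

/-! ### Totally positive units -/

/-- A unit has norm `±1`, and both `σ` and `σ ∘ c` are positive on it, so the norm is `1`. -/
theorem totPos_unit_mul_conj (hF : Module.finrank ℚ F = 2) {c : F ≃ₐ[ℚ] F} (hc : c ≠ 1)
    (σ : F →+* ℝ) {u : (𝓞 F)ˣ} (hu : TotPos ((u : 𝓞 F) : F)) :
    ((u : 𝓞 F) : F) * c ((u : 𝓞 F) : F) = 1 := by
  have h1 := NumberField.isUnit_iff_norm.mp u.isUnit
  rw [RingOfIntegers.coe_norm] at h1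
  have h2 := norm_eq_mul_conj hF hc ((u : 𝓞 F) : F)
  have h3 : (0 : ℝ) < ((Algebra.norm ℚ ((u : 𝓞 F) : F) : ℚ) : ℝ) := by
    have h := congrArg σ h2
    rw [map_ratCast, map_mul] at h
    rw [h]
    exact mul_pos (hu σ) (hu (σ.comp (c : F →+* F)))
  have h4 : (0 : ℚ) < Algebra.norm ℚ ((u : 𝓞 F) : F) := by exact_mod_cast h3
  rw [abs_of_pos h4] at h1
  rw [← h2, h1, Rat.cast_one]

theorem exists_int_eq_add_inv (hF : Module.finrank ℚ F = 2) {c : F ≃ₐ[ℚ] F} (hc : c ≠ 1)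
    (σ : F →+* ℝ) {u : (𝓞 F)ˣ} (hu : TotPos ((u : 𝓞 F) : F)) :
    ∃ T : ℕ, σ ((u : 𝓞 F) : F) + (σ ((u : 𝓞 F) : F))⁻¹ = T := by
  have h1 := totPos_unit_mul_conj hF hc σ hu
  have h2 := trace_eq_add_conj hF hc ((u : 𝓞 F) : F)
  have h3 : IsIntegral ℤ (Algebra.trace ℚ F ((u : 𝓞 F) : F)) :=
    Algebra.isIntegral_trace (NumberField.RingOfIntegers.isIntegral_coe _)
  obtain ⟨T, hT⟩ := IsIntegrallyClosed.isIntegral_iff.mp h3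
  have h4 := congrArg σ h2
  rw [map_ratCast, map_add] at h4
  have h5 : (σ ((u : 𝓞 F) : F))⁻¹ = σ (c ((u : 𝓞 F) : F)) := by
    apply inv_eq_of_mul_eq_one_right
    rw [← map_mul, h1, map_one]
  have hpos : 0 < σ ((u : 𝓞 F) : F) := hu σ
  have h6 : σ ((u : 𝓞 F) : F) + (σ ((u : 𝓞 F) : F))⁻¹ = (T : ℝ) := by
    rw [h5, ← h4, ← hT]
    simp
  have hT0 : 0 ≤ T := by
    have : (0 : ℝ) ≤ (T : ℝ) := by rw [← h6]; positivity
    exact_mod_cast this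
  refine ⟨T.toNat, ?_⟩
  rw [h6]
  exact_mod_cast (Int.toNat_of_nonneg hT0).symm

/-- On `x > 1` the function `x + x⁻¹` is strictly increasing, and on admissible units it is a trace,
hence a natural number. Well-ordering of its values yields a least unit. -/
theorem exists_isLeast_admissibleUnits (hF : Module.finrank ℚ F = 2) {c : F ≃ₐ[ℚ] F} (hc : c ≠ 1)
    (σ : F →+* ℝ) (𝔞 : (FractionalIdeal (𝓞 F)⁰ F)ˣ) (κ : ℕ+)
    (hne : (admissibleUnits σ c 𝔞 κ).Nonempty) :
    ∃ x, IsLeast (admissibleUnits σ c 𝔞 κ) x := by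
  classical
  have hT : ∀ x ∈ admissibleUnits σ c 𝔞 κ, ∃ T : ℕ, x + x⁻¹ = T := by
    rintro x ⟨u, hu, rfl, -⟩
    exact exists_int_eq_add_inv hF hc σ hu
  have hex : ∃ T : ℕ, ∃ x ∈ admissibleUnits σ c 𝔞 κ, x + x⁻¹ = T := by
    obtain ⟨x, hx⟩ := hne
    obtain ⟨T, h⟩ := hT x hx
    exact ⟨T, x, hx, h⟩
  obtain ⟨x, hx, hxT⟩ := Nat.find_spec hex
  refine ⟨x, hx, fun y hy => ?_⟩
  obtain ⟨T, hyT⟩ := hT y hy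
  have h1 : Nat.find hex ≤ T := Nat.find_min' hex ⟨y, hy, hyT⟩
  have h2 : x + x⁻¹ ≤ y + y⁻¹ := by rw [hxT, hyT]; exact_mod_cast h1
  have hx1 : 1 < x := by obtain ⟨u, -, -, h, -⟩ := hx; exact h
  have hy1 : 1 < y := by obtain ⟨u, -, -, h, -⟩ := hy; exact h
  by_contra! hlt
  have h3 : (x + x⁻¹) - (y + y⁻¹) = (x - y) * (1 - (x * y)⁻¹) := by
    have : x ≠ 0 := by linarith
    have : y ≠ 0 := by linarith
    field_simp
    ring
  have h4 : (x * y)⁻¹ < 1 := inv_lt_one_of_one_lt₀ (by nlinarith)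
  have := mul_pos (sub_pos.mpr hlt) (sub_pos.mpr h4)
  linarith

/-- A real quadratic field contains an integral square root of an integer. -/
theorem exists_sqrt_int (hF : Module.finrank ℚ F = 2) {c : F ≃ₐ[ℚ] F} (hc : c ≠ 1)
    (σ : F →+* ℝ) : ∃ (θ : 𝓞 F) (d : ℤ), c (θ : F) = -θ ∧ 0 < σ θ ∧ (θ : F) ^ 2 = d := by
  obtain ⟨x, hx⟩ : ∃ x, c x ≠ x := by
    by_contra! h
    exact hc (AlgEquiv.ext h)
  obtain ⟨n, hn, hint⟩ := IsAlgebraic.exists_integral_multiple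
    ((IsFractionRing.isAlgebraic_iff ℤ ℚ F (x := x - c x)).mpr (Algebra.IsAlgebraic.isAlgebraic _))
  have hn' : (n : F) ≠ 0 := by exact_mod_cast hn
  -- For an element moved by `c`, the difference `x - c x` is anti-invariant; the integer `n` makes
  -- it integral.
  let η : 𝓞 F := ⟨n • (x - c x), hint⟩
  have hη : (η : F) = n * (x - c x) := by
    change n • (x - c x) = _
    rw [zsmul_eq_mul]
  have hcη : c (η : F) = -η := by
    rw [hη, map_mul, map_intCast, map_sub, conj_conj hF hc]
    ring
  have hη0 : σ η ≠ 0 := by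
    rw [map_ne_zero, hη]
    exact mul_ne_zero hn' (sub_ne_zero.mpr hx.symm)
  obtain ⟨θ, hcθ, hθ0⟩ : ∃ θ : 𝓞 F, c (θ : F) = -θ ∧ 0 < σ θ := by
    rcases lt_or_gt_of_ne hη0 with h | h
    · have e : ((-η : 𝓞 F) : F) = -(η : F) := map_neg (algebraMap (𝓞 F) F) η
      refine ⟨-η, ?_, ?_⟩
      · rw [e, map_neg, hcη]
      · rw [e, map_neg]; linarith
    · exact ⟨η, hcη, h⟩
  obtain ⟨d, hd⟩ := IsIntegrallyClosed.isIntegral_iff.mp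
    (Algebra.isIntegral_norm ℚ (NumberField.RingOfIntegers.isIntegral_coe θ))
  refine ⟨θ, -d, hcθ, hθ0, ?_⟩
  have h := norm_eq_mul_conj hF hc (θ : F)
  rw [← hd, hcθ] at h
  simp only [eq_intCast, Rat.cast_intCast] at h
  push_cast
  rw [h]
  ring

/-- Choose `k > 0` with `k L^∨ ⊆ L`. A solution of `X² - d k² Y² = 1` gives the unit `u₀ = X + Y k
θ`. Its square is totally positive, and `u₀² - 1` is divisible by `k`, so it maps `L^∨` into `L`. -/
theorem admissibleUnits_nonempty (hF : Module.finrank ℚ F = 2) {c : F ≃ₐ[ℚ] F} (hc : c ≠ 1)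
    (σ : F →+* ℝ) (𝔞 : (FractionalIdeal (𝓞 F)⁰ F)ˣ) (κ : ℕ+) :
    (admissibleUnits σ c 𝔞 κ).Nonempty := by
  obtain ⟨θ, d, hcθ, hσθ, hθ⟩ := exists_sqrt_int hF hc σ
  obtain ⟨k, hk, hkL⟩ := exists_pos_mul_dualL hF (c := c) 𝔞 κ
  have hσd : (σ θ) ^ 2 = d := by
    have := congrArg σ hθ
    simpa using this
  have hd : 0 < d := by
    have : (0 : ℝ) < d := by rw [← hσd]; positivity
    exact_mod_cast this
  -- Otherwise `k θ` would be an integer up to sign and hence fixed by `c`, although `c θ = -θ ≠ θ`.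
  have hsq : ¬ IsSquare (d * (k : ℤ) ^ 2) := by
    rintro ⟨m, hm⟩
    have h1 : ((k : F) * θ) ^ 2 = (m : F) ^ 2 := by
      rw [mul_pow, hθ]
      have : ((d * (k : ℤ) ^ 2 : ℤ) : F) = ((m * m : ℤ) : F) := by rw [hm]
      push_cast at this
      linear_combination this
    have h2 : c ((k : F) * θ) = (k : F) * θ := by
      rcases sq_eq_sq_iff_eq_or_eq_neg.mp h1 with h | h <;> rw [h] <;> simp
    rw [map_mul, map_natCast, hcθ] at h2
    have h3 := congrArg σ h2
    rw [map_mul, map_mul, map_neg, map_natCast] at h3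
    have : (0 : ℝ) < k * σ θ := by positivity
    linarith
  obtain ⟨x, y, hxy, hy⟩ := Pell.exists_of_not_isSquare (by positivity) hsq
  -- Absolute values make both coordinates positive, which forces `σ u₀ > 1`.
  have hxy' : |x| ^ 2 - (d * (k : ℤ) ^ 2) * |y| ^ 2 = 1 := by rw [sq_abs, sq_abs]; exact hxy
  have hyp : 1 ≤ |y| := Int.one_le_abs hy
  have hxp : 1 ≤ |x| := by
    apply Int.one_le_abs
    rintro rfl
    have : 0 < d * (k : ℤ) ^ 2 * y ^ 2 := by positivity
    nlinarith
  generalize |x| = X at hxy' hxp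
  generalize |y| = Y at hxy' hyp
  have hθ' : (θ : 𝓞 F) ^ 2 = (d : 𝓞 F) := by
    apply NumberField.RingOfIntegers.ext
    push_cast
    rw [hθ]
    simp
  have hprod : ((X : 𝓞 F) + Y * k * θ) * ((X : 𝓞 F) - Y * k * θ) = 1 := by
    have : ((X ^ 2 - (d * (k : ℤ) ^ 2) * Y ^ 2 : ℤ) : 𝓞 F) = ((1 : ℤ) : 𝓞 F) := by rw [hxy']
    push_cast at this
    linear_combination this - (Y : 𝓞 F) ^ 2 * (k : 𝓞 F) ^ 2 * hθ'
  let u₀ : (𝓞 F)ˣ := Units.mkOfMulEqOne _ _ hprod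
  have hu₀ : (((u₀ : 𝓞 F)) : F) = X + Y * k * θ := by
    change (((X : 𝓞 F) + Y * k * θ : 𝓞 F) : F) = _
    simp
  have hσ1 : 1 < σ (((u₀ : 𝓞 F)) : F) := by
    rw [hu₀]
    simp only [map_add, map_mul, map_intCast, map_natCast]
    have h1 : (1 : ℝ) ≤ X := by exact_mod_cast hxp
    have h2 : (1 : ℝ) ≤ Y := by exact_mod_cast hyp
    have h3 : (0 : ℝ) < k := by exact_mod_cast hk
    have : 0 < (Y : ℝ) * k * σ θ := by positivity
    linarith
  refine ⟨σ (((u₀ ^ 2 : (𝓞 F)ˣ) : 𝓞 F) : F), u₀ ^ 2, ?_, rfl, ?_, ?_⟩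
  · intro φ
    have : φ ((u₀ : 𝓞 F) : F) ≠ 0 := by
      rw [map_ne_zero]
      intro h
      rw [h, map_zero] at hσ1
      linarith
    have h2 : φ (((u₀ ^ 2 : (𝓞 F)ˣ) : 𝓞 F) : F) = (φ ((u₀ : 𝓞 F) : F)) ^ 2 := by simp
    rw [h2]
    positivity
  · have h2 : σ (((u₀ ^ 2 : (𝓞 F)ˣ) : 𝓞 F) : F) = (σ ((u₀ : 𝓞 F) : F)) ^ 2 := by simp
    rw [h2]
    nlinarith
  · intro z hz
    -- By Pell's equation `u₀² - 1 = k (2 d k Y² + 2 X Y θ)`.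
    have h1 : ((((u₀ ^ 2 : (𝓞 F)ˣ) : 𝓞 F) : F) - 1) * z =
        ((2 * d * k * Y ^ 2 + 2 * X * Y * θ : 𝓞 F) : F) * (k * z) := by
      have h2 : (((u₀ ^ 2 : (𝓞 F)ˣ) : 𝓞 F) : F) = ((u₀ : 𝓞 F) : F) ^ 2 := by simp
      rw [h2, hu₀]
      have h3 : ((X ^ 2 - (d * (k : ℤ) ^ 2) * Y ^ 2 : ℤ) : F) = ((1 : ℤ) : F) := by rw [hxy']
      push_cast at h3
      simp only [map_add, map_mul, map_pow, map_intCast, map_natCast, map_ofNat]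
      linear_combination z * h3 + (Y : F) ^ 2 * (k : F) ^ 2 * z * hθ
    rw [h1]
    exact mul_mem_latticeL _ (hkL z hz)

theorem isLeast_epsilon (hF : Module.finrank ℚ F = 2) {c : F ≃ₐ[ℚ] F} (hc : c ≠ 1)
    (σ : F →+* ℝ) (𝔞 : (FractionalIdeal (𝓞 F)⁰ F)ˣ) (κ : ℕ+) :
    IsLeast (admissibleUnits σ c 𝔞 κ) (epsilon σ c 𝔞 κ) := by
  obtain ⟨x, hx⟩ := exists_isLeast_admissibleUnits hF hc σ 𝔞 κ
    (admissibleUnits_nonempty hF hc σ 𝔞 κ)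
  rw [epsilon, hx.csInf_eq]
  exact hx

end QuadraticField

/-! ### The theta kernel in isotropic coordinates -/

theorem bil_eq (N : ℝ) (A B : Matrix (Fin 2) (Fin 2) ℝ) :
    bil N A B = (A 0 0 * B 1 1 + B 0 0 * A 1 1 - A 0 1 * B 1 0 - B 0 1 * A 1 0) / N := by
  simp only [bil, QuadraticMap.polar, quadQ, Matrix.det_fin_two, Matrix.add_apply]
  ring

/-- The matrix with given isotropic coordinates. -/
noncomputable def isoMatrix (N : ℝ) (l : Fin 4 → ℝ) : Matrix (Fin 2) (Fin 2) ℝ :=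
  √N • !![l 0, l 2; l 3, l 1]

theorem bil_isoMatrix {N : ℝ} (hN : 0 < N) (l l' : Fin 4 → ℝ) :
    bil N (isoMatrix N l) (isoMatrix N l') = l 0 * l' 1 + l' 0 * l 1 - l 2 * l' 3 - l' 2 * l 3 := by
  have h : √N * √N = N := Real.mul_self_sqrt hN.le
  rw [bil_eq, div_eq_iff hN.ne']
  simp [isoMatrix]
  linear_combination (l 0 * l' 1 + l' 0 * l 1 - l 2 * l' 3 - l' 2 * l 3) * h

theorem quadQ_isoMatrix {N : ℝ} (hN : 0 < N) (l : Fin 4 → ℝ) :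
    quadQ N (isoMatrix N l) = hypForm l := by
  have h : √N * √N = N := Real.mul_self_sqrt hN.le
  rw [quadQ, div_eq_iff hN.ne']
  simp [isoMatrix, Matrix.det_fin_two, hypForm]
  linear_combination (l 0 * l 1 - l 2 * l 3) * h

theorem vecX_eq (N t : ℝ) : vecX N t = isoMatrix N ![Real.exp t, -Real.exp (-t), 0, 0] := by
  simp [vecX, isoMatrix]

theorem vecY_eq (N t : ℝ) : vecY N t = isoMatrix N ![0, 0, Real.exp t, Real.exp (-t)] := by
  simp [vecY, isoMatrix]

theorem vecXperp_eq (N t : ℝ) : vecXperp N t = isoMatrix N ![Real.exp t, Real.exp (-t), 0, 0] := by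
  simp [vecXperp, isoMatrix]

theorem vecYperp_eq (N t : ℝ) : vecYperp N t = isoMatrix N ![0, 0, Real.exp t, -Real.exp (-t)] := by
  simp [vecYperp, isoMatrix]

theorem isoMatrix_lin (N a b : ℝ) (l l' : Fin 4 → ℝ) :
    a • isoMatrix N l + b • isoMatrix N l' = isoMatrix N (a • l + b • l') := by
  ext i j
  fin_cases i <;> fin_cases j <;> simp [isoMatrix] <;> ring

/-- The spanning vectors are orthogonal with `Q = 1`, so each contributes the square of its pairing
divided by `4`. On the negative plane below, `Q = -1` flips the sign. -/
theorem quadQ_projPos {N : ℝ} (hN : 0 < N) (l : Fin 4 → ℝ) (t s : ℝ) :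
    quadQ N (projPos N t s (isoMatrix N l)) = (posX l t ^ 2 + posY l s ^ 2) / 4 := by
  have h1 : Real.exp t * Real.exp (-t) = 1 := by rw [← Real.exp_add]; simp
  have h2 : Real.exp s * Real.exp (-s) = 1 := by rw [← Real.exp_add]; simp
  have e1 : Real.exp t * Real.exp (-t) + Real.exp t * Real.exp (-t) = 2 := by rw [h1]; norm_num
  have e2 : Real.exp s * Real.exp (-s) + Real.exp s * Real.exp (-s) = 2 := by rw [h2]; norm_num
  rw [projPos, planeProj, vecXperp_eq, vecYperp_eq, isoMatrix_lin, quadQ_isoMatrix hN]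
  simp only [bil_isoMatrix hN]
  simp [hypForm, posX, posY, e1, e2]
  linear_combination ((l 1 * Real.exp t + l 0 * Real.exp (-t)) ^ 2 / 4) * h1 +
    ((l 2 * Real.exp (-s) - l 3 * Real.exp s) ^ 2 / 4) * h2

theorem quadQ_projNeg {N : ℝ} (hN : 0 < N) (l : Fin 4 → ℝ) (t s : ℝ) :
    quadQ N (projNeg N t s (isoMatrix N l)) = -(negX l t ^ 2 + negY l s ^ 2) / 4 := by
  have h1 : Real.exp t * Real.exp (-t) = 1 := by rw [← Real.exp_add]; simp
  have h2 : Real.exp s * Real.exp (-s) = 1 := by rw [← Real.exp_add]; simp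
  have e1 : -(Real.exp t * Real.exp (-t)) + -(Real.exp t * Real.exp (-t)) = -2 := by
    rw [h1]; norm_num
  have e2 : -(Real.exp s * Real.exp (-s)) - Real.exp s * Real.exp (-s) = -2 := by
    rw [h2]; norm_num
  rw [projNeg, planeProj, vecX_eq, vecY_eq, isoMatrix_lin, quadQ_isoMatrix hN]
  simp only [bil_isoMatrix hN]
  simp [hypForm, negX, negY, e1, e2]
  linear_combination (-(l 1 * Real.exp t - l 0 * Real.exp (-t)) ^ 2 / 4) * h1 -
    ((l 2 * Real.exp (-s) + l 3 * Real.exp s) ^ 2 / 4) * h2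

/-- Passage from the summand of the statement to the analytic kernel. The factor `√N` in the
isotropic coordinates removes the level. -/
theorem thetaTerm_isoMatrix {N : ℝ} (hN : 0 < N) (τ : ℍ) (t s : ℝ) (l : Fin 4 → ℝ) :
    thetaTerm N τ t s (isoMatrix N l) = kernelXQ l τ.re τ.im t s := by
  have hX : bil N (isoMatrix N l) (vecX N t) = negX l t := by
    rw [vecX_eq, bil_isoMatrix hN]; simp [negX]; ring
  have hY : bil N (isoMatrix N l) (vecYperp N s) = posY l s := by
    rw [vecYperp_eq, bil_isoMatrix hN]; simp [posY]; ring
  have h4 : (4 * hypForm l : ℂ) =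
      posX l t ^ 2 + posY l s ^ 2 - negX l t ^ 2 - negY l s ^ 2 := by
    exact_mod_cast four_mul_hypForm l t s
  have hτ : (τ : ℂ) = τ.re + τ.im * Complex.I := (Complex.re_add_im _).symm
  have hτ' : conj (τ : ℂ) = τ.re - τ.im * Complex.I := by
    rw [hτ]; simp [sub_eq_add_neg]
  rw [thetaTerm, hX, hY, quadQ_projPos hN, quadQ_projNeg hN, kernelXQ, siegelGauss, hτ', hτ,
    majorant, Complex.ofReal_mul]
  congr 2
  push_cast
  linear_combination (-(Real.pi * τ.re * Complex.I / 2 : ℂ)) * h4 +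
    (Real.pi * τ.im * (posX l t ^ 2 + posY l s ^ 2 + negX l t ^ 2 + negY l s ^ 2) / 2 : ℂ) *
      Complex.I_sq

/-! ### Lattice sums -/

section Lattice

variable {F : Type*} [Field F] [NumberField F]

/-- Pairs `(l₁, l₂)` in the dual lattice with `l₁ - l₂ ∈ L`. -/
def pairSet (c : F ≃ₐ[ℚ] F) (𝔞 : (FractionalIdeal (𝓞 F)⁰ F)ˣ) (κ : ℕ+) : Set (F × F) :=
  {p | p.1 ∈ dualL c 𝔞 κ ∧ p.2 ∈ dualL c 𝔞 κ ∧ p.1 - p.2 ∈ latticeL 𝔞}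

/-- Isotropic coordinates of a pair. -/
noncomputable def pairVec (N : ℝ) (σ : F →+* ℝ) (c : F ≃ₐ[ℚ] F) (p : F × F) : Fin 4 → ℝ :=
  (√N)⁻¹ • ![σ p.1, σ (c p.1), σ p.2, σ (c p.2)]

theorem map_vMat {N : ℝ} (hN : 0 < N) (σ : F →+* ℝ) (c : F ≃ₐ[ℚ] F) (p : F × F) :
    (vMat c p.1 p.2).map σ = isoMatrix N (pairVec N σ c p) := by
  have : √N ≠ 0 := (Real.sqrt_pos.mpr hN).ne'
  ext i j
  fin_cases i <;> fin_cases j <;> simp [vMat, isoMatrix, pairVec, this]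

/-- Matrices in `M` correspond to pairs. -/
noncomputable def pairSetEquiv (c : F ≃ₐ[ℚ] F) (𝔞 : (FractionalIdeal (𝓞 F)⁰ F)ˣ) (κ : ℕ+) :
    pairSet c 𝔞 κ ≃ latticeM c 𝔞 κ :=
  Equiv.ofBijective
    (fun p => ⟨vMat c p.1.1 p.1.2, p.1.1, p.2.1, p.1.2, p.2.2.1, p.2.2.2, rfl⟩) <| by
    constructor
    · rintro ⟨⟨a, b⟩, hp⟩ ⟨⟨a', b'⟩, hp'⟩ h
      have h' := congrArg Subtype.val h
      have h1 := congrFun (congrFun h' 0) 0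
      have h2 := congrFun (congrFun h' 0) 1
      simp [vMat] at h1 h2
      simp [h1, h2]
    · rintro ⟨A, a, ha, b, hb, hab, rfl⟩
      exact ⟨⟨(a, b), ha, hb, hab⟩, rfl⟩

theorem latticeTerm_pairSetEquiv (σ : F →+* ℝ) (c : F ≃ₐ[ℚ] F)
    (𝔞 : (FractionalIdeal (𝓞 F)⁰ F)ˣ) (κ : ℕ+) (τ : ℍ) (t s : ℝ) (p : pairSet c 𝔞 κ) :
    latticeTerm σ c 𝔞 κ τ t s (pairSetEquiv c 𝔞 κ p) =
      kernelXQ (pairVec (levelN 𝔞 κ) σ c p) τ.re τ.im t s := by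
  rw [latticeTerm, ← thetaTerm_isoMatrix (levelN_pos_real 𝔞 κ),
    ← map_vMat (levelN_pos_real 𝔞 κ)]
  rfl

/-- A frame for `M` in isotropic coordinates which is even unimodular. -/
theorem exists_frame (hF : Module.finrank ℚ F = 2) {c : F ≃ₐ[ℚ] F} (hc : c ≠ 1)
    (σ : F →+* ℝ) (𝔞 : (FractionalIdeal (𝓞 F)⁰ F)ˣ) (κ : ℕ+) :
    ∃ (R : Matrix (Fin 4) (Fin 4) ℝ) (φ : (Fin 4 → ℤ) ≃ pairSet c 𝔞 κ), IsEvenUnimodular R ∧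
      ∀ m : Fin 4 → ℤ, (R.mulVec fun i => (m i : ℝ)) = pairVec (levelN 𝔞 κ) σ c (φ m) := by
  obtain ⟨e, he⟩ := exists_basis_latticeL hF 𝔞
  obtain ⟨f, hfe, hf⟩ := exists_basis_dualL (c := c) 𝔞 κ he
  have hLd := latticeL_le_dualL hF hc σ 𝔞 κ
  have heL : ∀ i, e i ∈ latticeL 𝔞 := by
    intro i
    rw [he]
    fin_cases i
    · exact ⟨![1, 0], by simp⟩
    · exact ⟨![0, 1], by simp⟩
  set N : ℝ := (levelN 𝔞 κ : ℝ) with hNdef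
  have hN : 0 < N := levelN_pos_real 𝔞 κ
  have hs : (√N)⁻¹ * (√N)⁻¹ = N⁻¹ := by rw [← mul_inv, Real.mul_self_sqrt hN.le]
  have hg : ∀ i j, ∃ k : ℤ, (σ (e i) * σ (c (e j)) + σ (c (e i)) * σ (e j)) / N = k := by
    intro i j
    obtain ⟨k, hk⟩ := hLd (heL i) (e j) (heL j)
    refine ⟨k, ?_⟩
    rw [← ratCast_fieldForm hF hc _ σ, hk]
    simp
  choose g hg using hg
  have hfe' : ∀ i j, (σ (f i) * σ (c (e j)) + σ (c (f i)) * σ (e j)) / N = if i = j then 1 else 0 := by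
    intro i j
    rw [← ratCast_fieldForm hF hc _ σ, hfe]
    split_ifs <;> simp
  -- The columns are the pairs `(eᵢ, 0)` and `(fᵢ, fᵢ)`: an element of `M` is uniquely `(x + y, y)`
  -- with `x ∈ L` and `y ∈ L^∨`.
  let R : Matrix (Fin 4) (Fin 4) ℝ := (√N)⁻¹ • !![σ (e 0), σ (e 1), σ (f 0), σ (f 1);
    σ (c (e 0)), σ (c (e 1)), σ (c (f 0)), σ (c (f 1));
    0, 0, σ (f 0), σ (f 1); 0, 0, σ (c (f 0)), σ (c (f 1))]
  have hmem : ∀ m : Fin 4 → ℤ,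
      ((m 0 * e 0 + m 1 * e 1 + (m 2 * f 0 + m 3 * f 1), m 2 * f 0 + m 3 * f 1) : F × F) ∈
        pairSet c 𝔞 κ := by
    intro m
    have h1 : (m 0 * e 0 + m 1 * e 1 : F) ∈ latticeL 𝔞 := (he _).mpr ⟨![m 0, m 1], by simp⟩
    have h2 : (m 2 * f 0 + m 3 * f 1 : F) ∈ dualL c 𝔞 κ := (hf _).mpr ⟨![m 2, m 3], by simp⟩
    exact ⟨add_mem (hLd h1) h2, h2, by simpa using h1⟩
  have hlin : ∀ m : Fin 4 → ℤ, (R.mulVec fun i => (m i : ℝ)) = pairVec N σ c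
      (m 0 * e 0 + m 1 * e 1 + (m 2 * f 0 + m 3 * f 1), m 2 * f 0 + m 3 * f 1) := by
    intro m
    ext i
    fin_cases i <;> simp [R, pairVec, Matrix.mulVec, dotProduct, Fin.sum_univ_four] <;> ring
  -- In `Q(x + y, y) = Q(x + y) - Q(y) = Q(x) + (y, x)` the possibly non-integral `Q(y)` cancels.
  have heven : ∀ m : Fin 4 → ℤ, ∃ k : ℤ, hypForm (R.mulVec fun i => (m i : ℝ)) = k := by
    intro m
    rw [hlin]
    have h1 : (m 0 * e 0 + m 1 * e 1 : F) ∈ latticeL 𝔞 := (he _).mpr ⟨![m 0, m 1], by simp⟩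
    have h2 : (m 2 * f 0 + m 3 * f 1 : F) ∈ dualL c 𝔞 κ := (hf _).mpr ⟨![m 2, m 3], by simp⟩
    generalize (m 0 * e 0 + m 1 * e 1 : F) = x at h1
    generalize (m 2 * f 0 + m 3 * f 1 : F) = y at h2
    obtain ⟨k, hk⟩ := exists_conj_mul_eq hF hc σ 𝔞 κ h1
    obtain ⟨k', hk'⟩ := h2 x h1
    have hk'' := ratCast_fieldForm hF hc (levelN 𝔞 κ) σ y x
    rw [hk', ← hNdef] at hk''
    refine ⟨k + k', ?_⟩
    rw [← hNdef] at hk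
    push_cast at hk'' ⊢
    rw [hk'', ← hk]
    simp only [hypForm, pairVec, Pi.smul_apply, smul_eq_mul, map_add, Matrix.cons_val]
    rw [div_eq_mul_inv, div_eq_mul_inv, ← hs]
    ring
  -- The lower right block vanishes because diagonal pairs are isotropic, and the off-diagonal
  -- blocks are identities because `f` is dual to `e`.
  have hgram : R.transpose * hypGram * R =
      (!![g 0 0, g 0 1, 1, 0; g 1 0, g 1 1, 0, 1; 1, 0, 0, 0; 0, 1, 0, 0] :
        Matrix (Fin 4) (Fin 4) ℤ).map (Int.cast : ℤ → ℝ) := by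
    have a00 := hfe' 0 0
    have a01 := hfe' 0 1
    have a10 := hfe' 1 0
    have a11 := hfe' 1 1
    simp only [if_true, zero_ne_one, one_ne_zero, if_false, div_eq_mul_inv, ← hs] at a00 a01 a10 a11
    have b00 := hg 0 0
    have b01 := hg 0 1
    have b10 := hg 1 0
    have b11 := hg 1 1
    simp only [div_eq_mul_inv, ← hs] at b00 b01 b10 b11
    ext i j
    fin_cases i <;> fin_cases j <;>
      simp [R, hypGram, Matrix.mul_apply, Fin.sum_univ_four] <;>
      first
        | ring1
        | linear_combination a00
        | linear_combination a01
        | linear_combination a10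
        | linear_combination a11
        | linear_combination b00
        | linear_combination b01
        | linear_combination b10
        | linear_combination b11
  have huni : (!![g 0 0, g 0 1, 1, 0; g 1 0, g 1 1, 0, 1; 1, 0, 0, 0; 0, 1, 0, 0] :
        Matrix (Fin 4) (Fin 4) ℤ) *
      !![0, 0, 1, 0; 0, 0, 0, 1; 1, 0, -g 0 0, -g 0 1; 0, 1, -g 1 0, -g 1 1] = 1 := by
    ext i j
    fin_cases i <;> fin_cases j <;> simp [Matrix.mul_apply, Fin.sum_univ_four]
  have hR : IsEvenUnimodular R := ⟨⟨_, _, huni, hgram⟩, heven⟩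
  refine ⟨R, Equiv.ofBijective (fun m => ⟨_, hmem m⟩) ⟨?_, ?_⟩, hR, fun m => hlin m⟩
  · intro m m' h
    have h' : (R.mulVec fun i => (m i : ℝ)) = R.mulVec fun i => (m' i : ℝ) := by
      rw [hlin, hlin]
      exact congrArg (pairVec N σ c) (congrArg Subtype.val h)
    have := Matrix.mulVec_injective_of_isUnit
      ((Matrix.isUnit_iff_isUnit_det R).mpr hR.isUnit_det) h'
    ext i
    exact_mod_cast congrFun this i
  · rintro ⟨⟨a, b⟩, ha, hb, hab⟩
    obtain ⟨m, hm⟩ := (he _).mp hab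
    obtain ⟨n, hn⟩ := (hf _).mp hb
    refine ⟨![m 0, m 1, n 0, n 1], Subtype.ext (Prod.ext ?_ ?_)⟩
    · simp only [Matrix.cons_val]
      rw [← hn, ← hm]
      ring
    · simp only [Matrix.cons_val]
      rw [← hn]

end Lattice

/-! ### Boosts -/

/-- The isometry which scales the isotropic coordinates by `e^{-a}, e^a, e^{-b}, e^b`. -/
noncomputable def boost (a b : ℝ) (l : Fin 4 → ℝ) : Fin 4 → ℝ :=
  ![Real.exp (-a) * l 0, Real.exp a * l 1, Real.exp (-b) * l 2, Real.exp b * l 3]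

/-- Moving the vector by a boost is the same as translating the base point: the four coordinates
depend only on the products of `l i` with the exponentials. -/
theorem negX_boost (a b : ℝ) (l : Fin 4 → ℝ) (t : ℝ) : negX (boost a b l) t = negX l (t + a) := by
  simp [negX, boost, Real.exp_add]; ring

theorem posX_boost (a b : ℝ) (l : Fin 4 → ℝ) (t : ℝ) : posX (boost a b l) t = posX l (t + a) := by
  simp [posX, boost, Real.exp_add]; ring

theorem negY_boost (a b : ℝ) (l : Fin 4 → ℝ) (s : ℝ) : negY (boost a b l) s = negY l (s + b) := by
  simp [negY, boost, Real.exp_add]; ring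

theorem posY_boost (a b : ℝ) (l : Fin 4 → ℝ) (s : ℝ) : posY (boost a b l) s = posY l (s + b) := by
  simp [posY, boost, Real.exp_add]; ring

theorem siegelGauss_boost (a b : ℝ) (l : Fin 4 → ℝ) (u v t s : ℝ) :
    siegelGauss (boost a b l) u v t s = siegelGauss l u v (t + a) (s + b) := by
  have h : hypForm (boost a b l) = hypForm l := by
    have h1 := four_mul_hypForm (boost a b l) 0 0
    have h2 := four_mul_hypForm l (0 + a) (0 + b)
    rw [negX_boost, posX_boost, negY_boost, posY_boost, ← h2] at h1
    linarith
  simp only [siegelGauss, majorant, h, negX_boost, posX_boost, negY_boost, posY_boost]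

theorem kernelXQ_boost (a b : ℝ) (l : Fin 4 → ℝ) (u v t s : ℝ) :
    kernelXQ (boost a b l) u v t s = kernelXQ l u v (t + a) (s + b) := by
  simp only [kernelXQ, siegelGauss_boost, negX_boost, posY_boost]

theorem kernelPY_boost (a b : ℝ) (l : Fin 4 → ℝ) (u v t s : ℝ) :
    kernelPY (boost a b l) u v t s = kernelPY l u v (t + a) (s + b) := by
  simp only [kernelPY, siegelGauss_boost, posX_boost, negY_boost]

/-- A bijection of lattices induced by a boost translates the parameters of the theta series. It is
used for admissible units, acting on one lattice, and for multiplication by `μ` between two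
lattices. -/
theorem thetaSum_boost {R R' : Matrix (Fin 4) (Fin 4) ℝ} {a b : ℝ}
    (ψ : (Fin 4 → ℤ) ≃ (Fin 4 → ℤ))
    (hψ : ∀ m, (R'.mulVec fun i => (ψ m i : ℝ)) = boost a b (R.mulVec fun i => (m i : ℝ)))
    {K : (Fin 4 → ℝ) → ℝ → ℝ → ℝ → ℝ → ℂ}
    (hK : ∀ l u v t s, K (boost a b l) u v t s = K l u v (t + a) (s + b)) (u v t s : ℝ) :
    thetaSum R' K u v t s = thetaSum R K u v (t + a) (s + b) := by
  rw [thetaSum, thetaSum, ← ψ.tsum_eq]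
  simp only [hψ, hK]

theorem stripIntegral_boost {R R' : Matrix (Fin 4) (Fin 4) ℝ} {a b : ℝ}
    (ψ : (Fin 4 → ℤ) ≃ (Fin 4 → ℤ))
    (hψ : ∀ m, (R'.mulVec fun i => (ψ m i : ℝ)) = boost a b (R.mulVec fun i => (m i : ℝ)))
    {K : (Fin 4 → ℝ) → ℝ → ℝ → ℝ → ℝ → ℂ}
    (hK : ∀ l u v t s, K (boost a b l) u v t s = K l u v (t + a) (s + b)) (t s : ℝ) :
    stripIntegral R' K t s = stripIntegral R K (t + a) (s + b) := by
  simp only [stripIntegral, thetaSum_boost ψ hψ hK]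

/-! ### Units, periodicity and the cycle integral -/

section Symmetry

variable {F : Type*} [Field F] [NumberField F]

theorem pairVec_mul {N N' a b : ℝ} (σ : F →+* ℝ) (c : F ≃ₐ[ℚ] F) (α β : F)
    (h₁ : (√N')⁻¹ * σ α = Real.exp (-a) * (√N)⁻¹) (h₂ : (√N')⁻¹ * σ (c α) = Real.exp a * (√N)⁻¹)
    (h₃ : (√N')⁻¹ * σ β = Real.exp (-b) * (√N)⁻¹) (h₄ : (√N')⁻¹ * σ (c β) = Real.exp b * (√N)⁻¹)
    (p : F × F) : pairVec N' σ c (α * p.1, β * p.2) = boost a b (pairVec N σ c p) := by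
  ext i
  fin_cases i <;> simp only [pairVec, boost, Fin.zero_eta, Fin.mk_one, Fin.reduceFinMk,
    Pi.smul_apply, smul_eq_mul, Matrix.cons_val, map_mul]
  · rw [← mul_assoc, h₁]; ring
  · rw [← mul_assoc, h₂]; ring
  · rw [← mul_assoc, h₃]; ring
  · rw [← mul_assoc, h₄]; ring

/-- Multiplication of the first entry by a unit that is trivial on `L^∨ / L`. -/
theorem mul_fst_mem_pairSet {c : F ≃ₐ[ℚ] F} {𝔞 : (FractionalIdeal (𝓞 F)⁰ F)ˣ} {κ : ℕ+}
    (hLd : latticeL 𝔞 ≤ dualL c 𝔞 κ) {w : F}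
    (hw : ∀ y ∈ dualL c 𝔞 κ, (w - 1) * y ∈ latticeL 𝔞) {p : F × F} (hp : p ∈ pairSet c 𝔞 κ) :
    (w * p.1, 1 * p.2) ∈ pairSet c 𝔞 κ := by
  obtain ⟨h1, h2, h3⟩ := hp
  have h4 := hw _ h1
  refine ⟨?_, by simpa using h2, ?_⟩
  · have := add_mem h1 (hLd h4)
    convert this using 1
    ring
  · have := add_mem h3 h4
    convert this using 1
    ring

/-- Since `u⁻¹ - 1 = -u⁻¹ (u - 1)` and `L` is an `𝓞 F`-module, inverses of admissible multipliers
also preserve the set of pairs. -/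
theorem inv_sub_one_mul_mem {c : F ≃ₐ[ℚ] F} {𝔞 : (FractionalIdeal (𝓞 F)⁰ F)ˣ} {κ : ℕ+}
    {u : (𝓞 F)ˣ} (hu : ∀ y ∈ dualL c 𝔞 κ, (((u : 𝓞 F) : F) - 1) * y ∈ latticeL 𝔞) :
    ∀ y ∈ dualL c 𝔞 κ, ((((u⁻¹ : (𝓞 F)ˣ) : 𝓞 F) : F) - 1) * y ∈ latticeL 𝔞 := by
  intro y hy
  have h := neg_mem (mul_mem_latticeL ((u⁻¹ : (𝓞 F)ˣ) : 𝓞 F) (hu y hy))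
  have h1 : (((u⁻¹ : (𝓞 F)ˣ) : 𝓞 F) : F) * ((u : 𝓞 F) : F) = 1 := by
    rw [← map_mul, Units.inv_mul, map_one]
  convert h using 1
  linear_combination y * h1

/-- The action of an admissible unit on pairs. -/
noncomputable def unitPairEquiv {c : F ≃ₐ[ℚ] F} {𝔞 : (FractionalIdeal (𝓞 F)⁰ F)ˣ} {κ : ℕ+}
    (hLd : latticeL 𝔞 ≤ dualL c 𝔞 κ) (u : (𝓞 F)ˣ)
    (hu : ∀ y ∈ dualL c 𝔞 κ, (((u : 𝓞 F) : F) - 1) * y ∈ latticeL 𝔞) :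
    pairSet c 𝔞 κ ≃ pairSet c 𝔞 κ where
  toFun p := ⟨_, mul_fst_mem_pairSet hLd hu p.2⟩
  invFun p := ⟨_, mul_fst_mem_pairSet hLd (inv_sub_one_mul_mem hu) p.2⟩
  left_inv p := by
    have h1 : (((u⁻¹ : (𝓞 F)ˣ) : 𝓞 F) : F) * ((u : 𝓞 F) : F) = 1 := by
      rw [← map_mul, Units.inv_mul, map_one]
    refine Subtype.ext (Prod.ext ?_ ?_)
    · simp only [← mul_assoc, h1, one_mul]
    · simp only [one_mul]
  right_inv p := by
    have h1 : ((u : 𝓞 F) : F) * (((u⁻¹ : (𝓞 F)ˣ) : 𝓞 F) : F) = 1 := by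
      rw [← map_mul, Units.mul_inv, map_one]
    refine Subtype.ext (Prod.ext ?_ ?_)
    · simp only [← mul_assoc, h1, one_mul]
    · simp only [one_mul]

/-- Periodicity of the theta integrals under an admissible unit. -/
theorem stripIntegral_add_log (hF : Module.finrank ℚ F = 2) {c : F ≃ₐ[ℚ] F} (hc : c ≠ 1)
    (σ : F →+* ℝ) {𝔞 : (FractionalIdeal (𝓞 F)⁰ F)ˣ} {κ : ℕ+} {R : Matrix (Fin 4) (Fin 4) ℝ}
    (φ : (Fin 4 → ℤ) ≃ pairSet c 𝔞 κ)
    (hφ : ∀ m : Fin 4 → ℤ, (R.mulVec fun i => (m i : ℝ)) = pairVec (levelN 𝔞 κ) σ c (φ m))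
    {x : ℝ} (hx : x ∈ admissibleUnits σ c 𝔞 κ)
    {K : (Fin 4 → ℝ) → ℝ → ℝ → ℝ → ℝ → ℂ}
    (hK : ∀ a b l u v t s, K (boost a b l) u v t s = K l u v (t + a) (s + b)) (t s : ℝ) :
    stripIntegral R K (t + Real.log x) s = stripIntegral R K t s := by
  obtain ⟨u, hu, hux, hx1, huL⟩ := hx
  have hx0 : 0 < x := by linarith
  have hcu : σ (c ((u : 𝓞 F) : F)) = x⁻¹ := by
    have := congrArg σ (totPos_unit_mul_conj hF hc σ hu)
    rw [map_mul, hux, map_one] at this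
    exact eq_inv_of_mul_eq_one_right this
  have hLd := latticeL_le_dualL hF hc σ 𝔞 κ
  let ψ : (Fin 4 → ℤ) ≃ (Fin 4 → ℤ) := (φ.trans (unitPairEquiv hLd u huL)).trans φ.symm
  -- The unit scales `λ₁` by `x` and `λ₁'` by `x⁻¹` and fixes `λ₂`, which is the boost with `a =
  -- -log x` and `b = 0`.
  have hψ : ∀ m, (R.mulVec fun i => (ψ m i : ℝ)) =
      boost (-Real.log x) 0 (R.mulVec fun i => (m i : ℝ)) := by
    intro m
    rw [hφ, hφ]
    have : φ (ψ m) = unitPairEquiv hLd u huL (φ m) := by simp [ψ]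
    rw [this]
    refine pairVec_mul σ c _ _ ?_ ?_ ?_ ?_ _
    · rw [neg_neg, Real.exp_log hx0, hux, mul_comm]
    · rw [Real.exp_neg, Real.exp_log hx0, hcu, mul_comm]
    · simp
    · simp
  rw [stripIntegral_boost ψ hψ (hK _ _)]
  simp

/-- The theta function as a sum over `ℤ⁴`. -/
theorem thetaM_eq_thetaSum (σ : F →+* ℝ) {c : F ≃ₐ[ℚ] F} {𝔞 : (FractionalIdeal (𝓞 F)⁰ F)ˣ}
    {κ : ℕ+} {R : Matrix (Fin 4) (Fin 4) ℝ} (φ : (Fin 4 → ℤ) ≃ pairSet c 𝔞 κ)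
    (hφ : ∀ m : Fin 4 → ℤ, (R.mulVec fun i => (m i : ℝ)) = pairVec (levelN 𝔞 κ) σ c (φ m))
    (τ : ℍ) (t s : ℝ) : thetaM σ c 𝔞 κ τ t s = thetaSum R kernelXQ τ.re τ.im t s := by
  rw [thetaM, thetaSum, ← (φ.trans (pairSetEquiv c 𝔞 κ)).tsum_eq]
  simp only [Equiv.trans_apply, latticeTerm_pairSetEquiv, hφ]

theorem summable_latticeTerm (σ : F →+* ℝ) {c : F ≃ₐ[ℚ] F} {𝔞 : (FractionalIdeal (𝓞 F)⁰ F)ˣ}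
    {κ : ℕ+} {R : Matrix (Fin 4) (Fin 4) ℝ} (hR : IsUnit R.det) (φ : (Fin 4 → ℤ) ≃ pairSet c 𝔞 κ)
    (hφ : ∀ m : Fin 4 → ℤ, (R.mulVec fun i => (m i : ℝ)) = pairVec (levelN 𝔞 κ) σ c (φ m))
    (τ : ℍ) (t s : ℝ) : Summable (latticeTerm σ c 𝔞 κ τ t s) := by
  rw [← (φ.trans (pairSetEquiv c 𝔞 κ)).summable_iff]
  have h := isThetaKernel_kernelXQ.summable hR (u := τ.re) (t := t) (s := s) τ.im_pos
  refine h.congr fun m => ?_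
  simp only [Function.comp_apply, Equiv.trans_apply, latticeTerm_pairSetEquiv, hφ]

theorem thetaIntegral_eq_stripIntegral (σ : F →+* ℝ) {c : F ≃ₐ[ℚ] F}
    {𝔞 : (FractionalIdeal (𝓞 F)⁰ F)ˣ} {κ : ℕ+} {R : Matrix (Fin 4) (Fin 4) ℝ}
    (φ : (Fin 4 → ℤ) ≃ pairSet c 𝔞 κ)
    (hφ : ∀ m : Fin 4 → ℤ, (R.mulVec fun i => (m i : ℝ)) = pairVec (levelN 𝔞 κ) σ c (φ m))
    (t s : ℝ) : thetaIntegral σ c 𝔞 κ t s = stripIntegral R kernelXQ t s := by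
  simp only [thetaIntegral, thetaIntegrand, thetaM_eq_thetaSum σ φ hφ]
  exact setIntegral_fd fun u v => thetaSum R kernelXQ u v t s

theorem cycleIntegral_eq (σ : F →+* ℝ) {c : F ≃ₐ[ℚ] F}
    {𝔞 : (FractionalIdeal (𝓞 F)⁰ F)ˣ} {κ : ℕ+} {R : Matrix (Fin 4) (Fin 4) ℝ}
    (φ : (Fin 4 → ℤ) ≃ pairSet c 𝔞 κ)
    (hφ : ∀ m : Fin 4 → ℤ, (R.mulVec fun i => (m i : ℝ)) = pairVec (levelN 𝔞 κ) σ c (φ m))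
    (s : ℝ) : cycleIntegral σ c 𝔞 κ s =
      ∫ t in (0 : ℝ)..Real.log (epsilon σ c 𝔞 κ), stripIntegral R kernelXQ t s := by
  simp only [cycleIntegral, thetaIntegral_eq_stripIntegral σ φ hφ]

/-- The cycle integral does not depend on `t₀`. -/
theorem cycleIntegral_const (hF : Module.finrank ℚ F = 2) {c : F ≃ₐ[ℚ] F} (hc : c ≠ 1)
    (σ : F →+* ℝ) (𝔞 : (FractionalIdeal (𝓞 F)⁰ F)ˣ) (κ : ℕ+) (s₁ s₂ : ℝ) :
    cycleIntegral σ c 𝔞 κ s₁ = cycleIntegral σ c 𝔞 κ s₂ := by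
  obtain ⟨R, φ, hR, hφ⟩ := exists_frame hF hc σ 𝔞 κ
  rw [cycleIntegral_eq σ φ hφ, cycleIntegral_eq σ φ hφ]
  refine integral_stripIntegral_const hR (fun s => ?_) s₁ s₂
  have := stripIntegral_add_log hF hc σ φ hφ (isLeast_epsilon hF hc σ 𝔞 κ).1 kernelPY_boost 0 s
  rwa [zero_add] at this

theorem periodic_thetaIntegral (hF : Module.finrank ℚ F = 2) {c : F ≃ₐ[ℚ] F} (hc : c ≠ 1)
    (σ : F →+* ℝ) (𝔞 : (FractionalIdeal (𝓞 F)⁰ F)ˣ) (κ : ℕ+) (s : ℝ) :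
    Function.Periodic (fun t => thetaIntegral σ c 𝔞 κ t s) (Real.log (epsilon σ c 𝔞 κ)) := by
  obtain ⟨R, φ, hR, hφ⟩ := exists_frame hF hc σ 𝔞 κ
  intro t
  simp only [thetaIntegral_eq_stripIntegral σ φ hφ]
  exact stripIntegral_add_log hF hc σ φ hφ (isLeast_epsilon hF hc σ 𝔞 κ).1 kernelXQ_boost t s

/-! ### Change of the ideal in its narrow class -/

theorem mul_mem_latticeL_iff {𝔞 𝔟 : (FractionalIdeal (𝓞 F)⁰ F)ˣ} {μ : Fˣ}
    (h : 𝔟 = toPrincipalIdeal (𝓞 F) F μ * 𝔞) (x : F) : (μ : F) * x ∈ latticeL 𝔟 ↔ x ∈ latticeL 𝔞 := by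
  rw [mem_latticeL, mem_latticeL, h, Units.val_mul, coe_toPrincipalIdeal,
    FractionalIdeal.mem_singleton_mul]
  constructor
  · rintro ⟨y, hy, hxy⟩
    rwa [mul_left_cancel₀ μ.ne_zero hxy]
  · exact fun hx => ⟨x, hx, rfl⟩

/-- Total positivity makes `Nm μ` positive, so no absolute value appears and multiplication by `μ`
is an isometry for the rescaled forms. -/
theorem levelN_principal_mul (hF : Module.finrank ℚ F = 2) {c : F ≃ₐ[ℚ] F} (hc : c ≠ 1)
    (σ : F →+* ℝ) {𝔞 𝔟 : (FractionalIdeal (𝓞 F)⁰ F)ˣ} {μ : Fˣ} (hμ : TotPos (μ : F))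
    (h : 𝔟 = toPrincipalIdeal (𝓞 F) F μ * 𝔞) (κ : ℕ+) :
    (levelN 𝔟 κ : ℝ) = levelN 𝔞 κ * (σ μ * σ (c μ)) := by
  have h1 := congrArg σ (norm_eq_mul_conj hF hc (μ : F))
  rw [map_ratCast, map_mul] at h1
  have h2 : 0 < σ μ * σ (c μ) := mul_pos (hμ σ) (hμ (σ.comp (c : F →+* F)))
  have h3 : (0 : ℚ) < Algebra.norm ℚ (μ : F) := by
    rw [← h1] at h2
    exact_mod_cast h2
  rw [levelN, levelN, h, Units.val_mul, coe_toPrincipalIdeal, map_mul,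
    FractionalIdeal.absNorm_span_singleton, abs_of_pos h3, ← h1]
  push_cast
  ring

theorem mul_mem_dualL_iff (hF : Module.finrank ℚ F = 2) {c : F ≃ₐ[ℚ] F} (hc : c ≠ 1)
    (σ : F →+* ℝ) {𝔞 𝔟 : (FractionalIdeal (𝓞 F)⁰ F)ˣ} {μ : Fˣ} (hμ : TotPos (μ : F))
    (h : 𝔟 = toPrincipalIdeal (𝓞 F) F μ * 𝔞) (κ : ℕ+) (x : F) :
    (μ : F) * x ∈ dualL c 𝔟 κ ↔ x ∈ dualL c 𝔞 κ := by
  have key : ∀ y, fieldForm c (levelN 𝔟 κ) (μ * x) (μ * y) = fieldForm c (levelN 𝔞 κ) x y := by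
    intro y
    have h2 : σ μ * σ (c μ) ≠ 0 := (mul_pos (hμ σ) (hμ (σ.comp (c : F →+* F)))).ne'
    have : ((fieldForm c (levelN 𝔟 κ) (μ * x) (μ * y) : ℚ) : ℝ) =
        ((fieldForm c (levelN 𝔞 κ) x y : ℚ) : ℝ) := by
      rw [ratCast_fieldForm hF hc _ σ, ratCast_fieldForm hF hc _ σ,
        levelN_principal_mul hF hc σ hμ h, ← mul_div_mul_right _ (levelN 𝔞 κ : ℝ) h2]
      simp only [map_mul]
      congr 1
      ring
    exact_mod_cast this
  constructor
  · intro hx y hy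
    rw [← key]
    exact hx _ ((mul_mem_latticeL_iff h y).mpr hy)
  · intro hx y hy
    obtain ⟨z, rfl⟩ : ∃ z, y = μ * z := ⟨(μ : F)⁻¹ * y, by field_simp⟩
    rw [key]
    exact hx _ ((mul_mem_latticeL_iff h z).mp hy)

/-- The condition `w L^∨ ⊆ L` is unchanged when both lattices are multiplied by `μ`. -/
theorem epsilon_principal_mul (hF : Module.finrank ℚ F = 2) {c : F ≃ₐ[ℚ] F} (hc : c ≠ 1)
    (σ : F →+* ℝ) {𝔞 𝔟 : (FractionalIdeal (𝓞 F)⁰ F)ˣ} {μ : Fˣ} (hμ : TotPos (μ : F))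
    (h : 𝔟 = toPrincipalIdeal (𝓞 F) F μ * 𝔞) (κ : ℕ+) :
    epsilon σ c 𝔟 κ = epsilon σ c 𝔞 κ := by
  have key : ∀ w : F, (∀ y ∈ dualL c 𝔟 κ, w * y ∈ latticeL 𝔟) ↔
      ∀ y ∈ dualL c 𝔞 κ, w * y ∈ latticeL 𝔞 := by
    intro w
    constructor
    · intro H y hy
      have := H _ ((mul_mem_dualL_iff hF hc σ hμ h κ y).mpr hy)
      rwa [mul_left_comm, mul_mem_latticeL_iff h] at this
    · intro H y hy
      obtain ⟨z, rfl⟩ : ∃ z, y = μ * z := ⟨(μ : F)⁻¹ * y, by field_simp⟩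
      rw [mul_left_comm, mul_mem_latticeL_iff h]
      exact H z ((mul_mem_dualL_iff hF hc σ hμ h κ z).mp hy)
  simp only [epsilon, admissibleUnits, key]

/-- Multiplication by `μ` on pairs. -/
noncomputable def mulPairEquiv (hF : Module.finrank ℚ F = 2) {c : F ≃ₐ[ℚ] F} (hc : c ≠ 1)
    (σ : F →+* ℝ) {𝔞 𝔟 : (FractionalIdeal (𝓞 F)⁰ F)ˣ} {μ : Fˣ} (hμ : TotPos (μ : F))
    (h : 𝔟 = toPrincipalIdeal (𝓞 F) F μ * 𝔞) (κ : ℕ+) : pairSet c 𝔞 κ ≃ pairSet c 𝔟 κ :=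
  ((Equiv.mulLeft₀ (μ : F) μ.ne_zero).prodCongr (Equiv.mulLeft₀ (μ : F) μ.ne_zero)).subtypeEquiv <| by
    rintro ⟨x, y⟩
    change (x ∈ dualL c 𝔞 κ ∧ y ∈ dualL c 𝔞 κ ∧ x - y ∈ latticeL 𝔞) ↔
      ((μ : F) * x ∈ dualL c 𝔟 κ ∧ (μ : F) * y ∈ dualL c 𝔟 κ ∧ (μ : F) * x - μ * y ∈ latticeL 𝔟)
    rw [← mul_sub, mul_mem_latticeL_iff h, mul_mem_dualL_iff hF hc σ hμ h,
      mul_mem_dualL_iff hF hc σ hμ h]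

theorem exists_thetaIntegral_principal_mul (hF : Module.finrank ℚ F = 2) {c : F ≃ₐ[ℚ] F}
    (hc : c ≠ 1) (σ : F →+* ℝ) {𝔞 𝔟 : (FractionalIdeal (𝓞 F)⁰ F)ˣ} {μ : Fˣ} (hμ : TotPos (μ : F))
    (h : 𝔟 = toPrincipalIdeal (𝓞 F) F μ * 𝔞) (κ : ℕ+) :
    ∃ a : ℝ, ∀ t s, thetaIntegral σ c 𝔟 κ t s = thetaIntegral σ c 𝔞 κ (t + a) (s + a) := by
  obtain ⟨R, φ, hR, hφ⟩ := exists_frame hF hc σ 𝔞 κ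
  obtain ⟨R', φ', hR', hφ'⟩ := exists_frame hF hc σ 𝔟 κ
  have hx : 0 < σ μ := hμ σ
  have hy : 0 < σ (c μ) := hμ (σ.comp (c : F →+* F))
  have hN := levelN_pos_real 𝔞 κ
  have hN' := levelN_principal_mul hF hc σ hμ h κ
  -- After division by `√(μ μ')`, multiplication by `μ` scales by `√(μ / μ') = e^{-a}` and its
  -- conjugate by `e^a`. It acts alike on `λ₁` and `λ₂`, so both parameters shift by `a`.
  set a := Real.log (√(σ (c μ)) / √(σ μ))
  have hx' : 0 < √(σ μ) := Real.sqrt_pos.mpr hx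
  have hy' : 0 < √(σ (c μ)) := Real.sqrt_pos.mpr hy
  have hn' : 0 < √(levelN 𝔞 κ : ℝ) := Real.sqrt_pos.mpr hN
  have ha : Real.exp a = √(σ (c μ)) / √(σ μ) := Real.exp_log (by positivity)
  have ha' : Real.exp (-a) = √(σ μ) / √(σ (c μ)) := by rw [Real.exp_neg, ha, inv_div]
  have h1 : (√(levelN 𝔟 κ : ℝ))⁻¹ * σ μ = Real.exp (-a) * (√(levelN 𝔞 κ : ℝ))⁻¹ := by
    rw [ha', hN', Real.sqrt_mul hN.le, Real.sqrt_mul hx.le]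
    have := Real.mul_self_sqrt hx.le
    field_simp
    linear_combination -this
  have h2 : (√(levelN 𝔟 κ : ℝ))⁻¹ * σ (c μ) = Real.exp a * (√(levelN 𝔞 κ : ℝ))⁻¹ := by
    rw [ha, hN', Real.sqrt_mul hN.le, Real.sqrt_mul hx.le]
    have := Real.mul_self_sqrt hy.le
    field_simp
    linear_combination -this
  let ψ : (Fin 4 → ℤ) ≃ (Fin 4 → ℤ) := (φ.trans (mulPairEquiv hF hc σ hμ h κ)).trans φ'.symm
  have hψ : ∀ m, (R'.mulVec fun i => (ψ m i : ℝ)) = boost a a (R.mulVec fun i => (m i : ℝ)) := by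
    intro m
    rw [hφ, hφ']
    have : φ' (ψ m) = mulPairEquiv hF hc σ hμ h κ (φ m) := by simp [ψ]
    rw [this]
    exact pairVec_mul σ c _ _ h1 h2 h1 h2 _
  refine ⟨a, fun t s => ?_⟩
  rw [thetaIntegral_eq_stripIntegral σ φ hφ, thetaIntegral_eq_stripIntegral σ φ' hφ',
    stripIntegral_boost ψ hψ (kernelXQ_boost a a)]

/-- The shift in `t₀` is harmless because the cycle integral is constant in it, and the shift in `t`
because the integral runs over a full period. -/
theorem cycleIntegral_principal_mul (hF : Module.finrank ℚ F = 2) {c : F ≃ₐ[ℚ] F}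
    (hc : c ≠ 1) (σ : F →+* ℝ) {𝔞 𝔟 : (FractionalIdeal (𝓞 F)⁰ F)ˣ} {μ : Fˣ} (hμ : TotPos (μ : F))
    (h : 𝔟 = toPrincipalIdeal (𝓞 F) F μ * 𝔞) (κ : ℕ+) (s s' : ℝ) :
    cycleIntegral σ c 𝔟 κ s = cycleIntegral σ c 𝔞 κ s' := by
  obtain ⟨a, ha⟩ := exists_thetaIntegral_principal_mul hF hc σ hμ h κ
  rw [cycleIntegral_const hF hc σ 𝔞 κ s' (s + a), cycleIntegral, cycleIntegral,
    epsilon_principal_mul hF hc σ hμ h]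
  simp only [ha]
  have hp := periodic_thetaIntegral hF hc σ 𝔞 κ (s + a)
  rw [intervalIntegral.integral_comp_add_right fun t => thetaIntegral σ c 𝔞 κ t (s + a)]
  have := hp.intervalIntegral_add_eq a 0
  rw [zero_add] at this
  rw [zero_add (a : ℝ)]
  rw [add_comm (Real.log _) a, this]

theorem narrowClass_eq_iff {𝔞 𝔟 : (FractionalIdeal (𝓞 F)⁰ F)ˣ} :
    narrowClass 𝔞 = narrowClass 𝔟 ↔
      ∃ μ : Fˣ, TotPos (μ : F) ∧ 𝔟 = toPrincipalIdeal (𝓞 F) F μ * 𝔞 := by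
  rw [narrowClass, narrowClass, QuotientGroup.eq, Subgroup.mem_map]
  constructor
  · rintro ⟨μ, hμ, h⟩
    exact ⟨μ, hμ, by rw [h, mul_comm, mul_inv_cancel_left]⟩
  · rintro ⟨μ, hμ, rfl⟩
    exact ⟨μ, hμ, by rw [mul_comm, mul_inv_cancel_right]⟩

end Symmetry

/-- Here `F` is a real quadratic field with a real embedding `σ` and Galois conjugation `c`. The
first part says that the cycle integral is well defined, the second part that it is constant in
`t₀` and depends only on the narrow ideal class of `𝔞` and on `κ`. -/
theorem proposition2p1 {F : Type*} [Field F] [NumberField F]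
    (hF : Module.finrank ℚ F = 2) (σ : F →+* ℝ) (c : F ≃ₐ[ℚ] F) (hc : c ≠ 1) :
    (∀ (𝔞 : (FractionalIdeal (𝓞 F)⁰ F)ˣ) (κ : ℕ+),
      IsLeast (admissibleUnits σ c 𝔞 κ) (epsilon σ c 𝔞 κ) ∧
      ∀ t₀ : ℝ,
        (∀ (t : ℝ) (τ : ℍ), Summable (latticeTerm σ c 𝔞 κ τ t t₀)) ∧
        (∀ (t : ℝ) (γ : SL(2, ℤ)) (τ : ℍ),
          thetaIntegrand σ c 𝔞 κ t t₀ (γ • τ) = thetaIntegrand σ c 𝔞 κ t t₀ τ) ∧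
        (∀ t : ℝ, IntegrableOn (thetaIntegrand σ c 𝔞 κ t t₀) 𝒟) ∧
        Function.Periodic (fun t => thetaIntegral σ c 𝔞 κ t t₀)
          (Real.log (epsilon σ c 𝔞 κ)) ∧
        IntervalIntegrable (fun t => thetaIntegral σ c 𝔞 κ t t₀) volume 0
          (Real.log (epsilon σ c 𝔞 κ))) ∧
    ∃ C : NarrowClassGroup F → ℕ+ → ℂ,
      ∀ (𝔞 : (FractionalIdeal (𝓞 F)⁰ F)ˣ) (κ : ℕ+) (t₀ : ℝ),
        cycleIntegral σ c 𝔞 κ t₀ = C (narrowClass 𝔞) κ := by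
  refine ⟨fun 𝔞 κ => ⟨isLeast_epsilon hF hc σ 𝔞 κ, fun s => ?_⟩, ?_⟩
  · obtain ⟨R, φ, hR, hφ⟩ := exists_frame hF hc σ 𝔞 κ
    refine ⟨fun t τ => summable_latticeTerm σ hR.isUnit_det φ hφ τ t s, fun t γ τ => ?_,
      fun t => ?_, periodic_thetaIntegral hF hc σ 𝔞 κ s, ?_⟩
    · simp only [thetaIntegrand, thetaM_eq_thetaSum σ φ hφ]
      exact im_sq_mul_thetaSum_smul hR t s γ τ
    · have h : thetaIntegrand σ c 𝔞 κ t s =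
          fun τ : ℍ => (τ.im : ℂ) ^ 2 * thetaSum R kernelXQ τ.re τ.im t s := by
        funext τ
        rw [thetaIntegrand, thetaM_eq_thetaSum σ φ hφ]
      rw [h]
      exact integrableOn_fd (h := fun u v => thetaSum R kernelXQ u v t s)
        (isThetaKernel_kernelXQ.integrableOn_halfStrip hR.isUnit_det t s)
    · simp only [thetaIntegral_eq_stripIntegral σ φ hφ]
      have hcont := isThetaKernel_kernelXQ.continuous_stripIntegral hR.isUnit_det
      exact (hcont.comp (continuous_id.prodMk continuous_const)).intervalIntegrable _ _
  -- `C` is read off at a chosen representative of the class and at `t₀ = 0`; neither choice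
  -- matters.
  · refine ⟨fun cl κ => cycleIntegral σ c (Quotient.out cl) κ 0, fun 𝔞 κ s => ?_⟩
    have h : narrowClass (Quotient.out (narrowClass 𝔞)) = narrowClass 𝔞 :=
      Quotient.out_eq (narrowClass 𝔞)
    obtain ⟨μ, hμ, hab⟩ := narrowClass_eq_iff.mp h
    exact cycleIntegral_principal_mul hF hc σ hμ hab κ s 0
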